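/- Let $\Bbbk$ be a commutative ring and $n\ge 0$ an integer. *Pruned trees.* Let $\Omega=\Omega_n^{epi}$ be the category whose objects $\tau$ are the sequences of non-decreasing surjections $\underline t_0\xrightarrow{\tau_1}\underline t_1\to\cdots\xrightarrow{\tau_n}\underline t_n=\underline 1$, where $\underline r=\{1<\dots<r\}$, and whose morphisms $u:\tau\to\sigma$ are the sequences of surjections $u:\underline t_i\to\underline s_i$ that commute with the structure maps and are non-decreasing on each fibre $\tau_{i+1}^{-1}(x)$, $x\in\underline t_{i+1}$. Put $\deg\tau=t_0+\dots+t_{n-1}$ and $\deg u=\deg\tau-\deg\sigma$ for $u:\tau\to\sigma$. *Signs.* A morphism $u:\tau\to\sigma$ of degree $1$ identifies exactly one pair of vertices $a,b$ of $\tau$. Attach a symbol of degree $1$ to each vertex of level $<n$ of a tree (the elements of $\underline t_i$ are the vertices of level $i$, and the root is the vertex of level $n$), and order these symbols by traversing the tree from the root upwards and from left to right (each vertex comes before the vertices above it). The sign $\operatorname{sgn}(u)=\pm1$ is the product of the Koszul sign of the permutation that moves $a,b$ (in this order) to the front of the tensor of the symbols of $\tau$ and, after $a\otimes b$ has been replaced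 by one merged symbol of degree $1$, of the Koszul sign of the permutation that puts the factors in the order given by $\sigma$. *Diagrams.* A dg-module is a $\mathbb Z$-graded $\Bbbk$-module with a differential of degree $-1$; it is cofibrant if it is so in the projective model structure, i.e. $0\to C$ has the left lifting property with respect to the quasi-isomorphisms that are surjective in every degree. A diagram of dg-modules on $\Omega$ is dg-cofibrant if all its values are cofibrant dg-modules. For $S$ contravariant and $T$ covariant let $S\otimes_\Omega T=\int^{\tau}S(\tau)\otimes T(\tau)$. A cofibrant replacement of $S$ is an objectwise quasi-isomorphism $q:Q_S\to S$ of contravariant diagrams, with $Q_S$ cofibrant in the projective model structure (the one whose weak equivalences and fibrations are the objectwise quasi-isomorphisms and the objectwise surjections), and $\operatorname{Tor}^{\Omega}_*(S,T)=H_*(Q_S\otimes_\Omega T)$. *The Koszul complex.* Let $$K(S,\Omega,T)=\bigoplus_{u:\tau\to\sigma}S(\sigma)\otimes\Bbbk\{u\}\otimes T(\tau),\qquad \deg(x\otimes\{u\}\otimes y)=\deg x+\deg u+\deg y,$$ with the differential $$\begin{aligned}d(x\otimes\{u\}\otimes y)={}&\delta x\otimes\{u\}\otimes y+(-1)^{\deg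 x+\deg u}\,x\otimes\{u\}\otimes\delta y\\&+\sum_{u=vw,\ \deg v=1}(-1)^{\deg x}\operatorname{sgn}(v)\,v^*(x)\otimes\{w\}\otimes y\\&+\sum_{u=vw,\ \deg w=1}(-1)^{\deg x+\deg v}\operatorname{sgn}(w)\,x\otimes\{v\}\otimes w_*(y).\end{aligned}$$ **Theorem.** For all diagrams $S$ (contravariant) and $T$ (covariant) of dg-modules on $\Omega_n^{epi}$ one has $d^2=0$, so that $K(S,\Omega_n^{epi},T)$ is a dg-module. Every dg-cofibrant $S$ has a cofibrant replacement. For $S$ and $T$ dg-cofibrant and every cofibrant replacement $Q_S$ of $S$ there are isomorphisms of $\Bbbk$-modules $$\operatorname{Tor}^{\Omega_n^{epi}}_i(S,T)=H_i(Q_S\otimes_{\Omega_n^{epi}}T)\;\cong\;H_i\bigl(K(S,\Omega_n^{epi},T)\bigr),\qquad i\in\mathbb Z,$$ natural in $S$, $T$ and $Q_S$: they commute with the maps induced by morphisms $f:S\to S'$, $g:T\to T'$ and $\tilde f:Q_S\to Q_{S'}$ such that $q'\tilde f=fq$. -/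

import Mathlib

open CategoryTheory Opposite
open scoped TensorProduct DirectSum

universe u

/-! ### The category of pruned trees with `n` levels -/

/-- A pruned tree with `n` levels: a sequence of non-decreasing surjections
`t₀ → t₁ → ⋯ → tₙ = *` between the ordinals `tᵢ = Fin (card i)`. -/
structure PrunedTree (n : ℕ) where
  card : Fin (n + 1) → ℕ
  map : ∀ i : Fin n, Fin (card i.castSucc) → Fin (card i.succ)
  map_monotone : ∀ i, Monotone (map i)
  map_surjective : ∀ i, Function.Surjective (map i)
  card_last : card (Fin.last n) = 1

namespace PrunedTree

variable {n : ℕ}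

/-- A morphism of pruned trees: a sequence of surjections commuting with the structure maps,
and non-decreasing on each fibre of the structure maps. -/
@[ext]
structure Hom (τ σ : PrunedTree n) where
  app : ∀ i : Fin (n + 1), Fin (τ.card i) → Fin (σ.card i)
  surjective : ∀ i, Function.Surjective (app i)
  comm : ∀ (i : Fin n) (x : Fin (τ.card i.castSucc)),
    app i.succ (τ.map i x) = σ.map i (app i.castSucc x)
  mono : ∀ (i : Fin n) (x y : Fin (τ.card i.castSucc)),
    τ.map i x = τ.map i y → x ≤ y → app i.castSucc x ≤ app i.castSucc y

instance : Category (PrunedTree n) where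
  Hom := Hom
  id τ :=
    { app := fun _ x => x
      surjective := fun _ x => ⟨x, rfl⟩
      comm := fun _ _ => rfl
      mono := fun _ _ _ _ h => h }
  comp u v :=
    { app := fun i x => v.app i (u.app i x)
      surjective := fun i => (v.surjective i).comp (u.surjective i)
      comm := fun i x => by rw [u.comm, v.comm]
      mono := fun i x y h hxy =>
        v.mono i _ _ (by rw [← u.comm, ← u.comm, h]) (u.mono i x y h hxy) }

/-- The degree of a tree: its number of vertices of level `< n`. -/
def degree (τ : PrunedTree n) : ℕ := ∑ i : Fin n, τ.card i.castSucc

/-- The degree of a morphism, `deg u = deg τ - deg σ`. -/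
def homDeg {τ σ : PrunedTree n} (_ : τ ⟶ σ) : ℤ := (τ.degree : ℤ) - σ.degree

lemma homDeg_comp {τ θ σ : PrunedTree n} (w : τ ⟶ θ) (v : θ ⟶ σ) :
    homDeg (w ≫ v) = homDeg w + homDeg v := by
  simp only [homDeg]; ring

lemma card_le {τ σ : PrunedTree n} (u : τ ⟶ σ) (i : Fin (n + 1)) : σ.card i ≤ τ.card i := by
  simpa using Fintype.card_le_of_surjective _ (Hom.surjective u i)

/-! ### Signs of the morphisms of degree one -/

/-- The vertices of a tree, including the root (of level `n`). -/
abbrev Vertex (τ : PrunedTree n) : Type := Σ i : Fin (n + 1), Fin (τ.card i)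

/-- `τ.Parent y z`: the vertex `z` is the target of the edge that starts at `y`. -/
def Parent (τ : PrunedTree n) (y z : τ.Vertex) : Prop :=
  ∃ (i : Fin n) (x : Fin (τ.card i.castSucc)), y = ⟨i.castSucc, x⟩ ∧ z = ⟨i.succ, τ.map i x⟩

/-- `τ.Ancestor y z`: the vertex `z` is `y` or lies on the path from `y` to the root. -/
def Ancestor (τ : PrunedTree n) : τ.Vertex → τ.Vertex → Prop :=
  Relation.ReflTransGen τ.Parent

/-- The order in which the vertices are met when the tree is traversed vertex by vertex, along
the edges from the root upwards, then from left to right: `y` comes before `z` if `y` is a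
proper ancestor of `z`, or if the branch of `y` lies to the left of the branch of `z`. -/
def Before (τ : PrunedTree n) (y z : τ.Vertex) : Prop :=
  (y ≠ z ∧ τ.Ancestor z y) ∨
    ∃ (j : Fin (n + 1)) (a b : Fin (τ.card j)),
      a < b ∧ τ.Ancestor y ⟨j, a⟩ ∧ τ.Ancestor z ⟨j, b⟩

/-- The action of a morphism on vertices. -/
def onVertex {τ σ : PrunedTree n} (u : τ ⟶ σ) (y : τ.Vertex) : σ.Vertex :=
  ⟨y.1, Hom.app u y.1 y.2⟩

open Classical in
/-- The vertices of level `< n`, each of which carries a symbol of degree one. -/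
noncomputable def innerVertices (τ : PrunedTree n) : Finset τ.Vertex :=
  Finset.univ.filter fun y => y.1 ≠ Fin.last n

open Classical in
/-- The exponent of the Koszul sign of the merging of `a` and `b` (with `a` before `b`). All
symbols have degree one. The first two terms count the transpositions that move `a`, then `b`,
to the front of the tensor of `τ`. Once `a ⊗ b` has been replaced by the merged vertex, the last
two terms count the transpositions that reorder the factors according to the target `σ`:
inversions between the merged vertex and another one, and inversions between two others. -/
noncomputable def mergeExponent {τ σ : PrunedTree n} (u : τ ⟶ σ) (a b : τ.Vertex) : ℕ :=
  (τ.innerVertices.filter fun y => τ.Before y a).card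
  + (τ.innerVertices.filter fun y => y ≠ a ∧ τ.Before y b).card
  + (τ.innerVertices.filter fun y =>
      y ≠ a ∧ y ≠ b ∧ σ.Before (onVertex u y) (onVertex u a)).card
  + ((τ.innerVertices ×ˢ τ.innerVertices).filter fun yz =>
      (yz.1 ≠ a ∧ yz.1 ≠ b) ∧ (yz.2 ≠ a ∧ yz.2 ≠ b) ∧
      τ.Before yz.1 yz.2 ∧ σ.Before (onVertex u yz.2) (onVertex u yz.1)).card

open Classical in
/-- The sign of a morphism of degree one. Such a morphism merges exactly one pair of vertices
`(a, b)` with `a` before `b`, so that the product has exactly one factor. -/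
noncomputable def sgn {τ σ : PrunedTree n} (u : τ ⟶ σ) : ℤˣ :=
  ∏ ab ∈ (τ.innerVertices ×ˢ τ.innerVertices).filter
      (fun ab => τ.Before ab.1 ab.2 ∧ onVertex u ab.1 = onVertex u ab.2),
    (-1 : ℤˣ) ^ mergeExponent u ab.1 ab.2

/-! ### Factorizations -/

/-- A factorization `u = v w` in the category of pruned trees, with `w = right`, applied first,
and `v = left`. -/
structure Factorization {τ σ : PrunedTree n} (u : τ ⟶ σ) where
  mid : PrunedTree n
  right : τ ⟶ mid
  left : mid ⟶ σ
  fac : right ≫ left = u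

lemma Factorization.homDeg_eq {τ σ : PrunedTree n} {u : τ ⟶ σ} (f : Factorization u) :
    homDeg u = homDeg f.right + homDeg f.left := by
  rw [← homDeg_comp, f.fac]

instance (τ σ : PrunedTree n) : Finite (τ ⟶ σ) :=
  Finite.of_injective
    (fun u : τ ⟶ σ => (Hom.app u : ∀ i : Fin (n + 1), Fin (τ.card i) → Fin (σ.card i)))
    (fun _ _ h => Hom.ext h)

lemma finite_bounded (N : ℕ) : Finite {θ : PrunedTree n // ∀ i, θ.card i < N} := by
  let P : (Σ c : Fin (n + 1) → Fin N,
      ∀ i : Fin n, Fin (c i.castSucc).val → Fin (c i.succ).val) → Prop := fun s =>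
    (∀ i, Monotone (s.2 i)) ∧ (∀ i, Function.Surjective (s.2 i)) ∧
      (s.1 (Fin.last n)).val = 1
  refine Finite.of_surjective (α := {s // P s})
    (fun s => ⟨⟨fun i => (s.1.1 i).val, s.1.2, s.2.1, s.2.2.1, s.2.2.2⟩,
      fun i => (s.1.1 i).isLt⟩) ?_
  rintro ⟨θ, hθ⟩
  exact ⟨⟨⟨fun i => ⟨θ.card i, hθ i⟩, θ.map⟩,
    θ.map_monotone, θ.map_surjective, θ.card_last⟩, rfl⟩

instance {τ σ : PrunedTree n} (u : τ ⟶ σ) : Finite (Factorization u) := by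
  let N := (∑ i, τ.card i) + 1
  have := finite_bounded (n := n) N
  have key : ∀ (θ : PrunedTree n) (_ : τ ⟶ θ) (i : Fin (n + 1)), θ.card i < N := fun θ w i =>
    Nat.lt_succ_of_le ((card_le w i).trans
      (Finset.single_le_sum (f := τ.card) (fun _ _ => Nat.zero_le _) (Finset.mem_univ i)))
  refine Finite.of_injective
    (β := Σ θ : {θ : PrunedTree n // ∀ i, θ.card i < N}, (τ ⟶ θ.1) × (θ.1 ⟶ σ))
    (fun f => ⟨⟨f.mid, key _ f.right⟩, f.right, f.left⟩) ?_
  rintro ⟨θ, w, v, h⟩ ⟨θ', w', v', h'⟩ e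
  simp only [Sigma.mk.injEq, Subtype.mk.injEq] at e
  obtain ⟨rfl, e⟩ := e
  simp only [heq_eq_eq, Prod.mk.injEq] at e
  obtain ⟨rfl, rfl⟩ := e
  rfl

/-- The factorizations `u = v w` with `deg v = 1`. -/
abbrev LeftFactorization {τ σ : PrunedTree n} (u : τ ⟶ σ) :=
  {f : Factorization u // homDeg f.left = 1}

/-- The factorizations `u = v w` with `deg w = 1`. -/
abbrev RightFactorization {τ σ : PrunedTree n} (u : τ ⟶ σ) :=
  {f : Factorization u // homDeg f.right = 1}

noncomputable instance {τ σ : PrunedTree n} (u : τ ⟶ σ) : Fintype (LeftFactorization u) :=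
  Fintype.ofFinite _

noncomputable instance {τ σ : PrunedTree n} (u : τ ⟶ σ) : Fintype (RightFactorization u) :=
  Fintype.ofFinite _

end PrunedTree

/-! ### Diagrams of dg-modules and cofibrancy -/

/-- Dg-modules over `k`: `ℤ`-graded, with a differential of degree `-1`. -/
abbrev DGMod (k : Type u) [CommRing k] := ChainComplex (ModuleCat.{u} k) ℤ

/-- Covariant diagrams of dg-modules on pruned trees. -/
abbrev CovDiagram (k : Type u) [CommRing k] (n : ℕ) := PrunedTree n ⥤ DGMod k

/-- Contravariant diagrams of dg-modules on pruned trees. -/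
abbrev ContraDiagram (k : Type u) [CommRing k] (n : ℕ) := (PrunedTree n)ᵒᵖ ⥤ DGMod k

section Cofibrancy

variable {k : Type u} [CommRing k] {n : ℕ}

/-- The acyclic fibrations of dg-modules: the quasi-isomorphisms that are surjective in every
degree. -/
def IsAcyclicFibration {C D : DGMod k} (p : C ⟶ D) : Prop :=
  (∀ i, Function.Surjective (p.f i)) ∧ QuasiIso p

/-- A dg-module `C` is cofibrant (in the projective model structure) if `0 ⟶ C` has the left
lifting property with respect to the acyclic fibrations. -/
def IsCofibrantDGMod (C : DGMod k) : Prop :=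
  ∀ ⦃X Y : DGMod k⦄ (p : X ⟶ Y), IsAcyclicFibration p →
    ∀ f : C ⟶ Y, ∃ g : C ⟶ X, g ≫ p = f

/-- A diagram of dg-modules is dg-cofibrant if all its values are cofibrant dg-modules. -/
def IsDGCofibrant {J : Type} [SmallCategory J] (F : J ⥤ DGMod k) : Prop :=
  ∀ j, IsCofibrantDGMod (F.obj j)

/-- A diagram `Q` is cofibrant in the projective model structure on diagrams if `0 ⟶ Q` has the
left lifting property with respect to the objectwise acyclic fibrations. -/
def IsCofibrantDiagram {J : Type} [SmallCategory J] (Q : J ⥤ DGMod k) : Prop :=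
  ∀ ⦃X Y : J ⥤ DGMod k⦄ (p : X ⟶ Y), (∀ j, IsAcyclicFibration (p.app j)) →
    ∀ f : Q ⟶ Y, ∃ g : Q ⟶ X, g ≫ p = f

/-- A cofibrant replacement of `S`: a cofibrant diagram `Q` with an objectwise
quasi-isomorphism `Q ⟶ S`. -/
structure CofibrantReplacement (S : ContraDiagram k n) where
  Q : ContraDiagram k n
  cofibrant : IsCofibrantDiagram Q
  q : Q ⟶ S
  quasiIso : ∀ j, QuasiIso (q.app j)

end Cofibrancy

/-! ### The tensor product of diagrams over the category of pruned trees -/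

section Tensor

variable {k : Type u} [CommRing k] {n : ℕ}

/-- Indices of the summands `S(τ)_p ⊗ T(τ)_q` of degree `i` of `⨁_τ S(τ) ⊗ T(τ)`. -/
structure TensorIndex (n : ℕ) (i : ℤ) where
  obj : PrunedTree n
  p : ℤ
  q : ℤ
  deg_eq : p + q = i

noncomputable instance (i : ℤ) : DecidableEq (TensorIndex n i) := Classical.decEq _

/-- The component of degree `i` of the dg-module `⨁_τ S(τ) ⊗ T(τ)`. -/
abbrev PreTensor (S : ContraDiagram k n) (T : CovDiagram k n) (i : ℤ) : Type u :=
  ⨁ a : TensorIndex n i, ((S.obj (op a.obj)).X a.p ⊗[k] (T.obj a.obj).X a.q)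

/-- The inclusion of the summand `S(τ)_p ⊗ T(τ)_q` in `⨁_τ S(τ) ⊗ T(τ)`. -/
noncomputable abbrev preTensorIncl (S : ContraDiagram k n) (T : CovDiagram k n) {i : ℤ}
    (τ : PrunedTree n) (p q : ℤ) (h : p + q = i) :
    ((S.obj (op τ)).X p ⊗[k] (T.obj τ).X q) →ₗ[k] PreTensor S T i :=
  DirectSum.lof k (TensorIndex n i)
    (fun a => ((S.obj (op a.obj)).X a.p ⊗[k] (T.obj a.obj).X a.q)) ⟨τ, p, q, h⟩

/-- The differential `d (x ⊗ y) = d x ⊗ y + (-1)^p x ⊗ d y` for `x` of degree `p`. -/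
noncomputable def preTensorD (S : ContraDiagram k n) (T : CovDiagram k n) {i j : ℤ}
    (hij : j + 1 = i) : PreTensor S T i →ₗ[k] PreTensor S T j :=
  DirectSum.toModule k (TensorIndex n i) (PreTensor S T j) fun a =>
    preTensorIncl S T a.obj (a.p - 1) a.q (by have := a.deg_eq; omega) ∘ₗ
        ((S.obj (op a.obj)).d a.p (a.p - 1)).hom.rTensor _
    + a.p.negOnePow • preTensorIncl S T a.obj a.p (a.q - 1) (by have := a.deg_eq; omega) ∘ₗ
        ((T.obj a.obj).d a.q (a.q - 1)).hom.lTensor _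

lemma preTensorD_incl (S : ContraDiagram k n) (T : CovDiagram k n) {i j : ℤ} (hij : j + 1 = i)
    (τ : PrunedTree n) (p q : ℤ) (h : p + q = i) (x : (S.obj (op τ)).X p) (y : (T.obj τ).X q) :
    preTensorD S T hij (preTensorIncl S T τ p q h (x ⊗ₜ y)) =
      preTensorIncl S T τ (p - 1) q (by omega) ((S.obj (op τ)).d p (p - 1) x ⊗ₜ y)
      + p.negOnePow • preTensorIncl S T τ p (q - 1) (by omega)
          (x ⊗ₜ (T.obj τ).d q (q - 1) y) := by
  rw [preTensorD, preTensorIncl, DirectSum.toModule_lof]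
  rfl

/-- The relations `w^*(x) ⊗ y = x ⊗ w_*(y)` that define the coend `∫^τ S(τ) ⊗ T(τ)` as a
quotient of `⨁_τ S(τ) ⊗ T(τ)`. -/
def coendRel (S : ContraDiagram k n) (T : CovDiagram k n) (i : ℤ) :
    Submodule k (PreTensor S T i) :=
  Submodule.span k {z | ∃ (τ σ : PrunedTree n) (w : τ ⟶ σ) (p q : ℤ) (h : p + q = i)
    (x : (S.obj (op σ)).X p) (y : (T.obj τ).X q),
    z = preTensorIncl S T τ p q h ((S.map w.op).f p x ⊗ₜ y)
      - preTensorIncl S T σ p q h (x ⊗ₜ (T.map w).f q y)}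

lemma f_d_apply {C D : DGMod k} (f : C ⟶ D) (i j : ℤ) (x : C.X i) :
    D.d i j (f.f i x) = f.f j (C.d i j x) := by
  rw [← ModuleCat.comp_apply, ← ModuleCat.comp_apply, f.comm]

lemma coendRel_le (S : ContraDiagram k n) (T : CovDiagram k n) {i j : ℤ} (hij : j + 1 = i) :
    coendRel S T i ≤ (coendRel S T j).comap (preTensorD S T hij) := by
  refine Submodule.span_le.2 ?_
  rintro _ ⟨τ, σ, w, p, q, h, x, y, rfl⟩
  simp only [SetLike.mem_coe, Submodule.mem_comap, map_sub, preTensorD_incl, f_d_apply]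
  rw [add_sub_add_comm]
  refine add_mem (Submodule.subset_span ⟨τ, σ, w, p - 1, q, by omega, _, _, rfl⟩) ?_
  have : preTensorIncl S T τ p (q - 1) (by omega : p + (q - 1) = j)
        ((S.map w.op).f p x ⊗ₜ (T.obj τ).d q (q - 1) y)
      - preTensorIncl S T σ p (q - 1) (by omega)
        (x ⊗ₜ (T.map w).f (q - 1) ((T.obj τ).d q (q - 1) y)) ∈ coendRel S T j :=
    Submodule.subset_span ⟨τ, σ, w, p, q - 1, by omega, _, _, rfl⟩
  rcases Int.units_eq_one_or p.negOnePow with e | e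
  · rw [e, one_smul, one_smul]
    exact this
  · simp only [e, Units.neg_smul, one_smul]
    rw [neg_sub_neg, ← neg_sub]
    exact neg_mem this

/-- The differential of the coend. -/
noncomputable def tensorD (S : ContraDiagram k n) (T : CovDiagram k n) {i j : ℤ}
    (hij : j + 1 = i) :
    (PreTensor S T i ⧸ coendRel S T i) →ₗ[k] (PreTensor S T j ⧸ coendRel S T j) :=
  Submodule.mapQ _ _ (preTensorD S T hij) (coendRel_le S T hij)

lemma preTensorD_comp (S : ContraDiagram k n) (T : CovDiagram k n) {i j l : ℤ}
    (hij : j + 1 = i) (hjl : l + 1 = j) :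
    preTensorD S T hjl ∘ₗ preTensorD S T hij = 0 := by
  refine DirectSum.linearMap_ext _ fun a => TensorProduct.ext' fun x y => ?_
  obtain ⟨τ, p, q, h⟩ := a
  have e1 : preTensorD S T hij (preTensorIncl S T τ p q h (x ⊗ₜ y)) = _ :=
    preTensorD_incl S T hij τ p q h x y
  have e2 : ∀ r s : ℤ, (S.obj (op τ)).d r s ((S.obj (op τ)).d p r x) = 0 := fun r s => by
    rw [← ModuleCat.comp_apply, HomologicalComplex.d_comp_d]; rfl
  have e3 : ∀ r s : ℤ, (T.obj τ).d r s ((T.obj τ).d q r y) = 0 := fun r s => by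
    rw [← ModuleCat.comp_apply, HomologicalComplex.d_comp_d]; rfl
  change preTensorD S T hjl (preTensorD S T hij (preTensorIncl S T τ p q h (x ⊗ₜ y))) = 0
  rw [e1, map_add, preTensorD_incl, e2]
  have e4 : ∀ z, preTensorD S T hjl (p.negOnePow • z) = p.negOnePow • preTensorD S T hjl z := by
    intro z
    rcases Int.units_eq_one_or p.negOnePow with e | e <;> simp [e, Units.smul_def]
  rw [e4, preTensorD_incl, e3]
  simp [Int.negOnePow_sub, Units.smul_def]

/-- The tensor product `S ⊗ T = ∫^τ S(τ) ⊗ T(τ)` of a contravariant and a covariant diagram of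
dg-modules over the category of pruned trees. -/
noncomputable def tensorOver (S : ContraDiagram k n) (T : CovDiagram k n) : DGMod k where
  X i := ModuleCat.of k (PreTensor S T i ⧸ coendRel S T i)
  d i j := if h : j + 1 = i then ModuleCat.ofHom (tensorD S T h) else 0
  shape i j h := dif_neg h
  d_comp_d' i j l hij hjl := by
    have hij' : j + 1 = i := hij
    have hjl' : l + 1 = j := hjl
    rw [dif_pos hij', dif_pos hjl', ← ModuleCat.ofHom_comp, tensorD, tensorD,
      ← Submodule.mapQ_comp]
    simp only [preTensorD_comp]
    rw [Submodule.mapQ_zero]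
    rfl

/-- The map `⨁_τ S(τ) ⊗ T(τ) ⟶ ⨁_τ S'(τ) ⊗ T'(τ)` induced by morphisms of diagrams. -/
noncomputable def preTensorMap {S S' : ContraDiagram k n} {T T' : CovDiagram k n} (f : S ⟶ S')
    (g : T ⟶ T') (i : ℤ) : PreTensor S T i →ₗ[k] PreTensor S' T' i :=
  DirectSum.toModule k (TensorIndex n i) (PreTensor S' T' i) fun a =>
    preTensorIncl S' T' a.obj a.p a.q a.deg_eq ∘ₗ
      TensorProduct.map ((f.app (op a.obj)).f a.p).hom ((g.app a.obj).f a.q).hom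

lemma preTensorMap_incl {S S' : ContraDiagram k n} {T T' : CovDiagram k n} (f : S ⟶ S')
    (g : T ⟶ T') {i : ℤ} (τ : PrunedTree n) (p q : ℤ) (h : p + q = i)
    (x : (S.obj (op τ)).X p) (y : (T.obj τ).X q) :
    preTensorMap f g i (preTensorIncl S T τ p q h (x ⊗ₜ y)) =
      preTensorIncl S' T' τ p q h ((f.app (op τ)).f p x ⊗ₜ (g.app τ).f q y) := by
  rw [preTensorMap, preTensorIncl, DirectSum.toModule_lof]
  rfl

lemma nat_apply {J : Type} [SmallCategory J] {F G : J ⥤ DGMod k} (f : F ⟶ G) {a b : J}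
    (w : a ⟶ b) (i : ℤ) (x : (F.obj a).X i) :
    (f.app b).f i ((F.map w).f i x) = (G.map w).f i ((f.app a).f i x) := by
  rw [← ModuleCat.comp_apply, ← ModuleCat.comp_apply, ← HomologicalComplex.comp_f,
    ← HomologicalComplex.comp_f, f.naturality]

lemma coendRel_le_map {S S' : ContraDiagram k n} {T T' : CovDiagram k n} (f : S ⟶ S')
    (g : T ⟶ T') (i : ℤ) :
    coendRel S T i ≤ (coendRel S' T' i).comap (preTensorMap f g i) := by
  refine Submodule.span_le.2 ?_
  rintro _ ⟨τ, σ, w, p, q, h, x, y, rfl⟩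
  simp only [SetLike.mem_coe, Submodule.mem_comap, map_sub, preTensorMap_incl, nat_apply]
  exact Submodule.subset_span ⟨τ, σ, w, p, q, h, _, _, rfl⟩

lemma preTensorMap_comm {S S' : ContraDiagram k n} {T T' : CovDiagram k n} (f : S ⟶ S')
    (g : T ⟶ T') {i j : ℤ} (hij : j + 1 = i) :
    preTensorD S' T' hij ∘ₗ preTensorMap f g i = preTensorMap f g j ∘ₗ preTensorD S T hij := by
  refine DirectSum.linearMap_ext _ fun a => TensorProduct.ext' fun x y => ?_
  obtain ⟨τ, p, q, h⟩ := a
  change preTensorD S' T' hij (preTensorMap f g i (preTensorIncl S T τ p q h (x ⊗ₜ y))) =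
    preTensorMap f g j (preTensorD S T hij (preTensorIncl S T τ p q h (x ⊗ₜ y)))
  rw [preTensorMap_incl, preTensorD_incl, preTensorD_incl, map_add, preTensorMap_incl,
    f_d_apply, f_d_apply]
  rcases Int.units_eq_one_or p.negOnePow with e | e <;>
    simp [e, Units.smul_def, preTensorMap_incl]

/-- The morphism `S ⊗ T ⟶ S' ⊗ T'` induced by morphisms of diagrams. -/
noncomputable def tensorOverMap {S S' : ContraDiagram k n} {T T' : CovDiagram k n} (f : S ⟶ S')
    (g : T ⟶ T') : tensorOver S T ⟶ tensorOver S' T' where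
  f i := ModuleCat.ofHom
    (Submodule.mapQ (coendRel S T i) (coendRel S' T' i) (preTensorMap f g i)
      (coendRel_le_map f g i))
  comm' i j hij := by
    have hij' : j + 1 = i := hij
    dsimp only [tensorOver]
    rw [dif_pos hij', dif_pos hij', ← ModuleCat.ofHom_comp, ← ModuleCat.ofHom_comp, tensorD,
      tensorD, ← Submodule.mapQ_comp, ← Submodule.mapQ_comp]
    simp only [preTensorMap_comm]

/-- `Tor_i(S, T)`, computed with a cofibrant replacement `Q` of `S`: the homology in degree `i`
of `Q ⊗ T`. -/
noncomputable abbrev CofibrantReplacement.Tor {S : ContraDiagram k n}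
    (R : CofibrantReplacement S) (T : CovDiagram k n) (i : ℤ) : ModuleCat.{u} k :=
  (tensorOver R.Q T).homology i

end Tensor

/-! ### The Koszul complex with coefficients -/

section Koszul

open PrunedTree

variable {k : Type u} [CommRing k] {n : ℕ}

/-- Indices of the summands `S(σ)_p ⊗ {u} ⊗ T(τ)_q`, for `u : τ ⟶ σ`, of degree
`p + deg u + q = i` of the Koszul complex. -/
structure KoszulIndex (n : ℕ) (i : ℤ) where
  src : PrunedTree n
  tgt : PrunedTree n
  u : src ⟶ tgt
  p : ℤ
  q : ℤ
  deg_eq : p + homDeg u + q = i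

noncomputable instance (i : ℤ) : DecidableEq (KoszulIndex n i) := Classical.decEq _

/-- The component of degree `i` of `⨁_u S(σ) ⊗ {u} ⊗ T(τ)`. -/
abbrev KoszulX (S : ContraDiagram k n) (T : CovDiagram k n) (i : ℤ) : Type u :=
  ⨁ a : KoszulIndex n i, ((S.obj (op a.tgt)).X a.p ⊗[k] (T.obj a.src).X a.q)

/-- The inclusion `x ⊗ y ↦ x ⊗ {u} ⊗ y` of a summand. -/
noncomputable abbrev koszulIncl (S : ContraDiagram k n) (T : CovDiagram k n) {i : ℤ}
    {τ σ : PrunedTree n} (u : τ ⟶ σ) (p q : ℤ) (h : p + homDeg u + q = i) :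
    ((S.obj (op σ)).X p ⊗[k] (T.obj τ).X q) →ₗ[k] KoszulX S T i :=
  DirectSum.lof k (KoszulIndex n i)
    (fun a => ((S.obj (op a.tgt)).X a.p ⊗[k] (T.obj a.src).X a.q)) ⟨τ, σ, u, p, q, h⟩

/-- The differential of the Koszul complex. For `x` of degree `p`,
`d (x ⊗ {u} ⊗ y) = d x ⊗ {u} ⊗ y + (-1)^(p + deg u) x ⊗ {u} ⊗ d y`
`  + ∑_{u = v w, deg v = 1} (-1)^p sgn v • v^*(x) ⊗ {w} ⊗ y`
`  + ∑_{u = v w, deg w = 1} (-1)^(p + deg v) sgn w • x ⊗ {v} ⊗ w_*(y)`. -/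
noncomputable def koszulD (S : ContraDiagram k n) (T : CovDiagram k n) {i j : ℤ}
    (hij : j + 1 = i) : KoszulX S T i →ₗ[k] KoszulX S T j :=
  DirectSum.toModule k (KoszulIndex n i) (KoszulX S T j) fun a =>
    koszulIncl S T a.u (a.p - 1) a.q (by have := a.deg_eq; omega) ∘ₗ
        ((S.obj (op a.tgt)).d a.p (a.p - 1)).hom.rTensor _
    + (a.p + homDeg a.u).negOnePow •
      koszulIncl S T a.u a.p (a.q - 1) (by have := a.deg_eq; omega) ∘ₗ
        ((T.obj a.src).d a.q (a.q - 1)).hom.lTensor _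
    + ∑ f : LeftFactorization a.u, (a.p.negOnePow * sgn f.1.left) •
        koszulIncl S T f.1.right a.p a.q
            (by have := a.deg_eq; have := f.1.homDeg_eq; have := f.2; omega) ∘ₗ
          ((S.map f.1.left.op).f a.p).hom.rTensor _
    + ∑ f : RightFactorization a.u,
        ((a.p + homDeg f.1.left).negOnePow * sgn f.1.right) •
        koszulIncl S T f.1.left a.p a.q
            (by have := a.deg_eq; have := f.1.homDeg_eq; have := f.2; omega) ∘ₗ
          ((T.map f.1.right).f a.q).hom.lTensor _

/-- The differential of the Koszul complex squares to zero. -/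
def KoszulSquareZero (S : ContraDiagram k n) (T : CovDiagram k n) : Prop :=
  ∀ ⦃i j l : ℤ⦄ (hij : j + 1 = i) (hjl : l + 1 = j), koszulD S T hjl ∘ₗ koszulD S T hij = 0

/-- The Koszul complex `K(S, Ω, T)` with coefficients in the diagrams `S` and `T`. -/
noncomputable def koszulComplex (S : ContraDiagram k n) (T : CovDiagram k n)
    (hK : KoszulSquareZero S T) : DGMod k where
  X i := ModuleCat.of k (KoszulX S T i)
  d i j := if h : j + 1 = i then ModuleCat.ofHom (koszulD S T h) else 0
  shape i j h := dif_neg h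
  d_comp_d' i j l hij hjl := by
    have hij' : j + 1 = i := hij
    have hjl' : l + 1 = j := hjl
    rw [dif_pos hij', dif_pos hjl', ← ModuleCat.ofHom_comp, hK hij' hjl']
    rfl

/-- The map `x ⊗ {u} ⊗ y ↦ f x ⊗ {u} ⊗ g y` induced by morphisms of diagrams. -/
noncomputable def koszulXMap {S S' : ContraDiagram k n} {T T' : CovDiagram k n} (f : S ⟶ S')
    (g : T ⟶ T') (i : ℤ) : KoszulX S T i →ₗ[k] KoszulX S' T' i :=
  DirectSum.toModule k (KoszulIndex n i) (KoszulX S' T' i) fun a =>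
    koszulIncl S' T' a.u a.p a.q a.deg_eq ∘ₗ
      TensorProduct.map ((f.app (op a.tgt)).f a.p).hom ((g.app a.src).f a.q).hom

lemma koszulXMap_incl {S S' : ContraDiagram k n} {T T' : CovDiagram k n} (f : S ⟶ S')
    (g : T ⟶ T') {i : ℤ} {τ σ : PrunedTree n} (u : τ ⟶ σ) (p q : ℤ)
    (h : p + homDeg u + q = i) (x : (S.obj (op σ)).X p) (y : (T.obj τ).X q) :
    koszulXMap f g i (koszulIncl S T u p q h (x ⊗ₜ y)) =
      koszulIncl S' T' u p q h ((f.app (op σ)).f p x ⊗ₜ (g.app τ).f q y) := by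
  rw [koszulXMap, koszulIncl, DirectSum.toModule_lof]
  rfl

lemma koszulD_incl (S : ContraDiagram k n) (T : CovDiagram k n) {i j : ℤ} (hij : j + 1 = i)
    {τ σ : PrunedTree n} (u : τ ⟶ σ) (p q : ℤ) (h : p + homDeg u + q = i)
    (x : (S.obj (op σ)).X p) (y : (T.obj τ).X q) :
    koszulD S T hij (koszulIncl S T u p q h (x ⊗ₜ y)) =
      koszulIncl S T u (p - 1) q (by omega) ((S.obj (op σ)).d p (p - 1) x ⊗ₜ y)
      + (p + homDeg u).negOnePow •
        koszulIncl S T u p (q - 1) (by omega) (x ⊗ₜ (T.obj τ).d q (q - 1) y)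
      + ∑ f : LeftFactorization u, (p.negOnePow * sgn f.1.left) •
          koszulIncl S T f.1.right p q
            (by have := f.1.homDeg_eq; have := f.2; omega)
            ((S.map f.1.left.op).f p x ⊗ₜ y)
      + ∑ f : RightFactorization u,
          ((p + homDeg f.1.left).negOnePow * sgn f.1.right) •
          koszulIncl S T f.1.left p q
            (by have := f.1.homDeg_eq; have := f.2; omega)
            (x ⊗ₜ (T.map f.1.right).f q y) := by
  rw [koszulD, koszulIncl, DirectSum.toModule_lof]
  simp only [LinearMap.add_apply, LinearMap.sum_apply]
  rfl

lemma koszulXMap_comm {S S' : ContraDiagram k n} {T T' : CovDiagram k n} (f : S ⟶ S')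
    (g : T ⟶ T') {i j : ℤ} (hij : j + 1 = i) :
    koszulD S' T' hij ∘ₗ koszulXMap f g i = koszulXMap f g j ∘ₗ koszulD S T hij := by
  refine DirectSum.linearMap_ext _ fun a => TensorProduct.ext' fun x y => ?_
  obtain ⟨τ, σ, u, p, q, h⟩ := a
  change koszulD S' T' hij (koszulXMap f g i (koszulIncl S T u p q h (x ⊗ₜ y))) =
    koszulXMap f g j (koszulD S T hij (koszulIncl S T u p q h (x ⊗ₜ y)))
  have hs : ∀ (ε : ℤˣ) z, koszulXMap f g j (ε • z) = ε • koszulXMap f g j z := by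
    intro ε z
    rcases Int.units_eq_one_or ε with e | e <;> simp [e, Units.smul_def]
  rw [koszulXMap_incl, koszulD_incl, koszulD_incl]
  simp only [map_add, map_sum, hs, koszulXMap_incl, f_d_apply, nat_apply]

/-- The morphism `K(S, Ω, T) ⟶ K(S', Ω, T')` induced by morphisms of diagrams. -/
noncomputable def koszulMap {S S' : ContraDiagram k n} {T T' : CovDiagram k n} (f : S ⟶ S')
    (g : T ⟶ T') (hK : KoszulSquareZero S T) (hK' : KoszulSquareZero S' T') :
    koszulComplex S T hK ⟶ koszulComplex S' T' hK' where
  f i := ModuleCat.ofHom (koszulXMap f g i)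
  comm' i j hij := by
    have hij' : j + 1 = i := hij
    dsimp only [koszulComplex]
    rw [dif_pos hij', dif_pos hij', ← ModuleCat.ofHom_comp, ← ModuleCat.ofHom_comp,
      koszulXMap_comm]

end Koszul

/-! Four facts carry the theorem. They identify the Koszul complex with the tensor product of `T`
and a cofibrant resolution of `S`.

Square zero. The mixed terms of d² cancel by degree parity, and the rest comes down to
`sum_sgn_eq_zero`: for `u` of degree two, the products sgn(v) sgn(w) over all factorizations u = v w
into morphisms of degree one add up to zero. If there is such a factorization, there are exactly
two. Indeed the nontrivial fibres of `u` are then three siblings (merge the left two or the right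
two first), or two independent pairs of siblings (in either order), or a pair of siblings and one
child of each (the parents must merge first, after which the two children can be put in either
order). Modulo two, the exponent of a sign is a count that depends on which vertices are dropped,
plus one comparison for each merge (`exists_sgn_eq`, `exists_sgn_mul_eq`). This uses that the parity
of the number of inversions is additive (`inversions_trans`). The two signs then differ by the
interchange of two dropped symbols of degree one, or by one comparison.

Resolution. For T = k[Hom(θ, -)] the Koszul complex is contravariant in θ, and `augmentation` maps
it to S. Its elements x ⊗ {v} ⊗ [w] belong to factorizations f = v w of morphisms f out of θ. Apart
from the internal part, the differential either drops a factor of v on the left, which lowers deg f,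
or moves a factor of v into w, which coarsens the factorization of the same f. For deg f > 0 the
factorizations of f are matched in pairs. Fix the last vertex b of a class of merged siblings, as
far from the root as possible (`Pivot`). Among the vertices above b, the toggle is the first one
that is not alone at the left end of its fibre. If it is merged with others, split it off to the
right of its block; if it is alone, merge it with the next block to its left. This matching is
acyclic, since `rank` decreases along it (`Covers.rank_lt`). As in algebraic discrete Morse theory,
iterating 1 - dh - hd, where h follows the matching, moves every element into the summand S(θ) ⊗
{id} ⊗ [id] (`exists_critical`). Hence the augmentation is an objectwise acyclic fibration.

Cofibrancy. The resolution is generated freely by the elements x ⊗ {u} ⊗ [id], and its differential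
is triangular with respect to deg u. A lift is therefore chosen by induction on deg u, where each
step lifts a map out of the cofibrant dg-module S(σ) that is a chain map only up to a known error
(`IsCofibrantDGMod.exists_twisted_lift`).

Comparison. By the co-Yoneda isomorphism, tensoring the resolution with T gives K(S, Ω, T)
(`comparison`). A cofibrant replacement of S lifts to the resolution. Tensoring with T turns
objectwise quasi-isomorphisms of cofibrant diagrams into isomorphisms on homology
(`IsCofibrantDiagram.isIso_homologyMap`), and the choice of the lift does not matter on homology
(`IsCofibrantDiagram.homologyMap_eq`), which also gives naturality. Both follow from lifting
problems for homotopy pullbacks of diagrams. -/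

/-! ### Vertices, parents and morphisms -/

namespace PrunedTree

variable {n : ℕ} {τ σ θ μ : PrunedTree n}

/-- The parent of a vertex; the root is its own parent. -/
def par (τ : PrunedTree n) (X : τ.Vertex) : τ.Vertex :=
  Fin.lastCases (motive := fun i => Fin (τ.card i) → τ.Vertex)
    (fun x => ⟨Fin.last n, x⟩) (fun j x => ⟨j.succ, τ.map j x⟩) X.1 X.2

@[simp] lemma par_castSucc (j : Fin n) (x : Fin (τ.card j.castSucc)) :
    τ.par ⟨j.castSucc, x⟩ = ⟨j.succ, τ.map j x⟩ := by
  simp [par]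

@[simp] lemma par_last (x : Fin (τ.card (Fin.last n))) :
    τ.par ⟨Fin.last n, x⟩ = ⟨Fin.last n, x⟩ := by
  simp [par]

lemma par_of_last {X : τ.Vertex} (h : X.1 = Fin.last n) : τ.par X = X := by
  obtain ⟨i, x⟩ := X
  obtain rfl : i = Fin.last n := h
  simp

lemma level_par {X : τ.Vertex} (h : X.1 ≠ Fin.last n) : (τ.par X).1.val = X.1.val + 1 := by
  obtain ⟨i, x⟩ := X
  induction i using Fin.lastCases with
  | last => exact absurd rfl h
  | cast j => simp

lemma level_par_congr {X : τ.Vertex} {Y : σ.Vertex} (h : X.1 = Y.1) :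
    (τ.par X).1 = (σ.par Y).1 := by
  obtain ⟨i, x⟩ := X
  obtain ⟨j, y⟩ := Y
  obtain rfl : i = j := h
  induction i using Fin.lastCases with
  | last => simp
  | cast j => simp

lemma par_ne_self {X : τ.Vertex} (h : X.1 ≠ Fin.last n) : τ.par X ≠ X := fun e => by
  have := level_par h
  rw [e] at this
  omega

lemma root_unique {X Y : τ.Vertex} (hX : X.1 = Fin.last n) (hY : Y.1 = Fin.last n) : X = Y := by
  obtain ⟨i, x⟩ := X
  obtain ⟨j, y⟩ := Y
  obtain rfl : i = Fin.last n := hX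
  obtain rfl : j = Fin.last n := hY
  have h := τ.card_last
  congr 1
  ext
  have := x.isLt
  have := y.isLt
  omega

/-- Induction from the root upwards on pairs of vertices of the same level. -/
lemma pair_induction {P : τ.Vertex → τ.Vertex → Prop}
    (root : ∀ X Y, X.1 = Fin.last n → Y.1 = Fin.last n → P X Y)
    (step : ∀ X Y, X.1 = Y.1 → X.1 ≠ Fin.last n → P (τ.par X) (τ.par Y) → P X Y)
    (X Y : τ.Vertex) (h : X.1 = Y.1) : P X Y := by
  have key : ∀ (m : ℕ) (X Y : τ.Vertex), X.1 = Y.1 → X.1.val + m = n → P X Y := by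
    intro m
    induction m with
    | zero =>
      intro X Y h hm
      exact root X Y (Fin.ext (by simpa using hm)) (Fin.ext (by rw [← h]; simpa using hm))
    | succ m ih =>
      intro X Y h hm
      have hl : X.1 ≠ Fin.last n := fun e => by rw [e] at hm; simp at hm
      exact step X Y h hl (ih _ _ (level_par_congr h) (by rw [level_par hl]; omega))
  exact key (n - X.1.val) X Y h (by have := X.1.isLt; omega)

lemma vertex_ext {X Y : τ.Vertex} (h : X.1 = Y.1) (h' : X.2.val = Y.2.val) : X = Y := by
  obtain ⟨i, x⟩ := X
  obtain ⟨j, y⟩ := Y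
  obtain rfl : i = j := h
  congr 1
  exact Fin.ext h'

/-- The position of the image of a vertex in its level. -/
def val (w : θ ⟶ τ) (X : θ.Vertex) : ℕ := (Hom.app w X.1 X.2).val

@[simp] lemma onVertex_fst (w : θ ⟶ τ) (X : θ.Vertex) : (onVertex w X).1 = X.1 := rfl

@[simp] lemma onVertex_snd (w : θ ⟶ τ) (X : θ.Vertex) : (onVertex w X).2.val = val w X := rfl

lemma onVertex_eq_iff {w : θ ⟶ τ} {X Y : θ.Vertex} :
    onVertex w X = onVertex w Y ↔ X.1 = Y.1 ∧ val w X = val w Y :=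
  ⟨fun h => ⟨by simpa using congrArg Sigma.fst h, by
    rw [← onVertex_snd, ← onVertex_snd, h]⟩, fun h => vertex_ext h.1 h.2⟩

lemma level_eq {w : θ ⟶ τ} {X Y : θ.Vertex} (h : onVertex w X = onVertex w Y) : X.1 = Y.1 :=
  (onVertex_eq_iff.1 h).1

lemma val_eq {w : θ ⟶ τ} {X Y : θ.Vertex} (h : onVertex w X = onVertex w Y) :
    val w X = val w Y :=
  (onVertex_eq_iff.1 h).2

@[simp] lemma onVertex_comp (w : θ ⟶ τ) (v : τ ⟶ σ) (X : θ.Vertex) :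
    onVertex (w ≫ v) X = onVertex v (onVertex w X) := rfl

lemma onVertex_surjective (w : θ ⟶ τ) : Function.Surjective (onVertex w) := by
  rintro ⟨i, y⟩
  obtain ⟨x, rfl⟩ := Hom.surjective w i y
  exact ⟨⟨i, x⟩, rfl⟩

lemma onVertex_par (w : θ ⟶ τ) (X : θ.Vertex) :
    onVertex w (θ.par X) = τ.par (onVertex w X) := by
  obtain ⟨i, x⟩ := X
  induction i using Fin.lastCases with
  | last => rw [par_last]; exact (par_last _).symm
  | cast j =>
    rw [par_castSucc]
    simp only [onVertex, par_castSucc, Hom.comm w]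

lemma val_mono (w : θ ⟶ τ) {X Y : θ.Vertex} (h : X.1 = Y.1) (hp : θ.par X = θ.par Y)
    (hXY : X.2.val ≤ Y.2.val) : val w X ≤ val w Y := by
  obtain ⟨i, x⟩ := X
  obtain ⟨j, y⟩ := Y
  obtain rfl : i = j := h
  induction i using Fin.lastCases with
  | last => rw [show x = y by simpa using hp]
  | cast j =>
    simp only [par_castSucc, Sigma.mk.injEq, heq_eq_eq, true_and] at hp
    exact Hom.mono w j x y hp hXY

lemma par_mono {X Y : θ.Vertex} (h : X.1 = Y.1) (hXY : X.2.val ≤ Y.2.val) :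
    (θ.par X).2.val ≤ (θ.par Y).2.val := by
  obtain ⟨i, x⟩ := X
  obtain ⟨j, y⟩ := Y
  obtain rfl : i = j := h
  induction i using Fin.lastCases with
  | last => rwa [par_last, par_last]
  | cast j => rw [par_castSucc, par_castSucc]; exact θ.map_monotone j hXY

lemma val_comp_mono (w : θ ⟶ τ) (v : τ ⟶ σ) {X Y : θ.Vertex} (h : X.1 = Y.1)
    (hp : onVertex w (θ.par X) = onVertex w (θ.par Y)) (hXY : val w X ≤ val w Y) :
    val (w ≫ v) X ≤ val (w ≫ v) Y :=
  val_mono v (X := onVertex w X) (Y := onVertex w Y) h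
    (by rw [← onVertex_par, ← onVertex_par, hp]) hXY

lemma par_val_mono (w : θ ⟶ τ) {X Y : θ.Vertex} (h : X.1 = Y.1) (hXY : val w X ≤ val w Y) :
    val w (θ.par X) ≤ val w (θ.par Y) := by
  have := par_mono (X := onVertex w X) (Y := onVertex w Y) h hXY
  rwa [← onVertex_par, ← onVertex_par] at this

lemma onVertex_par_congr {w : θ ⟶ τ} {X Y : θ.Vertex} (h : onVertex w X = onVertex w Y) :
    onVertex w (θ.par X) = onVertex w (θ.par Y) := by
  rw [onVertex_par, onVertex_par, h]

lemma hom_ext_onVertex {u v : θ ⟶ τ} (h : ∀ X, onVertex u X = onVertex v X) : u = v := by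
  refine Hom.ext (funext fun i => funext fun x => ?_)
  have := h ⟨i, x⟩
  simpa [onVertex] using this

/-- Morphisms are surjective on vertices. Hence a factorization of a given morphism is determined by
its right factor. -/
instance (w : θ ⟶ τ) : Epi w where
  left_cancellation u v h := hom_ext_onVertex fun Y => by
    obtain ⟨X, rfl⟩ := onVertex_surjective w Y
    rw [← onVertex_comp, ← onVertex_comp, h]

/-- The condition under which a morphism `w'` factors through `w`. -/
def Refines (w : θ ⟶ τ) (w' : θ ⟶ μ) : Prop :=
  ∀ X Y : θ.Vertex, X.1 = Y.1 → onVertex w (θ.par X) = onVertex w (θ.par Y) →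
    val w X ≤ val w Y → val w' X ≤ val w' Y

/-- Antisymmetry: the condition is applied in both directions. Its hypothesis on parents is
automatic, since identified vertices have identified parents. -/
lemma Refines.onVertex_eq {w : θ ⟶ τ} {w' : θ ⟶ μ} (h : Refines w w') {X Y : θ.Vertex}
    (e : onVertex w X = onVertex w Y) : onVertex w' X = onVertex w' Y :=
  onVertex_eq_iff.2 ⟨level_eq e, le_antisymm
    (h X Y (level_eq e) (onVertex_par_congr e) (val_eq e).le)
    (h Y X (level_eq e).symm (onVertex_par_congr e).symm (val_eq e).ge)⟩

lemma refines_comp (w : θ ⟶ τ) (v : τ ⟶ σ) : Refines w (w ≫ v) :=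
  fun _ _ h hp hXY => val_comp_mono w v h hp hXY

/-- The factor is a section of `w` followed by `w'`. It does not depend on the section because `w'`
is constant on the fibres of `w`, and it is non-decreasing among siblings by the refinement
condition. -/
lemma Refines.exists_fac {w : θ ⟶ τ} {w' : θ ⟶ μ} (h : Refines w w') :
    ∃ e : τ ⟶ μ, w ≫ e = w' := by
  have key : ∀ (i) (x y : Fin (θ.card i)), Hom.app w i x = Hom.app w i y →
      Hom.app w' i x = Hom.app w' i y := fun i x y e => by
    have := h.onVertex_eq (X := ⟨i, x⟩) (Y := ⟨i, y⟩) (by simp [onVertex, e])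
    simpa [onVertex] using this
  let s : ∀ i, Fin (τ.card i) → Fin (θ.card i) := fun i => Function.surjInv (Hom.surjective w i)
  have hs : ∀ i y, Hom.app w i (s i y) = y := fun i => Function.surjInv_eq _
  have hse : ∀ i x, Hom.app w' i (s i (Hom.app w i x)) = Hom.app w' i x := fun i x =>
    key i _ _ (hs i _)
  refine ⟨Hom.mk (fun i y => Hom.app w' i (s i y)) ?_ ?_ ?_, ?_⟩
  · intro i z
    obtain ⟨x, rfl⟩ := Hom.surjective w' i z
    exact ⟨Hom.app w i x, hse i x⟩
  · intro i y
    obtain ⟨x, rfl⟩ := Hom.surjective w i.castSucc y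
    rw [← Hom.comm w, hse, hse, Hom.comm w']
  · intro i y y' e hy
    obtain ⟨x, rfl⟩ := Hom.surjective w i.castSucc y
    obtain ⟨x', rfl⟩ := Hom.surjective w i.castSucc y'
    rw [hse, hse]
    refine h ⟨i.castSucc, x⟩ ⟨i.castSucc, x'⟩ rfl ?_ hy
    rw [par_castSucc, par_castSucc]
    simp only [onVertex, Hom.comm w, e]
  · exact Hom.ext (funext fun i => funext fun x => hse i x)

/-! ### Degrees -/

lemma card_vertex (τ : PrunedTree n) : Fintype.card τ.Vertex = τ.degree + 1 := by
  simp [Vertex, degree, Fin.sum_univ_castSucc, τ.card_last]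

lemma homDeg_eq_card (u : τ ⟶ σ) :
    homDeg u = (Fintype.card τ.Vertex : ℤ) - Fintype.card σ.Vertex := by
  rw [card_vertex, card_vertex, homDeg]
  push_cast
  ring

@[simp] lemma homDeg_id (τ : PrunedTree n) : homDeg (𝟙 τ) = 0 := by simp [homDeg]

lemma homDeg_nonneg (u : τ ⟶ σ) : 0 ≤ homDeg u := by
  have := Fintype.card_le_of_surjective _ (onVertex_surjective u)
  rw [homDeg_eq_card]
  omega

lemma onVertex_injective_of_homDeg {u : τ ⟶ σ} (h : homDeg u = 0) :
    Function.Injective (onVertex u) := by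
  rw [homDeg_eq_card] at h
  exact ((Fintype.bijective_iff_surjective_and_card _).2
    ⟨onVertex_surjective u, by omega⟩).1

/-- A morphism of degree zero is bijective on every level. Both it and its inverse preserve the
order, and the only order isomorphism between finite ordinals is the identity. -/
lemma exists_eqToHom_of_homDeg {u : τ ⟶ σ} (h : homDeg u = 0) :
    ∃ e : τ = σ, u = eqToHom e := by
  have hinj := onVertex_injective_of_homDeg h
  have hbij : ∀ i, Function.Bijective (Hom.app u i) := fun i => ⟨fun x y e => by
    have := hinj (a₁ := ⟨i, x⟩) (a₂ := ⟨i, y⟩) (by simp [onVertex, e])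
    simpa using this, Hom.surjective u i⟩
  have hcard : ∀ i, τ.card i = σ.card i := fun i => by
    simpa using Fintype.card_of_bijective (hbij i)
  -- Induction from the root upwards: siblings are compared by monotonicity on fibres, and vertices
  -- with different parents are ordered as their parents are.
  have hval : ∀ X Y : τ.Vertex, X.1 = Y.1 → (X.2.val ≤ Y.2.val ↔ val u X ≤ val u Y) := by
    refine fun X Y h => pair_induction (P := fun X Y => X.2.val ≤ Y.2.val ↔ val u X ≤ val u Y)
      (fun X Y hX hY => ?_) (fun X Y h hl ih => ?_) X Y h
    · obtain rfl := root_unique hX hY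
      simp
    · have aux : ∀ X Y : τ.Vertex, X.1 = Y.1 →
          ((τ.par X).2.val ≤ (τ.par Y).2.val ↔ val u (τ.par X) ≤ val u (τ.par Y)) →
          X.2.val ≤ Y.2.val → val u X ≤ val u Y := fun X Y h ih hXY => by
        by_cases hp : τ.par X = τ.par Y
        · exact val_mono u h hp hXY
        · by_contra hlt
          have h1 := par_val_mono u h.symm (le_of_not_ge hlt)
          have h2 := ih.1 (par_mono h hXY)
          exact hp (hinj (onVertex_eq_iff.2 ⟨level_par_congr h, le_antisymm h2 h1⟩))
      refine ⟨aux X Y h ih, fun hXY => ?_⟩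
      by_contra hlt
      have hlt := le_of_not_ge hlt
      by_cases hp : τ.par X = τ.par Y
      · have h1 := val_mono u h.symm hp.symm hlt
        have := hinj (onVertex_eq_iff.2 ⟨h, le_antisymm hXY h1⟩)
        subst this
        simp_all
      · have h1 := par_val_mono u h hXY
        have h2 := par_mono h.symm hlt
        have h3 := ih.2 h1
        exact hp (vertex_ext (level_par_congr h) (le_antisymm h3 h2))
  have happ : ∀ i x, (Hom.app u i x).val = x.val := fun i x => by
    let e : Fin (τ.card i) ≃o Fin (σ.card i) :=
      { toEquiv := Equiv.ofBijective _ (hbij i)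
        map_rel_iff' := fun {x y} => (hval ⟨i, x⟩ ⟨i, y⟩ rfl).symm }
    have : e = Fin.castOrderIso (hcard i) := Subsingleton.elim _ _
    exact congrArg Fin.val (DFunLike.congr_fun this x)
  have hmap : ∀ (i : Fin n) x, (τ.map i x).val = (σ.map i (Fin.cast (hcard _) x)).val :=
    fun i x => by
      rw [← happ, Hom.comm u]
      congr 2
      exact Fin.ext (happ _ x)
  obtain ⟨c, m, hm, hs, hl⟩ := τ
  obtain ⟨c', m', hm', hs', hl'⟩ := σ
  obtain rfl : c = c' := funext hcard
  obtain rfl : m = m' := funext fun i => funext fun x => Fin.ext (hmap i x)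
  exact ⟨rfl, Hom.ext (funext fun i => funext fun x => Fin.ext (happ i x))⟩

/-- The comparison morphism between the middle trees has degree zero, hence is an identity. To prove
that two factorizations are equal, it is thus enough to compare their orders in one direction and to
count degrees. -/
lemma Factorization.ext_of_refines {u : τ ⟶ σ} {F G : Factorization u}
    (h : Refines F.right G.right) (hd : homDeg F.right = homDeg G.right) : F = G := by
  obtain ⟨e, he⟩ := h.exists_fac
  have h0 : homDeg e = 0 := by
    have := homDeg_comp F.right e
    rw [he] at this
    omega
  obtain ⟨θ, w, v, hv⟩ := F
  obtain ⟨θ', w', v', hv'⟩ := G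
  obtain ⟨h1, h2⟩ := exists_eqToHom_of_homDeg h0
  dsimp only at h1 e h2 he
  subst h1
  rw [h2, eqToHom_refl, Category.comp_id] at he
  subst he
  obtain rfl : v = v' := (cancel_epi w).1 (hv.trans hv'.symm)
  rfl

/-- `u` merges the vertices `a` and `b`, and no others. -/
def Merges (u : τ ⟶ σ) (a b : τ.Vertex) : Prop :=
  a ≠ b ∧ onVertex u a = onVertex u b ∧
    ∀ X Y, X ≠ Y → onVertex u X = onVertex u Y → X = a ∧ Y = b ∨ X = b ∧ Y = a

lemma Merges.symm {u : τ ⟶ σ} {a b : τ.Vertex} (h : Merges u a b) : Merges u b a :=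
  ⟨h.1.symm, h.2.1.symm, fun X Y hXY e => (h.2.2 X Y hXY e).symm⟩

/-- The degree is the drop in the number of vertices. A section of the vertex map therefore misses
exactly one vertex `b`, and the other member of the pair is the representative of the fibre of `b`.
-/
lemma homDeg_eq_one_iff {u : τ ⟶ σ} : homDeg u = 1 ↔ ∃ a b, Merges u a b := by
  classical
  rw [homDeg_eq_card]
  constructor
  · intro h
    let s := Function.surjInv (onVertex_surjective u)
    have hs : ∀ Y, onVertex u (s Y) = Y := Function.surjInv_eq (onVertex_surjective u)
    have hinj : Function.Injective s := Function.injective_surjInv _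
    have hc : (Finset.univ.image s)ᶜ.card = 1 := by
      rw [Finset.card_compl, Finset.card_image_of_injective _ hinj, Finset.card_univ]
      omega
    obtain ⟨b, hb⟩ := Finset.card_eq_one.1 hc
    have hmem : ∀ X, X = b ∨ s (onVertex u X) = X := fun X => by
      by_cases hX : X ∈ Finset.univ.image s
      · obtain ⟨Y, -, rfl⟩ := Finset.mem_image.1 hX
        exact Or.inr (by rw [hs])
      · exact Or.inl (Finset.mem_singleton.1 (hb ▸ Finset.mem_compl.2 hX))
    have hb' : s (onVertex u b) ≠ b := fun e => by
      have : b ∈ (Finset.univ.image s)ᶜ := by rw [hb]; simp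
      exact Finset.mem_compl.1 this (Finset.mem_image.2 ⟨_, Finset.mem_univ _, e⟩)
    refine ⟨s (onVertex u b), b, hb', hs _, fun X Y hXY e => ?_⟩
    rcases hmem X with rfl | hX
    · rcases hmem Y with rfl | hY
      · exact absurd rfl hXY
      · exact Or.inr ⟨rfl, by rw [e, hY]⟩
    · rcases hmem Y with rfl | hY
      · exact Or.inl ⟨by rw [← e, hX], rfl⟩
      · exact absurd (by rw [← hX, ← hY, e]) hXY
  · rintro ⟨a, b, hab, e, h⟩
    have : Fintype.card {X : τ.Vertex // X ≠ b} = Fintype.card σ.Vertex := by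
      refine Fintype.card_of_bijective (f := fun X => onVertex u X.1) ⟨?_, ?_⟩
      · rintro ⟨X, hX⟩ ⟨Y, hY⟩ hXY
        by_contra hne
        rcases h X Y (fun h => hne (Subtype.ext h)) hXY with h | h
        · exact hY h.2
        · exact hX h.1
      · intro Z
        obtain ⟨X, rfl⟩ := onVertex_surjective u Z
        by_cases hX : X = b
        · exact ⟨⟨a, hab⟩, by rw [hX, ← e]⟩
        · exact ⟨⟨X, hX⟩, rfl⟩
    rw [Fintype.card_subtype_compl, Fintype.card_subtype_eq] at this
    have : 0 < Fintype.card τ.Vertex := Fintype.card_pos_iff.2 ⟨a⟩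
    omega

lemma Merges.not_last {u : τ ⟶ σ} {a b : τ.Vertex} (h : Merges u a b) : a.1 ≠ Fin.last n :=
  fun e => h.1 (root_unique e ((level_eq h.2.1) ▸ e))

lemma Merges.level {u : τ ⟶ σ} {a b : τ.Vertex} (h : Merges u a b) : a.1 = b.1 :=
  level_eq h.2.1

/-- Different parents would also be identified, so they would be `a` and `b` themselves; but they
lie one level closer to the root. -/
lemma Merges.par_eq {u : τ ⟶ σ} {a b : τ.Vertex} (h : Merges u a b) : τ.par a = τ.par b := by
  by_contra hne
  have ha := level_par h.not_last
  have hb := h.level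
  rcases h.2.2 _ _ hne (onVertex_par_congr h.2.1) with e | e
  · rw [e.1] at ha; omega
  · rw [e.1, hb] at ha; omega

end PrunedTree

/-! ### Quotients of trees -/

namespace PrunedTree

variable {n : ℕ} {τ σ θ μ : PrunedTree n}

/-- The vertices of a level are sorted by their key: first by the key of their parent, then by
their coordinate `g`. -/
def key (θ : PrunedTree n) (g : θ.Vertex → ℕ) (B : ℕ) (i : Fin (n + 1)) : Fin (θ.card i) → ℕ :=
  Fin.reverseInduction (motive := fun i => Fin (θ.card i) → ℕ) (fun _ => 0)
    (fun j ih x => ih (θ.map j x) * B + g ⟨j.castSucc, x⟩) i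

lemma key_castSucc (g : θ.Vertex → ℕ) (B : ℕ) (j : Fin n) (x : Fin (θ.card j.castSucc)) :
    key θ g B j.castSucc x = key θ g B j.succ (θ.map j x) * B + g ⟨j.castSucc, x⟩ := by
  simp [key]

lemma key_last (g : θ.Vertex → ℕ) (B : ℕ) (x : Fin (θ.card (Fin.last n))) :
    key θ g B (Fin.last n) x = 0 := by
  simp [key]

/-- The keys are numbers in base `B`: the key of the parent followed by the last digit `g`. The
levels of the quotient are the sets of keys that occur, division by `B` is the structure map, and
vertices with identified parents are compared by their last digit. -/
lemma exists_quotient (g : θ.Vertex → ℕ)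
    (hg : ∀ X Y : θ.Vertex, X.1 = Y.1 → θ.par X = θ.par Y → X.2.val ≤ Y.2.val → g X ≤ g Y) :
    ∃ (τ : PrunedTree n) (w : θ ⟶ τ), ∀ X Y : θ.Vertex, X.1 = Y.1 →
      onVertex w (θ.par X) = onVertex w (θ.par Y) → (val w X ≤ val w Y ↔ g X ≤ g Y) := by
  classical
  obtain ⟨B, hB⟩ : ∃ B, ∀ X, g X < B :=
    ⟨∑ X, g X + 1, fun X => Nat.lt_succ_of_le
      (Finset.single_le_sum (fun _ _ => Nat.zero_le _) (Finset.mem_univ X))⟩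
  have hpos : ∀ X : θ.Vertex, 0 < B := fun X => (Nat.zero_le _).trans_lt (hB X)
  have hdiv : ∀ (j : Fin n) x, key θ g B j.castSucc x / B = key θ g B j.succ (θ.map j x) :=
    fun j x => by
      rw [key_castSucc, mul_comm, Nat.mul_add_div (hpos ⟨_, x⟩), Nat.div_eq_of_lt (hB _),
        add_zero]
  let s : Fin (n + 1) → Finset ℕ := fun i => Finset.univ.image (key θ g B i)
  have hmem : ∀ i x, key θ g B i x ∈ s i := fun i x =>
    Finset.mem_image_of_mem _ (Finset.mem_univ _)
  let o : ∀ i, Fin (s i).card ≃o s i := fun i => (s i).orderIsoOfFin rfl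
  have hm : ∀ (j : Fin n) (y : s j.castSucc), y.1 / B ∈ s j.succ := by
    rintro j ⟨_, hy⟩
    obtain ⟨x, -, rfl⟩ := Finset.mem_image.1 hy
    simp only [hdiv]
    exact hmem _ _
  let m : ∀ j : Fin n, s j.castSucc → s j.succ := fun j y => ⟨y.1 / B, hm j y⟩
  let c : ∀ i, Fin (θ.card i) → s i := fun i x => ⟨key θ g B i x, hmem i x⟩
  have hc : ∀ i, Function.Surjective (c i) := by
    rintro i ⟨_, hy⟩
    obtain ⟨x, -, rfl⟩ := Finset.mem_image.1 hy
    exact ⟨x, rfl⟩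
  have hmc : ∀ j x, m j (c j.castSucc x) = c j.succ (θ.map j x) := fun j x =>
    Subtype.ext (hdiv j x)
  have hcard : (s (Fin.last n)).card = 1 := by
    have hz : 0 < θ.card (Fin.last n) := by rw [θ.card_last]; exact one_pos
    have : s (Fin.last n) = {0} := by
      ext y
      simp only [s, Finset.mem_image, Finset.mem_univ, true_and, key_last, Finset.mem_singleton]
      exact ⟨fun ⟨_, h⟩ => h.symm, fun h => ⟨⟨0, hz⟩, h.symm⟩⟩
    rw [this, Finset.card_singleton]
  let Q : PrunedTree n :=
    { card := fun i => (s i).card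
      map := fun j y => (o j.succ).symm (m j (o j.castSucc y))
      map_monotone := fun j y y' h => by
        refine (o j.succ).symm.monotone ?_
        exact Nat.div_le_div_right (c := B) (Subtype.coe_le_coe.2 ((o j.castSucc).monotone h))
      map_surjective := fun j => by
        have hmj : Function.Surjective (m j) := ?_
        exact (o j.succ).symm.surjective.comp (hmj.comp (o j.castSucc).surjective)
        intro z
        obtain ⟨x, rfl⟩ := hc _ z
        obtain ⟨x, rfl⟩ := θ.map_surjective j x
        exact ⟨_, hmc j x⟩
      card_last := hcard }
  have hQ : ∀ j y, Q.map j y = (o j.succ).symm (m j (o j.castSucc y)) := fun _ _ => rfl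
  let w : θ ⟶ Q := Hom.mk (fun i x => (o i).symm (c i x))
    (fun i => (o i).symm.surjective.comp (hc i))
    (fun j x => by rw [hQ, OrderIso.apply_symm_apply, hmc])
    (fun j x y h hxy => by
      refine (o _).symm.monotone ?_
      change key θ g B j.castSucc x ≤ key θ g B j.castSucc y
      rw [key_castSucc, key_castSucc, h]
      exact Nat.add_le_add_left (hg ⟨_, x⟩ ⟨_, y⟩ rfl (by simp [h]) hxy) _)
  have hw : ∀ i (x y : Fin (θ.card i)),
      val w ⟨i, x⟩ ≤ val w ⟨i, y⟩ ↔ key θ g B i x ≤ key θ g B i y := fun i x y =>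
    (o i).symm.le_iff_le
  refine ⟨Q, w, ?_⟩
  rintro ⟨i, x⟩ ⟨j, y⟩ h hp
  obtain rfl : i = j := h
  induction i using Fin.lastCases with
  | last =>
    obtain rfl : x = y := by simpa using root_unique (X := ⟨_, x⟩) (Y := ⟨_, y⟩) rfl rfl
    simp
  | cast j =>
    have h1 : key θ g B j.succ (θ.map j x) = key θ g B j.succ (θ.map j y) := by
      have := val_eq hp
      rw [par_castSucc, par_castSucc] at this
      exact le_antisymm ((hw _ _ _).1 this.le) ((hw _ _ _).1 this.ge)
    rw [hw, key_castSucc, key_castSucc, h1, Nat.add_le_add_iff_left]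

/-- The vertices of the middle tree are sorted by their images under `f`, and by `δ` among those
with the same image. -/
def Factorization.IsSortedBy {f : θ ⟶ σ} (F : Factorization f) (δ : θ.Vertex → ℕ) : Prop :=
  ∀ X Y : θ.Vertex, X.1 = Y.1 → onVertex F.right (θ.par X) = onVertex F.right (θ.par Y) →
    (val F.right X ≤ val F.right Y ↔
      val f X < val f Y ∨ val f X = val f Y ∧ δ X ≤ δ Y)

/-- Source of the factorizations in the sign cases and in the matching: a tie-breaker on the fibres
of `f` determines the middle tree. The only condition is compatibility with the order of merged
siblings. The pair (image, tie-breaker) is encoded lexicographically as one number. -/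
lemma exists_isSortedBy (f : θ ⟶ σ) (δ : θ.Vertex → ℕ)
    (hδ : ∀ X Y : θ.Vertex, onVertex f X = onVertex f Y → θ.par X = θ.par Y →
      X.2.val ≤ Y.2.val → δ X ≤ δ Y) :
    ∃ F : Factorization f, F.IsSortedBy δ := by
  obtain ⟨D, hD⟩ : ∃ D, ∀ X, δ X < D :=
    ⟨∑ X, δ X + 1, fun X => Nat.lt_succ_of_le
      (Finset.single_le_sum (fun _ _ => Nat.zero_le _) (Finset.mem_univ X))⟩
  have hlex : ∀ X Y : θ.Vertex, val f X * D + δ X ≤ val f Y * D + δ Y ↔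
      val f X < val f Y ∨ val f X = val f Y ∧ δ X ≤ δ Y := by
    intro X Y
    have hX := hD X
    have hY := hD Y
    constructor
    · intro h
      rcases lt_trichotomy (val f X) (val f Y) with h' | h' | h'
      · exact Or.inl h'
      · exact Or.inr ⟨h', by rw [h'] at h; omega⟩
      · have := Nat.mul_le_mul_right D (Nat.succ_le_of_lt h')
        rw [Nat.succ_mul] at this
        omega
    · rintro (h | ⟨h, h'⟩)
      · have := Nat.mul_le_mul_right D (Nat.succ_le_of_lt h)
        rw [Nat.succ_mul] at this
        omega
      · rw [h]; omega
  obtain ⟨τ, w, hw⟩ := exists_quotient (θ := θ) (fun X => val f X * D + δ X)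
    (fun X Y h hp hXY => (hlex X Y).2 (by
      rcases (val_mono f h hp hXY).lt_or_eq with h' | h'
      · exact Or.inl h'
      · exact Or.inr ⟨h', hδ X Y (onVertex_eq_iff.2 ⟨h, h'⟩) hp hXY⟩))
  have href : Refines w f := fun X Y h hp hXY => by
    rcases (hlex X Y).1 ((hw X Y h hp).1 hXY) with h' | h'
    · exact h'.le
    · exact h'.1.le
  obtain ⟨v, hv⟩ := href.exists_fac
  exact ⟨⟨τ, w, v, hv⟩, fun X Y h hp => (hw X Y h hp).trans (hlex X Y)⟩

lemma Factorization.refines {f : θ ⟶ σ} (F : Factorization f) : Refines F.right f := by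
  have := refines_comp F.right F.left
  rwa [F.fac] at this

lemma Factorization.onVertex_eq {f : θ ⟶ σ} (F : Factorization f) {X Y : θ.Vertex}
    (h : onVertex F.right X = onVertex F.right Y) : onVertex f X = onVertex f Y :=
  F.refines.onVertex_eq h

lemma Factorization.IsSortedBy.onVertex_eq_iff {f : θ ⟶ σ} {F : Factorization f}
    {δ : θ.Vertex → ℕ} (hF : F.IsSortedBy δ) {X Y : θ.Vertex} :
    onVertex F.right X = onVertex F.right Y ↔
      onVertex F.right (θ.par X) = onVertex F.right (θ.par Y) ∧
        onVertex f X = onVertex f Y ∧ δ X = δ Y := by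
  constructor
  · intro h
    have hp := onVertex_par_congr h
    have hf := F.onVertex_eq h
    have h1 := (hF X Y (level_eq h) hp).1 (val_eq h).le
    have h2 := (hF Y X (level_eq h).symm hp.symm).1 (val_eq h).ge
    have h3 := val_eq hf
    exact ⟨hp, hf, by omega⟩
  · rintro ⟨hp, hf, h⟩
    have h1 := (hF X Y (level_eq hf) hp).2 (Or.inr ⟨val_eq hf, h.le⟩)
    have h2 := (hF Y X (level_eq hf).symm hp.symm).2 (Or.inr ⟨(val_eq hf).symm, h.ge⟩)
    exact PrunedTree.onVertex_eq_iff.2 ⟨level_eq hf, le_antisymm h1 h2⟩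

end PrunedTree

/-! ### The order of the vertices -/

namespace PrunedTree

variable {n : ℕ} {τ σ θ μ : PrunedTree n}

lemma parent_iff {y z : τ.Vertex} : τ.Parent y z ↔ y.1 ≠ Fin.last n ∧ τ.par y = z := by
  constructor
  · rintro ⟨i, x, rfl, rfl⟩
    exact ⟨Fin.castSucc_ne_last i, by simp⟩
  · obtain ⟨i, x⟩ := y
    rintro ⟨h, rfl⟩
    induction i using Fin.lastCases with
    | last => exact absurd rfl h
    | cast j => exact ⟨j, x, rfl, by simp⟩

lemma ancestor_par (y : τ.Vertex) : τ.Ancestor y (τ.par y) := by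
  by_cases h : y.1 = Fin.last n
  · rw [par_of_last h]; exact Relation.ReflTransGen.refl
  · exact Relation.ReflTransGen.single (parent_iff.2 ⟨h, rfl⟩)

/-- Each edge raises the level by one, so an ancestor is an iterate of `par` determined by its
level. This turns the relation into a function. -/
lemma Ancestor.iterate {y z : τ.Vertex} (h : τ.Ancestor y z) :
    y.1 ≤ z.1 ∧ τ.par^[z.1.val - y.1.val] y = z := by
  induction h with
  | refl => simp
  | tail h hp ih =>
    obtain ⟨hl, rfl⟩ := parent_iff.1 hp
    have h1 := level_par hl
    obtain ⟨h2, h3⟩ := ih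
    have h2' : _ ≤ _ := h2
    rw [Fin.le_def] at h2'
    refine ⟨by rw [Fin.le_def]; omega, ?_⟩
    rw [h1, Nat.succ_sub h2', Function.iterate_succ_apply', h3]

lemma ancestor_iterate (y : τ.Vertex) (m : ℕ) : τ.Ancestor y (τ.par^[m] y) := by
  induction m with
  | zero => exact Relation.ReflTransGen.refl
  | succ m ih =>
    rw [Function.iterate_succ_apply']
    exact ih.trans (ancestor_par _)

lemma iterate_par_level {y z : τ.Vertex} (h : y.1 = z.1) (m : ℕ) :
    (τ.par^[m] y).1 = (τ.par^[m] z).1 := by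
  induction m with
  | zero => exact h
  | succ m ih =>
    rw [Function.iterate_succ_apply', Function.iterate_succ_apply']
    exact level_par_congr ih

lemma iterate_par_mono {y z : τ.Vertex} (h : y.1 = z.1) (hyz : y.2.val ≤ z.2.val) (m : ℕ) :
    (τ.par^[m] y).2.val ≤ (τ.par^[m] z).2.val := by
  induction m with
  | zero => exact hyz
  | succ m ih =>
    rw [Function.iterate_succ_apply', Function.iterate_succ_apply']
    exact par_mono (iterate_par_level h m) ih

lemma Ancestor.mono {y z y' z' : τ.Vertex} (h : τ.Ancestor y z) (h' : τ.Ancestor y' z')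
    (e : y.1 = y'.1) (e' : z.1 = z'.1) (hy : y.2.val ≤ y'.2.val) : z.2.val ≤ z'.2.val := by
  rw [← h.iterate.2, ← h'.iterate.2, ← e, ← e']
  exact iterate_par_mono e hy _

lemma Ancestor.unique {y z z' : τ.Vertex} (h : τ.Ancestor y z) (h' : τ.Ancestor y z')
    (e : z.1 = z'.1) : z = z' :=
  vertex_ext e (le_antisymm (h.mono h' rfl e le_rfl) (h'.mono h rfl e.symm le_rfl))

lemma Ancestor.eq_of_level {y z : τ.Vertex} (h : τ.Ancestor y z) (e : y.1 = z.1) : y = z :=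
  Ancestor.unique Relation.ReflTransGen.refl h e

lemma Ancestor.trans_of_le {y z z' : τ.Vertex} (h : τ.Ancestor y z) (h' : τ.Ancestor y z')
    (e : z.1 ≤ z'.1) : τ.Ancestor z z' := by
  rw [← h.iterate.2, ← h'.iterate.2]
  have h1 := h.iterate.1
  have h2 : z'.1.val - y.1.val = (z'.1.val - z.1.val) + (z.1.val - y.1.val) := by
    rw [Fin.le_def] at h1 e; omega
  rw [h2, Function.iterate_add_apply]
  exact ancestor_iterate _ _

lemma exists_level_iterate (y : τ.Vertex) (j : Fin (n + 1)) (h : y.1 ≤ j) :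
    (τ.par^[j.val - y.1.val] y).1 = j := by
  have key : ∀ m, y.1.val + m ≤ n → (τ.par^[m] y).1.val = y.1.val + m := by
    intro m
    induction m with
    | zero => simp
    | succ m ih =>
      intro hm
      have := ih (by omega)
      rw [Function.iterate_succ_apply', level_par, this, add_assoc]
      intro e
      rw [e, Fin.val_last] at this
      omega
  rw [Fin.le_def] at h
  have := j.isLt
  exact Fin.ext (by rw [key _ (by omega)]; omega)

lemma before_iff {y z : τ.Vertex} : τ.Before y z ↔ (y ≠ z ∧ τ.Ancestor z y) ∨
    ∃ A B : τ.Vertex, A.1 = B.1 ∧ A.2.val < B.2.val ∧ τ.Ancestor y A ∧ τ.Ancestor z B := by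
  refine or_congr Iff.rfl ⟨?_, ?_⟩
  · rintro ⟨j, a, b, h, h1, h2⟩
    exact ⟨⟨j, a⟩, ⟨j, b⟩, rfl, h, h1, h2⟩
  · rintro ⟨⟨j, a⟩, ⟨j', b⟩, e, h, h1, h2⟩
    obtain rfl : j = j' := e
    exact ⟨j, a, b, h, h1, h2⟩

lemma before_of_lt {y z : τ.Vertex} (h : y.1 = z.1) (hyz : y.2.val < z.2.val) :
    τ.Before y z :=
  before_iff.2 (Or.inr ⟨y, z, h, hyz, Relation.ReflTransGen.refl, Relation.ReflTransGen.refl⟩)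

lemma Before.asymm {y z : τ.Vertex} (h : τ.Before y z) : ¬ τ.Before z y := by
  -- Two contradictory comparisons, at the level of `A`, `B` and at a level nearer the root: there
  -- the ancestors of `A` and `B` are `D` and `C`, so A < B gives D ≤ C, against C < D.
  have aux2 : ∀ {y z A B C D : τ.Vertex}, A.1 = B.1 → A.2.val < B.2.val → τ.Ancestor y A →
      τ.Ancestor z B → C.1 = D.1 → C.2.val < D.2.val → τ.Ancestor z C → τ.Ancestor y D →
      A.1 ≤ C.1 → False := by
    intro y z A B C D e hlt hA hB e' hlt' hC hD hle
    have h1 := hA.trans_of_le hD (e' ▸ hle)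
    have h2 := hB.trans_of_le hC (e ▸ hle)
    have := h1.mono h2 e e'.symm hlt.le
    omega
  intro h'
  rcases before_iff.1 h with ⟨hne, h1⟩ | ⟨A, B, e, hlt, hA, hB⟩ <;>
    rcases before_iff.1 h' with ⟨hne', h1'⟩ | ⟨C, D, e', hlt', hC, hD⟩
  · exact hne (h1'.eq_of_level (le_antisymm h1'.iterate.1 h1.iterate.1))
  · obtain rfl := Ancestor.unique (h1.trans hD) hC e'.symm
    exact lt_irrefl _ hlt'
  · obtain rfl := Ancestor.unique (h1'.trans hB) hA e.symm
    exact lt_irrefl _ hlt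
  · rcases le_total A.1 C.1 with hle | hle
    · exact aux2 e hlt hA hB e' hlt' hC hD hle
    · exact aux2 e' hlt' hC hD e hlt hA hB hle

lemma Before.ne {y z : τ.Vertex} (h : τ.Before y z) : y ≠ z := by
  rintro rfl
  exact h.asymm h

lemma before_total {y z : τ.Vertex} (hne : y ≠ z) : τ.Before y z ∨ τ.Before z y := by
  have aux : ∀ {y z : τ.Vertex}, y ≠ z → y.1 ≤ z.1 → τ.Before y z ∨ τ.Before z y := by
    intro y z hne hle
    -- It suffices to compare `z` with the ancestor of `y` on the level of `z`.
    have hA := ancestor_iterate y (z.1.val - y.1.val)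
    have hl := exists_level_iterate y z.1 hle
    set A := τ.par^[z.1.val - y.1.val] y
    rcases lt_trichotomy A.2.val z.2.val with h | h | h
    · exact Or.inl (before_iff.2 (Or.inr ⟨A, z, hl, h, hA, Relation.ReflTransGen.refl⟩))
    · have : A = z := vertex_ext hl h
      exact Or.inr (before_iff.2 (Or.inl ⟨hne.symm, this ▸ hA⟩))
    · exact Or.inr (before_iff.2 (Or.inr ⟨z, A, hl.symm, h, Relation.ReflTransGen.refl, hA⟩))
  rcases le_total y.1 z.1 with h | h
  · exact aux hne h
  · exact (aux hne.symm h).symm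

/-! ### Inversions -/

section Inversions

variable {V : Type*}

/-- Indicator functions with values in `ZMod 2` of tournaments on a finite set. -/
structure IsTournament (A : Finset V) (β : V → V → ZMod 2) : Prop where
  self : ∀ y ∈ A, β y y = 0
  add : ∀ y ∈ A, ∀ z ∈ A, y ≠ z → β y z + β z y = 1

lemma IsTournament.subset {A B : Finset V} {β : V → V → ZMod 2} (h : IsTournament A β)
    (hBA : B ⊆ A) : IsTournament B β :=
  ⟨fun y hy => h.self y (hBA hy), fun y hy z hz => h.add y (hBA hy) z (hBA hz)⟩

/-- The parity of the number of pairs that two tournaments order differently. -/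
def inversions (A : Finset V) (β β' : V → V → ZMod 2) : ZMod 2 :=
  ∑ y ∈ A, ∑ z ∈ A, β y z * β' z y

/-- The pair of `y` and `c` is inverted exactly if the tournaments disagree on it, that is, if β y c
+ β' y c = 1. The new contribution is thus linear in the tournaments. -/
lemma inversions_insert [DecidableEq V] {A : Finset V} {c : V} (hc : c ∉ A) {β β' : V → V → ZMod 2}
    (h : IsTournament (insert c A) β) (h' : IsTournament (insert c A) β') :
    inversions (insert c A) β β' = inversions A β β' + ∑ y ∈ A, (β y c + β' y c) := by
  have key : ∀ p q p' q' : ZMod 2, p + p' = 1 → q + q' = 1 → p * q' + p' * q = p + q := by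
    decide
  have hsum : ∑ y ∈ A, β y c * β' c y + ∑ y ∈ A, β c y * β' y c
      = ∑ y ∈ A, (β y c + β' y c) := by
    rw [← Finset.sum_add_distrib]
    refine Finset.sum_congr rfl fun y hy => ?_
    have hne : y ≠ c := fun e => hc (e ▸ hy)
    exact key _ _ _ _ (h.add y (Finset.mem_insert_of_mem hy) c (Finset.mem_insert_self _ _) hne)
      (h'.add y (Finset.mem_insert_of_mem hy) c (Finset.mem_insert_self _ _) hne)
  rw [← hsum]
  simp only [inversions, Finset.sum_insert hc, h.self c (Finset.mem_insert_self _ _), zero_mul,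
    zero_add, Finset.sum_add_distrib]
  ring

lemma inversions_erase [DecidableEq V] {A : Finset V} {c : V} (hc : c ∈ A) {β β' : V → V → ZMod 2}
    (h : IsTournament A β) (h' : IsTournament A β') :
    inversions A β β' = inversions (A.erase c) β β' + ∑ y ∈ A.erase c, (β y c + β' y c) := by
  have := inversions_insert (Finset.notMem_erase c A) (β := β) (β' := β')
  rw [Finset.insert_erase hc] at this
  exact this h h'

/-- Disagreement on a pair is additive modulo two, so the middle tournament cancels. Transitivity of
the orders plays no role. -/
lemma inversions_trans [DecidableEq V] (A : Finset V) {β β' β'' : V → V → ZMod 2} (h : IsTournament A β)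
    (h' : IsTournament A β') (h'' : IsTournament A β'') :
    inversions A β β' + inversions A β' β'' = inversions A β β'' := by
  induction A using Finset.induction_on with
  | empty => simp [inversions]
  | insert c A hc ih =>
    have hs := Finset.subset_insert c A
    rw [inversions_insert hc h h', inversions_insert hc h' h'', inversions_insert hc h h'',
      ← ih (h.subset hs) (h'.subset hs) (h''.subset hs)]
    simp only [Finset.sum_add_distrib]
    have : ∀ a b c d e : ZMod 2, a + (b + c) + (d + (c + e)) = a + d + (b + e) := by decide
    exact this _ _ _ _ _

end Inversions

/-! ### The sign of a morphism of degree one -/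

open Classical in
/-- The indicator function of the order of the vertices of a tree. -/
noncomputable def before (τ : PrunedTree n) (y z : τ.Vertex) : ZMod 2 :=
  if τ.Before y z then 1 else 0

lemma before_eq_one {y z : τ.Vertex} (h : τ.Before y z) : τ.before y z = 1 := if_pos h

lemma before_eq_zero {y z : τ.Vertex} (h : ¬ τ.Before y z) : τ.before y z = 0 := if_neg h

@[simp] lemma before_self (y : τ.Vertex) : τ.before y y = 0 := before_eq_zero fun h => h.ne rfl

lemma before_add {y z : τ.Vertex} (h : y ≠ z) : τ.before y z + τ.before z y = 1 := by
  rcases before_total h with h | h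
  · rw [before_eq_one h, before_eq_zero h.asymm, add_zero]
  · rw [before_eq_one h, before_eq_zero h.asymm, zero_add]

lemma isTournament_before (u : τ ⟶ σ) (A : Finset τ.Vertex)
    (h : ∀ y ∈ A, ∀ z ∈ A, onVertex u y = onVertex u z → y = z) :
    IsTournament A fun y z => σ.before (onVertex u y) (onVertex u z) :=
  ⟨fun _ _ => before_self _, fun y hy z hz hne => before_add fun e => hne (h y hy z hz e)⟩

lemma isTournament_before_id (A : Finset τ.Vertex) : IsTournament A τ.before :=
  ⟨fun _ _ => before_self _, fun _ _ _ _ hne => before_add hne⟩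

lemma mem_innerVertices {y : τ.Vertex} : y ∈ τ.innerVertices ↔ y.1 ≠ Fin.last n := by
  simp [innerVertices]

lemma Merges.mem_left {u : τ ⟶ σ} {a b : τ.Vertex} (h : Merges u a b) :
    a ∈ τ.innerVertices := mem_innerVertices.2 h.not_last

lemma Merges.mem_right {u : τ ⟶ σ} {a b : τ.Vertex} (h : Merges u a b) :
    b ∈ τ.innerVertices := h.symm.mem_left

lemma sgn_eq {u : τ ⟶ σ} {a b : τ.Vertex} (h : Merges u a b) (hab : τ.Before a b) :
    sgn u = (-1) ^ mergeExponent u a b := by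
  classical
  rw [sgn]
  refine Finset.prod_eq_single_of_mem (a, b) ?_ fun p hp hne => ?_
  · simp only [Finset.mem_filter, Finset.mem_product]
    exact ⟨⟨h.mem_left, h.mem_right⟩, hab, h.2.1⟩
  · simp only [Finset.mem_filter, Finset.mem_product] at hp
    exfalso
    rcases h.2.2 _ _ hp.2.1.ne hp.2.2 with e | e
    · exact hne (Prod.ext e.1 e.2)
    · rw [e.1, e.2] at hp
      exact hab.asymm hp.2.1

open Classical in
/-- The parity of the exponent of the sign of a morphism that merges `a` and `b`, computed by
dropping the vertex `b`. -/
noncomputable def dropExponent (u : τ ⟶ σ) (a b : τ.Vertex) : ZMod 2 :=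
  ∑ y ∈ τ.innerVertices, τ.before y b
    + inversions (τ.innerVertices.erase b) τ.before
        (fun y z => σ.before (onVertex u y) (onVertex u z))
    + τ.before a b

open Classical in
lemma mergeExponent_cast (u : τ ⟶ σ) (a b : τ.Vertex) :
    (mergeExponent u a b : ZMod 2) =
      ∑ y ∈ τ.innerVertices, τ.before y a + ∑ y ∈ τ.innerVertices.erase a, τ.before y b
      + ∑ y ∈ (τ.innerVertices.erase a).erase b, σ.before (onVertex u y) (onVertex u a)
      + inversions ((τ.innerVertices.erase a).erase b) τ.before
          (fun y z => σ.before (onVertex u y) (onVertex u z)) := by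
  have e1 : ∀ (p q : Prop) [Decidable p] [Decidable q],
      (if p ∧ q then (1 : ZMod 2) else 0) = if p then (if q then 1 else 0) else 0 := by
    intro p q _ _
    split_ifs <;> simp_all
  have e2 : τ.innerVertices.erase a = τ.innerVertices.filter (fun y => y ≠ a) := by
    ext y; simp [and_comm]
  have e3 : (τ.innerVertices.erase a).erase b
      = τ.innerVertices.filter (fun y => y ≠ a ∧ y ≠ b) := by
    ext y; simp only [Finset.mem_erase, Finset.mem_filter]; tauto
  rw [mergeExponent]
  push_cast
  rw [e3, e2]
  simp only [Finset.natCast_card_filter, inversions, before, Finset.sum_filter, e1,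
    Finset.sum_product]
  congr 1
  · congr 1
    refine Finset.sum_congr rfl fun y _ => ?_
    split_ifs <;> simp_all
  · refine Finset.sum_congr rfl fun y _ => ?_
    split_ifs
    all_goals try (simp_all; done)
    refine Finset.sum_congr rfl fun z _ => ?_
    split_ifs <;> simp_all

/-- The merged vertex takes over the place of `a`. Peeling `a` off the inversions yields the terms
of the original exponent. The formula holds whichever of `a` and `b` comes first, so the vertex to
be dropped can be chosen freely later. -/
lemma exists_sgn_eq {u : τ ⟶ σ} {a b : τ.Vertex} (h : Merges u a b) :
    ∃ e : ℕ, sgn u = (-1) ^ e ∧ (e : ZMod 2) = dropExponent u a b := by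
  classical
  have hinj : ∀ {a b : τ.Vertex}, Merges u a b → ∀ y ∈ τ.innerVertices.erase b,
      ∀ z ∈ τ.innerVertices.erase b, onVertex u y = onVertex u z → y = z := by
    intro a b h y hy z hz e
    by_contra hne
    rcases h.2.2 _ _ hne e with e | e
    · exact (Finset.mem_erase.1 hz).1 e.2
    · exact (Finset.mem_erase.1 hy).1 e.1
  have ha : a ∈ τ.innerVertices.erase b := Finset.mem_erase.2 ⟨h.1, h.mem_left⟩
  have e1 : dropExponent u a b = ∑ y ∈ τ.innerVertices, τ.before y b
      + (inversions ((τ.innerVertices.erase b).erase a) τ.before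
          (fun y z => σ.before (onVertex u y) (onVertex u z))
        + (∑ y ∈ (τ.innerVertices.erase b).erase a, τ.before y a
          + ∑ y ∈ (τ.innerVertices.erase b).erase a, σ.before (onVertex u y) (onVertex u a)))
      + τ.before a b := by
    rw [dropExponent, inversions_erase ha (isTournament_before_id _)
      (isTournament_before u _ (hinj h)), Finset.sum_add_distrib]
  rcases before_total h.1 with hab | hab
  · refine ⟨_, sgn_eq h hab, ?_⟩
    rw [mergeExponent_cast, e1, Finset.erase_right_comm (a := a) (b := b)]
    have e2 : ∑ y ∈ τ.innerVertices, τ.before y a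
        = ∑ y ∈ (τ.innerVertices.erase b).erase a, τ.before y a := by
      rw [Finset.sum_erase (f := fun y => τ.before y a) _ (before_self a),
        Finset.sum_erase (f := fun y => τ.before y a) _ (before_eq_zero hab.asymm)]
    have e3 : ∑ y ∈ τ.innerVertices, τ.before y b
        = 1 + ∑ y ∈ τ.innerVertices.erase a, τ.before y b := by
      rw [← Finset.add_sum_erase _ _ h.mem_left, before_eq_one hab]
    rw [e2, e3, before_eq_one hab]
    have : ∀ p q r j : ZMod 2, p + q + r + j = 1 + q + (j + (p + r)) + 1 := by decide
    exact this _ _ _ _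
  · refine ⟨_, sgn_eq h.symm hab, ?_⟩
    rw [mergeExponent_cast, e1, before_eq_zero hab.asymm,
      Finset.sum_erase (f := fun y => τ.before y a) _ (before_self a), h.2.1]
    ring

end PrunedTree

/-! ### Factorizations of the morphisms of degree two -/

namespace PrunedTree

variable {n : ℕ} {τ σ θ μ : PrunedTree n}

lemma neg_one_pow_congr {a b : ℕ} (h : (a : ZMod 2) = b) : (-1 : ℤˣ) ^ a = (-1) ^ b := by
  rw [ZMod.natCast_eq_natCast_iff'] at h
  rw [Int.units_pow_eq_pow_mod_two, h, ← Int.units_pow_eq_pow_mod_two]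

lemma merges_of_homDeg {u : τ ⟶ σ} (h : homDeg u = 1) {a b : τ.Vertex} (hne : a ≠ b)
    (e : onVertex u a = onVertex u b) : Merges u a b := by
  obtain ⟨p, q, hpq⟩ := homDeg_eq_one_iff.1 h
  rcases hpq.2.2 a b hne e with ⟨rfl, rfl⟩ | ⟨rfl, rfl⟩
  · exact hpq
  · exact hpq.symm

lemma Merges.val_lt_of_lt {u : τ ⟶ σ} {a b X Y : τ.Vertex} (h : Merges u a b) (hl : X.1 = Y.1)
    (hp : τ.par X = τ.par Y) (hXY : X.2.val < Y.2.val) (hb : ¬ (X = a ∧ Y = b))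
    (ha : ¬ (X = b ∧ Y = a)) : val u X < val u Y := by
  refine (val_mono u hl hp hXY.le).lt_of_ne fun e => ?_
  have hne : X ≠ Y := fun e => by rw [e] at hXY; exact lt_irrefl _ hXY
  rcases h.2.2 X Y hne (onVertex_eq_iff.2 ⟨hl, e⟩) with h | h
  · exact hb h
  · exact ha h

open Classical in
/-- The parity of the exponent of the sign of a composite of two morphisms of degree one that
drop first the vertex `b`, then the vertex `d`. -/
noncomputable def dropExponent₂ (u : τ ⟶ σ) (b d : τ.Vertex) : ZMod 2 :=
  ∑ y ∈ τ.innerVertices, τ.before y b + ∑ y ∈ τ.innerVertices.erase b, τ.before y d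
    + inversions ((τ.innerVertices.erase b).erase d) τ.before
        (fun y z => σ.before (onVertex u y) (onVertex u z))

/-- Each vertex is counted against all vertices not yet dropped. The two expressions differ only in
the comparison of `b` and `d`, which one counts as `before d b` and the other as `before b d`. This
is the Koszul sign of two symbols of degree one. -/
lemma dropExponent₂_swap (u : τ ⟶ σ) {b d : τ.Vertex} (hne : b ≠ d)
    (hb : b.1 ≠ Fin.last n) (hd : d.1 ≠ Fin.last n) :
    dropExponent₂ u b d = dropExponent₂ u d b + 1 := by
  classical
  rw [dropExponent₂, dropExponent₂, Finset.erase_right_comm (a := b) (b := d),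
    ← Finset.add_sum_erase _ (fun y => τ.before y d) (mem_innerVertices.2 hb),
    ← Finset.add_sum_erase _ (fun y => τ.before y b) (mem_innerVertices.2 hd),
    ← before_add hne]
  have : ∀ p q r s t : ZMod 2, p + q + r + s = t + r + q + s + (t + p) := by decide
  exact this _ _ _ _ _

/-- Both exponents are rewritten as counts on `τ`. The order of the middle tree then cancels: its
inversions by `inversions_trans`, its comparisons with `d` because they occur twice. Only the
comparison of the two vertices merged second survives. -/
lemma exists_sgn_mul_eq {u : τ ⟶ σ} (F : Factorization u) {a b c d : τ.Vertex}
    (h : Merges F.right a b) (h' : Merges F.left (onVertex F.right c) (onVertex F.right d))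
    (hd : d ≠ b) : ∃ e : ℕ, sgn F.left * sgn F.right = (-1) ^ e ∧
      (e : ZMod 2) = dropExponent₂ u b d + τ.before a b
        + F.mid.before (onVertex F.right c) (onVertex F.right d) := by
  classical
  obtain ⟨e, he, he'⟩ := exists_sgn_eq h
  obtain ⟨e₂, he₂, he₂'⟩ := exists_sgn_eq h'
  refine ⟨e₂ + e, by rw [he, he₂, pow_add], ?_⟩
  obtain ⟨θ, w, v, rfl⟩ := F
  dsimp only at *
  set U := τ.innerVertices with hU
  have hinj : ∀ y ∈ U.erase b, ∀ z ∈ U.erase b, onVertex w y = onVertex w z → y = z := by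
    intro y hy z hz e
    by_contra hne
    rcases h.2.2 _ _ hne e with e | e
    · exact (Finset.mem_erase.1 hz).1 e.2
    · exact (Finset.mem_erase.1 hy).1 e.1
  have hdU : d ∈ U.erase b := Finset.mem_erase.2 ⟨hd, mem_innerVertices.2 h'.symm.not_last⟩
  -- The vertices other than `b` represent those of the middle tree, each exactly once; `b` is
  -- represented by `a`.
  have himg : θ.innerVertices = (U.erase b).image (onVertex w) := by
    ext Y
    obtain ⟨X, rfl⟩ := onVertex_surjective w Y
    rw [mem_innerVertices, Finset.mem_image]
    constructor
    · intro hX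
      by_cases hb : X = b
      · exact ⟨a, Finset.mem_erase.2 ⟨h.1, h.mem_left⟩, by rw [hb, h.2.1]⟩
      · exact ⟨X, Finset.mem_erase.2 ⟨hb, mem_innerVertices.2 hX⟩, rfl⟩
    · rintro ⟨Z, hZ, hZX⟩
      have := mem_innerVertices.1 (Finset.mem_of_mem_erase hZ)
      rwa [level_eq hZX] at this
  have himg' : θ.innerVertices.erase (onVertex w d)
      = ((U.erase b).erase d).image (onVertex w) := by
    rw [himg]
    ext Y
    simp only [Finset.mem_erase (a := Y), Finset.mem_image]
    constructor
    · rintro ⟨hY, X, hX, rfl⟩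
      exact ⟨X, Finset.mem_erase.2 ⟨fun e => hY (by rw [e]), hX⟩, rfl⟩
    · rintro ⟨X, hX, rfl⟩
      have hX' := Finset.mem_of_mem_erase hX
      exact ⟨fun e => (Finset.mem_erase.1 hX).1 (hinj _ hX' _ hdU e), X, hX', rfl⟩
  have hinj' : ∀ y ∈ (U.erase b).erase d, ∀ z ∈ (U.erase b).erase d,
      onVertex w y = onVertex w z → y = z := fun y hy z hz =>
    hinj y (Finset.mem_of_mem_erase hy) z (Finset.mem_of_mem_erase hz)
  have hinj'' : ∀ y ∈ (U.erase b).erase d, ∀ z ∈ (U.erase b).erase d,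
      onVertex (w ≫ v) y = onVertex (w ≫ v) z → y = z := fun y hy z hz e => by
    by_contra hne
    have hne' : onVertex w y ≠ onVertex w z := fun e => hne (hinj' y hy z hz e)
    rcases h'.2.2 _ _ hne' e with e | e
    · exact (Finset.mem_erase.1 hz).1 (hinj z (Finset.mem_of_mem_erase hz) d hdU e.2)
    · exact (Finset.mem_erase.1 hy).1 (hinj y (Finset.mem_of_mem_erase hy) d hdU e.1)
  have e1 : dropExponent v (onVertex w c) (onVertex w d)
      = ∑ y ∈ (U.erase b).erase d, θ.before (onVertex w y) (onVertex w d)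
        + inversions ((U.erase b).erase d)
          (fun y z => θ.before (onVertex w y) (onVertex w z))
          (fun y z => σ.before (onVertex (w ≫ v) y) (onVertex (w ≫ v) z))
        + θ.before (onVertex w c) (onVertex w d) := by
    rw [dropExponent, ← Finset.sum_erase (f := fun y => θ.before y (onVertex w d)) _
      (before_self (onVertex w d)), himg', inversions, Finset.sum_image hinj',
      Finset.sum_image hinj']
    simp only [Finset.sum_image hinj']
    rfl
  push_cast
  rw [he', he₂', e1, dropExponent, inversions_erase hdU (isTournament_before_id _)
    (isTournament_before w _ hinj), dropExponent₂, ← inversions_trans ((U.erase b).erase d)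
    (isTournament_before_id _) (isTournament_before w _ hinj')
    (isTournament_before (w ≫ v) _ hinj''), Finset.sum_add_distrib,
    Finset.sum_erase (f := fun y => τ.before y d) (U.erase b) (before_self d)]
  have : ∀ p q r s t x y : ZMod 2,
      p + q + r + (s + (t + (x + p)) + y) = s + x + (t + q) + y + r := by decide
  exact this _ _ _ _ _ _ _

/-- The factorizations of `u` into two morphisms of degree one are `F₁` and `F₂`, and they have
opposite signs. -/
def OppositePair (u : τ ⟶ σ) : Prop :=
  ∃ F₁ F₂ : Factorization u, homDeg F₁.left = 1 ∧ homDeg F₂.left = 1 ∧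
    sgn F₁.left * sgn F₁.right = -(sgn F₂.left * sgn F₂.right) ∧
    ∀ H : Factorization u, homDeg H.left = 1 → H = F₁ ∨ H = F₂

lemma neg_one_pow_opposite {a b : ℕ} (h : (a : ZMod 2) = b + 1) :
    (-1 : ℤˣ) ^ a = -(-1) ^ b := by
  rw [neg_one_pow_congr (a := a) (b := b + 1) (by push_cast; exact h), pow_succ, mul_neg_one]

/-- Once the first merge is fixed, the only freedom left in the middle tree is the relative order of
a child of `a` and a child of `b` with the same image under `u`. Siblings are ordered by the source,
and vertices with different images by `u`. -/
lemma Factorization.eq_of_merges {u : τ ⟶ σ} {F H : Factorization u} {a b : τ.Vertex}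
    (hF : Merges F.right a b) (hH : Merges H.right a b)
    (h : ∀ X Y, X ≠ Y → onVertex u X = onVertex u Y →
      (τ.par X = a ∧ τ.par Y = b ∨ τ.par X = b ∧ τ.par Y = a) →
      val F.right X ≤ val F.right Y → val H.right X ≤ val H.right Y) : F = H := by
  refine Factorization.ext_of_refines (fun X Y hl hp hXY => ?_)
    ((homDeg_eq_one_iff.2 ⟨a, b, hF⟩).trans (homDeg_eq_one_iff.2 ⟨a, b, hH⟩).symm)
  by_cases hpp : τ.par X = τ.par Y
  · rcases le_total X.2.val Y.2.val with hle | hle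
    · exact val_mono _ hl hpp hle
    · have e := le_antisymm hXY (val_mono F.right hl.symm hpp.symm hle)
      by_cases hne : X = Y
      · rw [hne]
      · rcases hF.2.2 X Y hne (onVertex_eq_iff.2 ⟨hl, e⟩) with ⟨rfl, rfl⟩ | ⟨rfl, rfl⟩
        · exact (val_eq hH.2.1).le
        · exact (val_eq hH.2.1).ge
  · have hab := hF.2.2 _ _ hpp hp
    by_contra hlt
    have h1 := F.refines X Y hl hp hXY
    have hp' : onVertex H.right (τ.par Y) = onVertex H.right (τ.par X) := by
      rcases hab with h | h
      · rw [h.1, h.2, hH.2.1]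
      · rw [h.1, h.2, hH.2.1]
    have h2 := H.refines Y X hl.symm hp' (le_of_not_ge hlt)
    refine hlt (h X Y (fun e => hpp (by rw [e])) (onVertex_eq_iff.2 ⟨hl, le_antisymm h1 h2⟩)
      hab hXY)

lemma Factorization.homDeg_left {u : τ ⟶ σ} (hu : homDeg u = 2) {F : Factorization u}
    {a b : τ.Vertex} (h : Merges F.right a b) : homDeg F.left = 1 := by
  have := F.homDeg_eq
  rw [homDeg_eq_one_iff.2 ⟨a, b, h⟩] at this
  omega

lemma Factorization.exists_merges {u : τ ⟶ σ} (hu : homDeg u = 2) {F : Factorization u}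
    (h : homDeg F.left = 1) : ∃ a b, Merges F.right a b ∧ a.2.val < b.2.val := by
  have := F.homDeg_eq
  obtain ⟨a, b, hab⟩ := homDeg_eq_one_iff.1 (show homDeg F.right = 1 by omega)
  rcases lt_trichotomy a.2.val b.2.val with hlt | e | hlt
  · exact ⟨a, b, hab, hlt⟩
  · exact absurd (vertex_ext hab.level e) hab.1
  · exact ⟨b, a, hab.symm, hlt⟩

lemma Factorization.merges_left {u : τ ⟶ σ} {F : Factorization u} (h : homDeg F.left = 1)
    {c d : τ.Vertex} (hne : onVertex F.right c ≠ onVertex F.right d)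
    (e : onVertex u c = onVertex u d) :
    Merges F.left (onVertex F.right c) (onVertex F.right d) := by
  refine merges_of_homDeg h hne ?_
  rw [← onVertex_comp, ← onVertex_comp, F.fac, e]

lemma par_ne_of_level {a X : τ.Vertex} (ha : a.1 ≠ Fin.last n) (hX : X.1 = a.1) :
    τ.par X ≠ a := fun e => by
  have := level_par (X := X) (by rwa [hX])
  rw [e, hX] at this
  omega

/-- Since `y` lies between `x` and `z`, only neighbours can be merged first. One factorization drops
`y` and then `z`, the other `z` and then `y`, while all comparisons agree; so the signs differ by
`dropExponent₂_swap`. -/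
lemma oppositePair_of_triple {u : τ ⟶ σ} (hu : homDeg u = 2) {x y z : τ.Vertex}
    (hxy : τ.par x = τ.par y) (hyz : τ.par y = τ.par z) (exy : onVertex u x = onVertex u y)
    (eyz : onVertex u y = onVertex u z) (lxy : x.2.val < y.2.val) (lyz : y.2.val < z.2.val)
    (fib : ∀ X Y, X ≠ Y → onVertex u X = onVertex u Y →
      (X = x ∨ X = y ∨ X = z) ∧ (Y = x ∨ Y = y ∨ Y = z)) : OppositePair u := by
  classical
  have nxy : x ≠ y := fun e => by rw [e] at lxy; exact lt_irrefl _ lxy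
  have nyz : y ≠ z := fun e => by rw [e] at lyz; exact lt_irrefl _ lyz
  have nxz : x ≠ z := fun e => by rw [e] at lxy; omega
  have hl1 := level_eq exy
  have hl2 := level_eq eyz
  have hx : x.1 ≠ Fin.last n := fun e => nxy (root_unique e (hl1 ▸ e))
  -- This tie-breaker keeps `z` apart on the right, so that `x` and `y` merge first; the next one
  -- keeps `x` apart on the left.
  obtain ⟨F₁, hF₁⟩ := exists_isSortedBy u (fun X => if X = z then 1 else 0) (by
    intro X Y e hp hle
    by_cases hne : X = Y
    · rw [hne]
    · obtain ⟨hX, hY⟩ := fib X Y hne e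
      rcases hX with rfl | rfl | rfl <;> rcases hY with rfl | rfl | rfl <;> simp_all <;> omega)
  obtain ⟨F₂, hF₂⟩ := exists_isSortedBy u (fun X => if X = x then 0 else 1) (by
    intro X Y e hp hle
    by_cases hne : X = Y
    · rw [hne]
    · obtain ⟨hX, hY⟩ := fib X Y hne e
      by_cases hYx : Y = x
      · subst hYx
        rcases hX with rfl | rfl | rfl
        · exact le_rfl
        · omega
        · omega
      · rw [if_neg hYx]
        split_ifs
        · exact Nat.zero_le _
        · exact le_rfl)
  have m₁ : Merges F₁.right x y := by
    refine ⟨nxy, hF₁.onVertex_eq_iff.2 ⟨by rw [hxy], exy, by simp [nxz, nyz]⟩, fun X Y hne e => ?_⟩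
    have h := (hF₁.onVertex_eq_iff.1 e).2
    obtain ⟨hX, hY⟩ := fib X Y hne h.1
    have h := h.2
    rcases hX with rfl | rfl | rfl <;> rcases hY with rfl | rfl | rfl <;> simp_all
  have m₂ : Merges F₂.right y z := by
    refine ⟨nyz, hF₂.onVertex_eq_iff.2 ⟨by rw [hyz], eyz, by simp [nxz.symm, nxy.symm]⟩,
      fun X Y hne e => ?_⟩
    have h := (hF₂.onVertex_eq_iff.1 e).2
    obtain ⟨hX, hY⟩ := fib X Y hne h.1
    have h := h.2
    rcases hX with rfl | rfl | rfl <;> rcases hY with rfl | rfl | rfl <;>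
      first
        | exact absurd rfl hne
        | exact Or.inl ⟨rfl, rfl⟩
        | exact Or.inr ⟨rfl, rfl⟩
        | exact absurd h (by simp [nxy.symm, nxz.symm])
  have d₁ := Factorization.homDeg_left hu m₁
  have d₂ := Factorization.homDeg_left hu m₂
  have v₁ : val F₁.right y < val F₁.right z :=
    m₁.val_lt_of_lt hl2 hyz lyz (fun h => nxy h.1.symm) (fun h => nxz h.2.symm)
  have v₂ : val F₂.right x < val F₂.right y :=
    m₂.val_lt_of_lt hl1 hxy lxy (fun h => nxy h.1) (fun h => nxz h.1)
  have n₁ : onVertex F₁.right y ≠ onVertex F₁.right z := fun e => v₁.ne (val_eq e)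
  have n₂ : onVertex F₂.right x ≠ onVertex F₂.right y := fun e => v₂.ne (val_eq e)
  refine ⟨F₁, F₂, d₁, d₂, ?_, fun H hH => ?_⟩
  · obtain ⟨e₁, s₁, s₁'⟩ := exists_sgn_mul_eq F₁ m₁ (Factorization.merges_left d₁ n₁ eyz) nyz.symm
    obtain ⟨e₂, s₂, s₂'⟩ := exists_sgn_mul_eq F₂ m₂ (Factorization.merges_left d₂ n₂ exy) nyz
    rw [s₁, s₂]
    refine neg_one_pow_opposite ?_
    rw [s₁', s₂', dropExponent₂_swap u nyz (hl1 ▸ hx) (hl2 ▸ hl1 ▸ hx),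
      before_eq_one (before_of_lt hl1 lxy), before_eq_one (before_of_lt hl2 lyz),
      before_eq_one (before_of_lt (y := onVertex F₁.right y) (z := onVertex F₁.right z) hl2 v₁),
      before_eq_one (before_of_lt (y := onVertex F₂.right x) (z := onVertex F₂.right y) hl1 v₂)]
  · obtain ⟨a, b, hab, hlt⟩ := H.exists_merges hu hH
    have hpar : ∀ {a b : τ.Vertex}, a.1 = x.1 → b.1 = x.1 → ∀ X Y : τ.Vertex, X ≠ Y →
        onVertex u X = onVertex u Y →
        ¬ (τ.par X = a ∧ τ.par Y = b ∨ τ.par X = b ∧ τ.par Y = a) := by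
      intro a b ha hb X Y hne e h
      have hX : X.1 = x.1 := by
        rcases (fib X Y hne e).1 with rfl | rfl | rfl
        · rfl
        · exact hl1.symm
        · exact (hl1.trans hl2).symm
      rcases h with h | h
      · exact par_ne_of_level (ha ▸ hx) (hX.trans ha.symm) h.1
      · exact par_ne_of_level (hb ▸ hx) (hX.trans hb.symm) h.1
    obtain ⟨ha, hb⟩ := fib a b hab.1 (H.onVertex_eq hab.2.1)
    -- By monotonicity, identifying `x` with `z` would identify `y` with them as well.
    have hxz : ¬ Merges H.right x z := fun h => by
      have h1 := val_mono H.right hl1 hxy lxy.le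
      have h2 := val_mono H.right hl2 hyz lyz.le
      have h3 := val_eq h.2.1
      have := h.2.2 x y nxy (onVertex_eq_iff.2 ⟨hl1, by omega⟩)
      rcases this with h | h
      · exact nyz h.2
      · exact nxz h.1
    rcases ha with rfl | rfl | rfl <;> rcases hb with rfl | rfl | rfl <;>
      first
        | exact absurd rfl hab.1
        | omega
        | exact absurd hab hxz
        | exact Or.inl (Factorization.eq_of_merges hab m₁ fun X Y hne e h =>
            absurd h (hpar (by simp [*]) (by simp [*]) X Y hne e))
        | exact Or.inr (Factorization.eq_of_merges hab m₂ fun X Y hne e h =>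
            absurd h (hpar (by simp [*]) (by simp [*]) X Y hne e))

/-- Independent merges can be performed in either order, and no other choice remains. The two
dropped vertices are exchanged, which changes the sign. -/
lemma oppositePair_of_pairs {u : τ ⟶ σ} (hu : homDeg u = 2) {a b c d : τ.Vertex}
    (hab : τ.par a = τ.par b) (hcd : τ.par c = τ.par d) (eab : onVertex u a = onVertex u b)
    (ecd : onVertex u c = onVertex u d) (lab : a.2.val < b.2.val) (lcd : c.2.val < d.2.val)
    (nac : a ≠ c) (nad : a ≠ d) (nbc : b ≠ c) (nbd : b ≠ d)
    (fib : ∀ X Y, X ≠ Y → onVertex u X = onVertex u Y →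
      (X = a ∧ Y = b ∨ X = b ∧ Y = a) ∨ (X = c ∧ Y = d ∨ X = d ∧ Y = c)) :
    OppositePair u := by
  classical
  have exists_fac : ∀ {a b c d : τ.Vertex}, τ.par a = τ.par b → onVertex u a = onVertex u b →
      onVertex u c = onVertex u d → a.2.val < b.2.val → c.2.val < d.2.val →
      a ≠ c → a ≠ d → b ≠ c → b ≠ d → (∀ X Y, X ≠ Y → onVertex u X = onVertex u Y →
      (X = a ∧ Y = b ∨ X = b ∧ Y = a) ∨ (X = c ∧ Y = d ∨ X = d ∧ Y = c)) →
      ∃ F : Factorization u, Merges F.right a b := by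
    intro a b c d hab eab ecd lab lcd nac nad nbc nbd fib
    have nab : a ≠ b := fun e => by rw [e] at lab; exact lt_irrefl _ lab
    have ncd : c ≠ d := fun e => by rw [e] at lcd; exact lt_irrefl _ lcd
    -- Distinguishing `d` keeps the pair `c`, `d` apart and leaves only the pair `a`, `b` to be
    -- merged.
    obtain ⟨F, hF⟩ := exists_isSortedBy u (fun X => if X = d then 1 else 0) (by
      intro X Y e hp hle
      by_cases hne : X = Y
      · rw [hne]
      · rcases fib X Y hne e with (⟨rfl, rfl⟩ | ⟨rfl, rfl⟩) | (⟨rfl, rfl⟩ | ⟨rfl, rfl⟩) <;>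
          simp_all <;> omega)
    refine ⟨F, nab, hF.onVertex_eq_iff.2 ⟨by rw [hab], eab, by simp [nad, nbd]⟩,
      fun X Y hne e => ?_⟩
    have h := (hF.onVertex_eq_iff.1 e).2
    rcases fib X Y hne h.1 with h' | ⟨rfl, rfl⟩ | ⟨rfl, rfl⟩
    · exact h'
    · exact absurd h.2 (by simp [ncd])
    · exact absurd h.2 (by simp [ncd])
  have unique_fac : ∀ {a b c d : τ.Vertex}, τ.par c = τ.par d → onVertex u a = onVertex u b →
      a ≠ b →
      (∀ X Y, X ≠ Y → onVertex u X = onVertex u Y →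
      (X = a ∧ Y = b ∨ X = b ∧ Y = a) ∨ (X = c ∧ Y = d ∨ X = d ∧ Y = c)) →
      ∀ F H : Factorization u, Merges F.right a b → Merges H.right a b → F = H := by
    intro a b c d hcd eab nab fib F H hF hH
    refine Factorization.eq_of_merges hF hH fun X Y hne e h => ?_
    exfalso
    rcases fib X Y hne e with h' | h'
    · have ha := hF.not_last
      have hl := level_eq eab
      rcases h' with ⟨rfl, rfl⟩ | ⟨rfl, rfl⟩ <;> rcases h with h | h
      · exact par_ne_self ha h.1
      · exact par_ne_of_level (hl ▸ ha) hl h.1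
      · exact par_ne_of_level ha hl.symm h.1
      · exact par_ne_self (hl ▸ ha) h.1
    · have : τ.par X = τ.par Y := by
        rcases h' with ⟨rfl, rfl⟩ | ⟨rfl, rfl⟩
        · exact hcd
        · exact hcd.symm
      rcases h with h | h
      · exact nab (by rw [← h.1, ← h.2, this])
      · exact nab (by rw [← h.1, ← h.2, this])
  have fib' : ∀ X Y, X ≠ Y → onVertex u X = onVertex u Y →
      (X = c ∧ Y = d ∨ X = d ∧ Y = c) ∨ (X = a ∧ Y = b ∨ X = b ∧ Y = a) :=
    fun X Y h e => (fib X Y h e).symm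
  have nab : a ≠ b := fun e => by rw [e] at lab; exact lt_irrefl _ lab
  have ncd : c ≠ d := fun e => by rw [e] at lcd; exact lt_irrefl _ lcd
  obtain ⟨F₁, m₁⟩ := exists_fac hab eab ecd lab lcd nac nad nbc nbd fib
  obtain ⟨F₂, m₂⟩ := exists_fac hcd ecd eab lcd lab nac.symm nbc.symm nad.symm nbd.symm fib'
  have d₁ := Factorization.homDeg_left hu m₁
  have d₂ := Factorization.homDeg_left hu m₂
  have v₁ : val F₁.right c < val F₁.right d :=
    m₁.val_lt_of_lt (level_eq ecd) hcd lcd (fun h => nac h.1.symm) (fun h => nbc h.1.symm)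
  have v₂ : val F₂.right a < val F₂.right b :=
    m₂.val_lt_of_lt (level_eq eab) hab lab (fun h => nac h.1) (fun h => nad h.1)
  refine ⟨F₁, F₂, d₁, d₂, ?_, fun H hH => ?_⟩
  · obtain ⟨e₁, s₁, s₁'⟩ := exists_sgn_mul_eq F₁ m₁
      (Factorization.merges_left d₁ (fun e => v₁.ne (val_eq e)) ecd) nbd.symm
    obtain ⟨e₂, s₂, s₂'⟩ := exists_sgn_mul_eq F₂ m₂
      (Factorization.merges_left d₂ (fun e => v₂.ne (val_eq e)) eab) nbd
    rw [s₁, s₂]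
    refine neg_one_pow_opposite ?_
    rw [s₁', s₂', dropExponent₂_swap u nbd m₁.symm.not_last m₂.symm.not_last,
      before_eq_one (before_of_lt (level_eq eab) lab),
      before_eq_one (before_of_lt (level_eq ecd) lcd),
      before_eq_one (before_of_lt (y := onVertex F₁.right c) (z := onVertex F₁.right d)
        (level_eq ecd :) v₁),
      before_eq_one (before_of_lt (y := onVertex F₂.right a) (z := onVertex F₂.right b)
        (level_eq eab :) v₂)]
  · obtain ⟨p, q, hpq, hlt⟩ := H.exists_merges hu hH
    rcases fib p q hpq.1 (H.onVertex_eq hpq.2.1) with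
      (⟨rfl, rfl⟩ | ⟨rfl, rfl⟩) | (⟨rfl, rfl⟩ | ⟨rfl, rfl⟩)
    · exact Or.inl (unique_fac hcd eab nab fib H F₁ hpq m₁)
    · exact absurd lab hlt.asymm
    · exact Or.inr (unique_fac hab ecd ncd fib' H F₂ hpq m₂)
    · exact absurd lcd hlt.asymm

/-- The parents `a` and `b` must be merged first. Their children `c` and `d` then become siblings,
and the two possible orders between them give the two factorizations. -/
lemma oppositePair_of_children {u : τ ⟶ σ} (hu : homDeg u = 2) {a b c d : τ.Vertex}
    (hab : τ.par a = τ.par b) (hc : τ.par c = a) (hd : τ.par d = b)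
    (eab : onVertex u a = onVertex u b) (ecd : onVertex u c = onVertex u d)
    (lab : a.2.val < b.2.val)
    (fib : ∀ X Y, X ≠ Y → onVertex u X = onVertex u Y →
      (X = a ∧ Y = b ∨ X = b ∧ Y = a) ∨ (X = c ∧ Y = d ∨ X = d ∧ Y = c)) :
    OppositePair u := by
  classical
  have nab : a ≠ b := fun e => by rw [e] at lab; exact lt_irrefl _ lab
  have ncd : c ≠ d := fun e => nab (by rw [← hc, ← hd, e])
  have hla := level_eq eab
  have hlc := level_eq ecd
  have ha : a.1 ≠ Fin.last n := fun e => nab (root_unique e (hla ▸ e))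
  have hcl : c.1 ≠ Fin.last n := fun e => ncd (root_unique e (hlc ▸ e))
  have hca : ∀ {X}, X.1 = a.1 → X ≠ c ∧ X ≠ d := by
    intro X hX
    have h1 := level_par hcl
    rw [hc] at h1
    constructor
    · rintro rfl
      rw [hX] at h1
      omega
    · rintro rfl
      rw [hlc, hX] at h1
      omega
  have exists_fac : ∀ {c d : τ.Vertex}, c ≠ d → τ.par c ≠ τ.par d → a ≠ c → a ≠ d → b ≠ c →
      b ≠ d → τ.par c ≠ c → onVertex u c = onVertex u d →
      (τ.par c = a ∧ τ.par d = b ∨ τ.par c = b ∧ τ.par d = a) →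
      (∀ X Y, X ≠ Y → onVertex u X = onVertex u Y →
      (X = a ∧ Y = b ∨ X = b ∧ Y = a) ∨ (X = c ∧ Y = d ∨ X = d ∧ Y = c)) →
      ∃ F : Factorization u, Merges F.right a b ∧ val F.right c < val F.right d := by
    intro c d ncd npar nac nad nbc nbd hcp ecd hcd fib
    -- The tie-breaker puts `d` to the right of `c`. The other order is obtained by exchanging the
    -- roles of `c` and `d`.
    obtain ⟨F, hF⟩ := exists_isSortedBy u (fun X => if X = d then 1 else 0) (by
      intro X Y e hp hle
      by_cases hne : X = Y
      · rw [hne]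
      · rcases fib X Y hne e with (⟨rfl, rfl⟩ | ⟨rfl, rfl⟩) | (⟨rfl, rfl⟩ | ⟨rfl, rfl⟩) <;>
          simp_all)
    have e1 : onVertex F.right a = onVertex F.right b :=
      hF.onVertex_eq_iff.2 ⟨by rw [hab], eab, by simp [nad, nbd]⟩
    refine ⟨F, ⟨nab, e1, fun X Y hne e => ?_⟩, ?_⟩
    · have h := (hF.onVertex_eq_iff.1 e).2
      rcases fib X Y hne h.1 with h' | ⟨rfl, rfl⟩ | ⟨rfl, rfl⟩
      · exact h'
      · exact absurd h.2 (by simp [ncd])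
      · exact absurd h.2 (by simp [ncd])
    · by_contra hlt
      have hp : onVertex F.right (τ.par d) = onVertex F.right (τ.par c) := by
        rcases hcd with h | h
        · rw [h.1, h.2, e1]
        · rw [h.1, h.2, e1]
      have := (hF d c (level_eq ecd).symm hp).1 (le_of_not_gt hlt)
      have h3 := val_eq ecd
      simp only [ncd, if_true, if_false] at this
      omega
  have npar : τ.par c ≠ τ.par d := by rw [hc, hd]; exact nab
  have fib' : ∀ X Y, X ≠ Y → onVertex u X = onVertex u Y →
      (X = a ∧ Y = b ∨ X = b ∧ Y = a) ∨ (X = d ∧ Y = c ∨ X = c ∧ Y = d) :=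
    fun X Y h e => (fib X Y h e).imp_right Or.symm
  obtain ⟨F₁, m₁, v₁⟩ := exists_fac ncd npar (hca rfl).1 (hca rfl).2 (hca hla.symm).1
    (hca hla.symm).2 (par_ne_self hcl) ecd (Or.inl ⟨hc, hd⟩) fib
  obtain ⟨F₂, m₂, v₂⟩ := exists_fac ncd.symm npar.symm (hca rfl).2 (hca rfl).1 (hca hla.symm).2
    (hca hla.symm).1 (par_ne_self (hlc ▸ hcl)) ecd.symm (Or.inr ⟨hd, hc⟩) fib'
  have d₁ := Factorization.homDeg_left hu m₁
  have d₂ := Factorization.homDeg_left hu m₂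
  have b₁ : F₁.mid.Before (onVertex F₁.right c) (onVertex F₁.right d) := before_of_lt hlc v₁
  have b₂ : F₂.mid.Before (onVertex F₂.right d) (onVertex F₂.right c) :=
    before_of_lt hlc.symm v₂
  refine ⟨F₁, F₂, d₁, d₂, ?_, fun H hH => ?_⟩
  · obtain ⟨e₁, s₁, s₁'⟩ := exists_sgn_mul_eq F₁ m₁
      (Factorization.merges_left d₁ b₁.ne ecd) (hca hla.symm).2.symm
    obtain ⟨e₂, s₂, s₂'⟩ := exists_sgn_mul_eq F₂ m₂
      (Factorization.merges_left d₂ b₂.ne.symm ecd) (hca hla.symm).2.symm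
    rw [s₁, s₂]
    refine neg_one_pow_opposite ?_
    -- Both composites drop `b` and then `d`, so the signs differ only in the comparison of the
    -- images of `c` and `d` in the middle trees.
    rw [s₁', s₂', before_eq_one b₁, before_eq_zero b₂.asymm, add_zero]
  · obtain ⟨p, q, hpq, hlt⟩ := H.exists_merges hu hH
    have hH' : Merges H.right a b := by
      rcases fib p q hpq.1 (H.onVertex_eq hpq.2.1) with
        (⟨rfl, rfl⟩ | ⟨rfl, rfl⟩) | (⟨rfl, rfl⟩ | ⟨rfl, rfl⟩)
      · exact hpq
      · exact hpq.symm
      · exact absurd hpq.par_eq npar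
      · exact absurd hpq.par_eq npar.symm
    have hne : val H.right c ≠ val H.right d := fun e => by
      rcases hH'.2.2 c d ncd (onVertex_eq_iff.2 ⟨hlc, e⟩) with h | h
      · exact (hca rfl).1 h.1.symm
      · exact (hca hla.symm).1 h.1.symm
    have key : ∀ F : Factorization u, Merges F.right a b →
        (val F.right c < val F.right d ↔ val H.right c < val H.right d) →
        val F.right c ≠ val F.right d → H = F := by
      intro F mF hv hneF
      refine Factorization.eq_of_merges hH' mF fun X Y hne' e h hle => ?_
      rcases fib X Y hne' e with h' | h'
      · exfalso
        rcases h' with ⟨rfl, rfl⟩ | ⟨rfl, rfl⟩ <;> rcases h with h | h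
        · exact par_ne_self ha h.1
        · exact par_ne_of_level (hla ▸ ha) hla h.1
        · exact par_ne_of_level ha hla.symm h.1
        · exact par_ne_self (hla ▸ ha) h.1
      · rcases h' with ⟨rfl, rfl⟩ | ⟨rfl, rfl⟩ <;> omega
    rcases lt_or_gt_of_ne hne with h | h
    · exact Or.inl (key F₁ m₁ ⟨fun _ => h, fun _ => v₁⟩ v₁.ne)
    · exact Or.inr (key F₂ m₂ ⟨fun h' => absurd h' v₂.asymm, fun h' => absurd h' h.asymm⟩
        v₂.ne')

/-- One factorization determines the fibres of `u` through its two merges. These overlap, or are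
independent pairs of siblings, or the second merges a child of `a` with a child of `b`. In each case
`OppositePair` holds. -/
theorem sum_sgn_eq_zero {u : τ ⟶ σ} (hu : homDeg u = 2) :
    ∑ F : LeftFactorization u, ((sgn F.1.left * sgn F.1.right : ℤˣ) : ℤ) = 0 := by
  classical
  have key : (∃ F : Factorization u, homDeg F.left = 1) → OppositePair u := by
    rintro ⟨F, hF⟩
    obtain ⟨a, b, hab, hlt⟩ := F.exists_merges hu hF
    obtain ⟨c', d', hcd', hlt'⟩ : ∃ c' d', Merges F.left c' d' ∧ c'.2.val < d'.2.val := by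
      obtain ⟨c, d, hcd⟩ := homDeg_eq_one_iff.1 hF
      rcases lt_trichotomy c.2.val d.2.val with h | h | h
      · exact ⟨c, d, hcd, h⟩
      · exact absurd (vertex_ext hcd.level h) hcd.1
      · exact ⟨d, c, hcd.symm, h⟩
    -- Representatives are chosen different from `b`; this makes them unique.
    have lift : ∀ Y : F.mid.Vertex, ∃ X, X ≠ b ∧ onVertex F.right X = Y := by
      intro Y
      obtain ⟨X, rfl⟩ := onVertex_surjective F.right Y
      by_cases h : X = b
      · exact ⟨a, hab.1, by rw [h, hab.2.1]⟩
      · exact ⟨X, h, rfl⟩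
    obtain ⟨c, hcb, rfl⟩ := lift c'
    obtain ⟨d, hdb, rfl⟩ := lift d'
    have hval : val F.right c < val F.right d := hlt'
    have ncd : c ≠ d := fun e => hcd'.1 (by rw [e])
    have hl : c.1 = d.1 := hcd'.level
    have eab := F.onVertex_eq hab.2.1
    have ecd : onVertex u c = onVertex u d := by
      rw [← F.fac, onVertex_comp, onVertex_comp, hcd'.2.1]
    have fib : ∀ X Y, X ≠ Y → onVertex u X = onVertex u Y →
        (X = a ∧ Y = b ∨ X = b ∧ Y = a) ∨
        (onVertex F.right X = onVertex F.right c ∧ onVertex F.right Y = onVertex F.right d ∨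
        onVertex F.right X = onVertex F.right d ∧ onVertex F.right Y = onVertex F.right c) := by
      intro X Y hne e
      by_cases h : onVertex F.right X = onVertex F.right Y
      · exact Or.inl (hab.2.2 X Y hne h)
      · refine Or.inr (hcd'.2.2 _ _ h ?_)
        rwa [← onVertex_comp, ← onVertex_comp, F.fac]
    have hfibre : ∀ X Z, onVertex F.right X = onVertex F.right Z → Z ≠ b →
        X = Z ∨ Z = a ∧ X = b := by
      intro X Z e hZ
      by_cases h : X = Z
      · exact Or.inl h
      · rcases hab.2.2 X Z h e with h | h
        · exact absurd h.2 hZ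
        · exact Or.inr ⟨h.2, h.1⟩
    have hmem : ∀ X Y, X ≠ Y → onVertex u X = onVertex u Y → X = a ∨ X = b ∨ X = c ∨ X = d := by
      intro X Y hne e
      rcases fib X Y hne e with (h | h) | h | h
      · exact Or.inl h.1
      · exact Or.inr (Or.inl h.1)
      · rcases hfibre _ _ h.1 hcb with h | h
        · exact Or.inr (Or.inr (Or.inl h))
        · exact Or.inr (Or.inl h.2)
      · rcases hfibre _ _ h.1 hdb with h | h
        · exact Or.inr (Or.inr (Or.inr h))
        · exact Or.inr (Or.inl h.2)
    have hpar : τ.par c = τ.par d ∨ (τ.par c = a ∧ τ.par d = b ∨ τ.par c = b ∧ τ.par d = a) := by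
      by_cases h : τ.par c = τ.par d
      · exact Or.inl h
      · refine Or.inr (hab.2.2 _ _ h ?_)
        rw [onVertex_par, onVertex_par, hcd'.par_eq]
    have hpar' : c.1 = a.1 → τ.par c = τ.par d := by
      intro h
      rcases hpar with h' | h' | h'
      · exact h'
      · exact absurd h'.1 (par_ne_of_level hab.not_last h)
      · exact absurd h'.1 (par_ne_of_level hab.symm.not_last (h.trans hab.level))
    have hlt_of : τ.par c = τ.par d → c.2.val < d.2.val := fun h => by
      by_contra hle
      have := val_mono F.right hl.symm h.symm (le_of_not_gt hle)
      omega
    -- As the representatives avoid `b`, the second merge involves the vertex produced by the first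
    -- one exactly if `c` or `d` equals `a`. The fibre of `u` then has three elements.
    by_cases hca : c = a
    · subst hca
      have hp := hpar' rfl
      have hbd : b.2.val < d.2.val := by
        by_contra hle
        have h1 := val_mono F.right (hl.symm.trans hab.level) (hp.symm.trans hab.par_eq)
          (le_of_not_gt hle)
        have h2 := val_eq hab.2.1
        omega
      refine oppositePair_of_triple hu hab.par_eq (hab.par_eq.symm.trans hp) eab
        (eab.symm.trans ecd) hlt hbd fun X Y hne e => ?_
      have hX := hmem X Y hne e
      have hY := hmem Y X hne.symm e.symm
      constructor
      · rcases hX with h | h | h | h <;> simp [h]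
      · rcases hY with h | h | h | h <;> simp [h]
    by_cases hda : d = a
    · subst hda
      have hp := hpar' hl
      refine oppositePair_of_triple hu hp hab.par_eq ecd eab (hlt_of hp) hlt
        fun X Y hne e => ?_
      have hX := hmem X Y hne e
      have hY := hmem Y X hne.symm e.symm
      constructor
      · rcases hX with h | h | h | h <;> simp [h]
      · rcases hY with h | h | h | h <;> simp [h]
    have fib' : ∀ X Y, X ≠ Y → onVertex u X = onVertex u Y →
        (X = a ∧ Y = b ∨ X = b ∧ Y = a) ∨ (X = c ∧ Y = d ∨ X = d ∧ Y = c) := by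
      intro X Y hne e
      rcases fib X Y hne e with h | h | h
      · exact Or.inl h
      · exact Or.inr (Or.inl ⟨(hfibre _ _ h.1 hcb).resolve_right fun h => hca h.1,
          (hfibre _ _ h.2 hdb).resolve_right fun h => hda h.1⟩)
      · exact Or.inr (Or.inr ⟨(hfibre _ _ h.1 hdb).resolve_right fun h => hda h.1,
          (hfibre _ _ h.2 hcb).resolve_right fun h => hca h.1⟩)
    rcases hpar with hp | hp | hp
    · exact oppositePair_of_pairs hu hab.par_eq hp eab ecd hlt (hlt_of hp) (Ne.symm hca)
        (Ne.symm hda) hcb.symm hdb.symm fib'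
    · exact oppositePair_of_children hu hab.par_eq hp.1 hp.2 eab ecd hlt fib'
    · exact oppositePair_of_children hu hab.par_eq hp.2 hp.1 eab ecd.symm hlt
        fun X Y h e => (fib' X Y h e).imp_right Or.symm
  by_cases hex : ∃ F : Factorization u, homDeg F.left = 1
  · obtain ⟨F₁, F₂, d₁, d₂, hs, hall⟩ := key hex
    -- A unit of ℤ is never its own negative, so the two factorizations are distinct and the sum has
    -- exactly two terms.
    have hne : (⟨F₁, d₁⟩ : LeftFactorization u) ≠ ⟨F₂, d₂⟩ := fun e => by
      obtain rfl : F₁ = F₂ := congrArg Subtype.val e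
      rcases Int.units_eq_one_or (sgn F₁.left * sgn F₁.right) with h | h <;>
        rw [h] at hs <;> exact absurd hs (by decide)
    have huniv : (Finset.univ : Finset (LeftFactorization u)) = {⟨F₁, d₁⟩, ⟨F₂, d₂⟩} := by
      ext ⟨H, hH⟩
      simpa using hall H hH
    rw [huniv, Finset.sum_pair hne]
    simp only
    rw [hs]
    simp
  · have : IsEmpty (LeftFactorization u) := ⟨fun F => hex ⟨F.1, F.2⟩⟩
    simp

end PrunedTree

/-! ### The differential of the Koszul complex -/

namespace PrunedTree

variable {n : ℕ} {τ σ : PrunedTree n}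

noncomputable instance (u : τ ⟶ σ) :
    Fintype {F : Factorization u // homDeg F.left = 2} := Fintype.ofFinite _

noncomputable instance (u : τ ⟶ σ) :
    Fintype {F : Factorization u // homDeg F.right = 2} := Fintype.ofFinite _

/-- Factorizations into three morphisms, grouped in two ways. -/
def leftLeftEquiv (u : τ ⟶ σ) :
    (Σ f : LeftFactorization u, LeftFactorization f.1.right) ≃
      (Σ F : {F : Factorization u // homDeg F.left = 2}, LeftFactorization F.1.left) where
  toFun a := ⟨⟨⟨a.2.1.mid, a.2.1.right, a.2.1.left ≫ a.1.1.left, by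
      rw [← Category.assoc, a.2.1.fac, a.1.1.fac]⟩, by
      rw [homDeg_comp, a.1.2, a.2.2]; rfl⟩, ⟨a.1.1.mid, a.2.1.left, a.1.1.left, rfl⟩, a.1.2⟩
  invFun a := ⟨⟨⟨a.2.1.mid, a.1.1.right ≫ a.2.1.right, a.2.1.left, by
      rw [Category.assoc, a.2.1.fac, a.1.1.fac]⟩, a.2.2⟩,
      ⟨a.1.1.mid, a.1.1.right, a.2.1.right, rfl⟩, by
        have h1 := a.1.2
        have h2 := a.2.1.homDeg_eq
        have h3 := a.2.2
        dsimp only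
        omega⟩
  left_inv := by
    rintro ⟨⟨⟨θ, w, v, h⟩, hv⟩, g⟩
    change LeftFactorization w at g
    obtain ⟨⟨θ', w', v', rfl⟩, hv'⟩ := g
    rfl
  right_inv := by
    rintro ⟨⟨⟨θ, w, v, h⟩, hv⟩, g⟩
    change LeftFactorization v at g
    obtain ⟨⟨θ', w', v', rfl⟩, hv'⟩ := g
    rfl

/-- Factorizations into three morphisms, grouped in two ways. -/
def rightRightEquiv (u : τ ⟶ σ) :
    (Σ f : RightFactorization u, RightFactorization f.1.left) ≃
      (Σ F : {F : Factorization u // homDeg F.right = 2}, LeftFactorization F.1.right) where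
  toFun a := ⟨⟨⟨a.2.1.mid, a.1.1.right ≫ a.2.1.right, a.2.1.left, by
      rw [Category.assoc, a.2.1.fac, a.1.1.fac]⟩, by
      rw [homDeg_comp, a.1.2, a.2.2]; rfl⟩, ⟨a.1.1.mid, a.1.1.right, a.2.1.right, rfl⟩, a.2.2⟩
  invFun a := ⟨⟨⟨a.2.1.mid, a.2.1.right, a.2.1.left ≫ a.1.1.left, by
      rw [← Category.assoc, a.2.1.fac, a.1.1.fac]⟩, by
        have h1 := a.1.2
        have h2 := a.2.1.homDeg_eq
        have h3 := a.2.2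
        dsimp only
        omega⟩,
      ⟨a.1.1.mid, a.2.1.left, a.1.1.left, rfl⟩, a.2.2⟩
  left_inv := by
    rintro ⟨⟨⟨θ, w, v, h⟩, hv⟩, g⟩
    change RightFactorization v at g
    obtain ⟨⟨θ', w', v', rfl⟩, hv'⟩ := g
    rfl
  right_inv := by
    rintro ⟨⟨⟨θ, w, v, h⟩, hv⟩, g⟩
    change LeftFactorization w at g
    obtain ⟨⟨θ', w', v', rfl⟩, hv'⟩ := g
    rfl

/-- Factorizations into three morphisms, grouped in two ways. -/
def leftRightEquiv (u : τ ⟶ σ) :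
    (Σ f : LeftFactorization u, RightFactorization f.1.right) ≃
      (Σ f : RightFactorization u, LeftFactorization f.1.left) where
  toFun a := ⟨⟨⟨a.2.1.mid, a.2.1.right, a.2.1.left ≫ a.1.1.left, by
      rw [← Category.assoc, a.2.1.fac, a.1.1.fac]⟩, a.2.2⟩,
      ⟨a.1.1.mid, a.2.1.left, a.1.1.left, rfl⟩, a.1.2⟩
  invFun a := ⟨⟨⟨a.2.1.mid, a.1.1.right ≫ a.2.1.right, a.2.1.left, by
      rw [Category.assoc, a.2.1.fac, a.1.1.fac]⟩, a.2.2⟩,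
      ⟨a.1.1.mid, a.1.1.right, a.2.1.right, rfl⟩, a.1.2⟩
  left_inv := by
    rintro ⟨⟨⟨θ, w, v, h⟩, hv⟩, g⟩
    change RightFactorization w at g
    obtain ⟨⟨θ', w', v', rfl⟩, hv'⟩ := g
    rfl
  right_inv := by
    rintro ⟨⟨⟨θ, w, v, h⟩, hv⟩, g⟩
    change LeftFactorization v at g
    obtain ⟨⟨θ', w', v', rfl⟩, hv'⟩ := g
    rfl

lemma sum_sgn_smul_eq_zero {M : Type*} [AddCommGroup M] {u : τ ⟶ σ} (hu : homDeg u = 2)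
    (ε : ℤˣ) (z : M) : ∑ F : LeftFactorization u, (ε * (sgn F.1.left * sgn F.1.right)) • z = 0 := by
  simp only [Units.smul_def]
  rw [← Finset.sum_smul]
  push_cast
  rw [← Finset.mul_sum]
  have := sum_sgn_eq_zero hu
  push_cast at this
  rw [this, mul_zero, zero_smul]

end PrunedTree

/-! ### Vanishing of the square of the Koszul differential -/

section Koszul

open PrunedTree

variable {k : Type u} [CommRing k] {n : ℕ}

lemma map_units_smul {M N : Type*} [AddCommGroup M] [AddCommGroup N] [Module k M] [Module k N]
    (f : M →ₗ[k] N) (ε : ℤˣ) (z : M) : f (ε • z) = ε • f z := by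
  rw [Units.smul_def, Units.smul_def, map_zsmul]

lemma dgMod_d_d {C : DGMod k} (i j l : ℤ) (x : C.X i) : C.d j l (C.d i j x) = 0 := by
  rw [← ModuleCat.comp_apply, HomologicalComplex.d_comp_d]
  rfl

lemma diagram_map_comp {J : Type} [SmallCategory J] (F : J ⥤ DGMod k) {a b c : J} (w : a ⟶ b)
    (v : b ⟶ c) (i : ℤ) (x : (F.obj a).X i) :
    (F.map (w ≫ v)).f i x = (F.map v).f i ((F.map w).f i x) := by
  rw [F.map_comp, HomologicalComplex.comp_f, ModuleCat.comp_apply]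

section

variable (S : ContraDiagram k n) (T : CovDiagram k n) {τ σ : PrunedTree n}

/-- For a fixed composite of the two left factors, a morphism of degree two, the sum is the one of
`sum_sgn_eq_zero`. The sign (-1)^p occurs twice and cancels. -/
lemma koszul_leftLeft {i : ℤ} (u : τ ⟶ σ) (p q : ℤ) (h : p + homDeg u + q = i + 2)
    (x : (S.obj (op σ)).X p) (y : (T.obj τ).X q) :
    ∑ f : LeftFactorization u, ∑ g : LeftFactorization f.1.right,
      ((p.negOnePow * sgn f.1.left) * (p.negOnePow * sgn g.1.left)) •
        koszulIncl S T (i := i) g.1.right p q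
          (by have := f.1.homDeg_eq; have := f.2; have := g.1.homDeg_eq; have := g.2; omega)
          ((S.map g.1.left.op).f p ((S.map f.1.left.op).f p x) ⊗ₜ y) = 0 := by
  rw [← Fintype.sum_sigma', Fintype.sum_equiv (leftLeftEquiv u) _ (fun a =>
      ((1 : ℤˣ) * (sgn a.2.1.left * sgn a.2.1.right)) •
        koszulIncl S T (i := i) a.1.1.right p q
          (by have := a.1.1.homDeg_eq; have := a.1.2; omega)
          ((S.map a.1.1.left.op).f p x ⊗ₜ y)), Fintype.sum_sigma]
  · exact Finset.sum_eq_zero fun F _ => sum_sgn_smul_eq_zero F.2 1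
      (koszulIncl S T (i := i) F.1.right p q (by have := F.1.homDeg_eq; have := F.2; omega)
        ((S.map F.1.left.op).f p x ⊗ₜ y))
  · rintro ⟨f, g⟩
    have : p.negOnePow * sgn f.1.left * (p.negOnePow * sgn g.1.left)
        = 1 * (sgn f.1.left * sgn g.1.left) := by
      rw [mul_mul_mul_comm, Int.units_mul_self]
    change _ = ((1 : ℤˣ) * (sgn f.1.left * sgn g.1.left)) • koszulIncl S T g.1.right p q _
      ((S.map (g.1.left ≫ f.1.left).op).f p x ⊗ₜ y)
    rw [this, op_comp, diagram_map_comp]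

/-- Here the degrees of the two remaining left factors differ by one, so the prefactor is the
constant -1 and the sum again reduces to `sum_sgn_eq_zero`. -/
lemma koszul_rightRight {i : ℤ} (u : τ ⟶ σ) (p q : ℤ) (h : p + homDeg u + q = i + 2)
    (x : (S.obj (op σ)).X p) (y : (T.obj τ).X q) :
    ∑ f : RightFactorization u, ∑ g : RightFactorization f.1.left,
      (((p + homDeg f.1.left).negOnePow * sgn f.1.right) *
        ((p + homDeg g.1.left).negOnePow * sgn g.1.right)) •
        koszulIncl S T (i := i) g.1.left p q
          (by have := f.1.homDeg_eq; have := f.2; have := g.1.homDeg_eq; have := g.2; omega)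
          (x ⊗ₜ (T.map g.1.right).f q ((T.map f.1.right).f q y)) = 0 := by
  rw [← Fintype.sum_sigma', Fintype.sum_equiv (rightRightEquiv u) _ (fun a =>
      ((-1 : ℤˣ) * (sgn a.2.1.left * sgn a.2.1.right)) •
        koszulIncl S T (i := i) a.1.1.left p q
          (by have := a.1.1.homDeg_eq; have := a.1.2; omega)
          (x ⊗ₜ (T.map a.1.1.right).f q y)), Fintype.sum_sigma]
  · exact Finset.sum_eq_zero fun F _ => sum_sgn_smul_eq_zero F.2 (-1)
      (koszulIncl S T (i := i) F.1.left p q (by have := F.1.homDeg_eq; have := F.2; omega)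
        (x ⊗ₜ (T.map F.1.right).f q y))
  · rintro ⟨f, g⟩
    have : (p + homDeg f.1.left).negOnePow * sgn f.1.right *
        ((p + homDeg g.1.left).negOnePow * sgn g.1.right)
        = -1 * (sgn g.1.right * sgn f.1.right) := by
      rw [g.1.homDeg_eq, g.2, mul_mul_mul_comm, mul_comm (sgn _) (sgn _), add_comm (1 : ℤ),
        ← add_assoc, Int.negOnePow_succ, neg_mul, Int.units_mul_self]
    change _ = ((-1 : ℤˣ) * (sgn g.1.right * sgn f.1.right)) • koszulIncl S T g.1.left p q _
      (x ⊗ₜ (T.map (f.1.right ≫ g.1.right)).f q y)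
    rw [this, diagram_map_comp]

/-- Both sums run over the same triple factorizations. Removing the left factor first lowers the
degree that enters the sign of the right term by one, which makes the terms opposite. -/
lemma koszul_leftRight {i : ℤ} (u : τ ⟶ σ) (p q : ℤ) (h : p + homDeg u + q = i + 2)
    (x : (S.obj (op σ)).X p) (y : (T.obj τ).X q) :
    ∑ f : LeftFactorization u, ∑ g : RightFactorization f.1.right,
      ((p.negOnePow * sgn f.1.left) * ((p + homDeg g.1.left).negOnePow * sgn g.1.right)) •
        koszulIncl S T (i := i) g.1.left p q
          (by have := f.1.homDeg_eq; have := f.2; have := g.1.homDeg_eq; have := g.2; omega)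
          ((S.map f.1.left.op).f p x ⊗ₜ (T.map g.1.right).f q y)
    + ∑ f : RightFactorization u, ∑ g : LeftFactorization f.1.left,
      (((p + homDeg f.1.left).negOnePow * sgn f.1.right) * (p.negOnePow * sgn g.1.left)) •
        koszulIncl S T (i := i) g.1.right p q
          (by have := f.1.homDeg_eq; have := f.2; have := g.1.homDeg_eq; have := g.2; omega)
          ((S.map g.1.left.op).f p x ⊗ₜ (T.map f.1.right).f q y) = 0 := by
  rw [← Fintype.sum_sigma', ← Fintype.sum_sigma', ← Equiv.sum_comp (leftRightEquiv u),
    ← Finset.sum_add_distrib]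
  refine Finset.sum_eq_zero fun a _ => ?_
  obtain ⟨f, g⟩ := a
  simp only [leftRightEquiv, Equiv.coe_fn_mk]
  have : (p + homDeg (g.1.left ≫ f.1.left)).negOnePow * sgn g.1.right *
      (p.negOnePow * sgn f.1.left)
      = -((p.negOnePow * sgn f.1.left) * ((p + homDeg g.1.left).negOnePow * sgn g.1.right)) := by
    have key : ∀ a b c d : ℤˣ, -a * b * (c * d) = -(c * d * (a * b)) := by decide
    rw [homDeg_comp, f.2, ← add_assoc, Int.negOnePow_succ, key]
  rw [this, Units.neg_smul]
  exact add_neg_cancel _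

end

/-- The squares of the internal differentials vanish and their mixed terms cancel by the parities
`e1`, `e2`, `eL` and `eR`. The double sums that remain are the three treated above. -/
theorem koszulSquareZero (S : ContraDiagram k n) (T : CovDiagram k n) : KoszulSquareZero S T := by
  intro i j l hij hjl
  refine DirectSum.linearMap_ext _ fun a => TensorProduct.ext' fun x y => ?_
  obtain ⟨τ, σ, u, p, q, h⟩ := a
  change koszulD S T hjl (koszulD S T hij (koszulIncl S T u p q h (x ⊗ₜ y))) = 0
  have key : ∀ a b c : ℤˣ, -a * (b * c) = -(b * c * a) := by decide
  have eL : ∀ f : LeftFactorization u, (p + homDeg u).negOnePow * (p.negOnePow * sgn f.1.left)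
      = -(p.negOnePow * sgn f.1.left * (p + homDeg f.1.right).negOnePow) := fun f => by
    rw [f.1.homDeg_eq, f.2, ← add_assoc, Int.negOnePow_succ, key]
  have eR : ∀ f : RightFactorization u,
      (p + homDeg u).negOnePow * ((p + homDeg f.1.left).negOnePow * sgn f.1.right)
      = -((p + homDeg f.1.left).negOnePow * sgn f.1.right * (p + homDeg f.1.left).negOnePow) :=
    fun f => by
      rw [f.1.homDeg_eq, f.2, add_comm 1, ← add_assoc, Int.negOnePow_succ, key]
  have e1 : (p - 1).negOnePow = -p.negOnePow := by
    rw [Int.negOnePow_sub, Int.negOnePow_one, mul_neg_one]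
  have e2 : ∀ m : ℤ, (p - 1 + m).negOnePow = -(p + m).negOnePow := fun m => by
    rw [show p - 1 + m = p + m - 1 by ring, Int.negOnePow_sub, Int.negOnePow_one, mul_neg_one]
  have hLL := koszul_leftLeft S T (i := l) u p q (by omega) x y
  have hRR := koszul_rightRight S T (i := l) u p q (by omega) x y
  have hLR := koszul_leftRight S T (i := l) u p q (by omega) x y
  simp only [koszulD_incl, map_add, map_sum, map_units_smul, smul_add, Finset.smul_sum, smul_smul,
    dgMod_d_d, f_d_apply, TensorProduct.zero_tmul, TensorProduct.tmul_zero, map_zero, smul_zero,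
    Finset.sum_add_distrib, e1, e2, eL, eR, neg_mul, Units.neg_smul, Finset.sum_neg_distrib]
  rw [hLL, hRR, eq_neg_of_add_eq_zero_left hLR]
  abel

end Koszul

/-! ### A matching on the factorizations of a morphism -/

namespace PrunedTree

variable {n : ℕ} {τ σ θ : PrunedTree n}

/-- The vertex `b` is the last one in a class of at least two siblings that `f` merges, and `f`
merges no siblings of lower level. -/
structure Pivot (f : θ ⟶ σ) (b : θ.Vertex) : Prop where
  exists_left : ∃ a, onVertex f a = onVertex f b ∧ θ.par a = θ.par b ∧ a.2.val < b.2.val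
  last : ∀ c, onVertex f c = onVertex f b → θ.par c = θ.par b → c.2.val ≤ b.2.val
  low : ∀ x y : θ.Vertex, x.1.val < b.1.val → onVertex f x = onVertex f y →
    θ.par x = θ.par y → x = y

/-- Collect the vertices that have a merged sibling to their left, and among them choose the
smallest level and then the rightmost position on it. -/
lemma exists_pivot {f : θ ⟶ σ} (hf : homDeg f ≠ 0) : ∃ b, Pivot f b := by
  classical
  have h1 : ∃ X Y, X ≠ Y ∧ onVertex f X = onVertex f Y := by
    by_contra h
    push Not at h
    have hinj : Function.Injective (onVertex f) := fun X Y e => by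
      by_contra hne
      exact h X Y hne e
    refine hf ?_
    rw [homDeg_eq_card, Fintype.card_of_bijective ⟨hinj, onVertex_surjective f⟩, sub_self]
  have h2 : ∃ X Y : θ.Vertex, X ≠ Y ∧ onVertex f X = onVertex f Y ∧ θ.par X = θ.par Y := by
    obtain ⟨X, Y, hne, e⟩ := h1
    -- If two identified vertices are not siblings, their parents are distinct and identified;
    -- descending towards the root ends at a pair of siblings.
    refine pair_induction (P := fun X Y => X ≠ Y → onVertex f X = onVertex f Y →
      ∃ X Y : θ.Vertex, X ≠ Y ∧ onVertex f X = onVertex f Y ∧ θ.par X = θ.par Y)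
      (fun X Y hX hY hne => absurd (root_unique hX hY) hne)
      (fun X Y hl _ ih hne e => ?_) X Y (level_eq e) hne e
    by_cases hp : θ.par X = θ.par Y
    · exact ⟨X, Y, hne, e, hp⟩
    · exact ih hp (onVertex_par_congr e)
  let A : Finset θ.Vertex := Finset.univ.filter fun y =>
    ∃ x, onVertex f x = onVertex f y ∧ θ.par x = θ.par y ∧ x.2.val < y.2.val
  have hA : ∀ x y : θ.Vertex, x ≠ y → onVertex f x = onVertex f y → θ.par x = θ.par y →
      x ∈ A ∨ y ∈ A := by
    intro x y hne e hp
    simp only [A, Finset.mem_filter, Finset.mem_univ, true_and]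
    rcases lt_trichotomy x.2.val y.2.val with h | h | h
    · exact Or.inr ⟨x, e, hp, h⟩
    · exact absurd (vertex_ext (level_eq e) h) hne
    · exact Or.inl ⟨y, e.symm, hp.symm, h⟩
  have hne : A.Nonempty := by
    obtain ⟨X, Y, hne, e, hp⟩ := h2
    rcases hA X Y hne e hp with h | h
    · exact ⟨_, h⟩
    · exact ⟨_, h⟩
  obtain ⟨b₀, hb₀, hmin⟩ := Finset.exists_min_image A (fun y => y.1.val) hne
  obtain ⟨b, hb, hmax⟩ := Finset.exists_max_image (A.filter fun y => y.1.val = b₀.1.val)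
    (fun y => y.2.val) ⟨b₀, Finset.mem_filter.2 ⟨hb₀, rfl⟩⟩
  rw [Finset.mem_filter] at hb
  refine ⟨b, (Finset.mem_filter.1 hb.1).2, fun c e hp => ?_, fun x y hlt e hp => ?_⟩
  · by_contra hlt
    push Not at hlt
    have hc : c ∈ A := Finset.mem_filter.2 ⟨Finset.mem_univ _, b, e.symm, hp.symm, hlt⟩
    exact absurd (hmax c (Finset.mem_filter.2 ⟨hc, by rw [level_eq e]; exact hb.2⟩))
      (not_le.2 hlt)
  · by_contra hne
    rcases hA x y hne e hp with h | h
    · have := hmin _ h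
      omega
    · have := hmin _ h
      rw [← level_eq e] at this
      omega

/-- A numbering of the vertices by increasing level. -/
def number (c : θ.Vertex) : ℕ := c.1.val * Fintype.card θ.Vertex + c.2.val

lemma snd_lt_card (c : θ.Vertex) : c.2.val < Fintype.card θ.Vertex := by
  refine c.2.isLt.trans_le ?_
  rw [Fintype.card_sigma]
  simpa using Finset.single_le_sum (f := fun i => θ.card i) (fun _ _ => Nat.zero_le _)
    (Finset.mem_univ c.1)

lemma number_lt {c d : θ.Vertex} (h : c.1.val < d.1.val) : number c < number d := by
  have h1 := snd_lt_card c
  have h2 := Nat.mul_le_mul_right (Fintype.card θ.Vertex) (Nat.succ_le_of_lt h)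
  rw [Nat.succ_mul] at h2
  unfold number
  omega

lemma number_injective : Function.Injective (number (θ := θ)) := by
  intro c d h
  rcases lt_trichotomy c.1.val d.1.val with h' | h' | h'
  · exact absurd h (number_lt h').ne
  · refine vertex_ext (Fin.ext h') ?_
    unfold number at h
    rw [h'] at h
    omega
  · exact absurd h (number_lt h').ne'

namespace Factorization

variable {f : θ ⟶ σ} {b c d t : θ.Vertex} {F G : Factorization f}

/-- `t` lies in the same fibre as `c`: their parents have the same image in the middle tree, and
they have the same image under `f`. -/
def SameFibre (F : Factorization f) (c t : θ.Vertex) : Prop :=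
  onVertex F.right (θ.par t) = onVertex F.right (θ.par c) ∧ onVertex f t = onVertex f c

/-- `c` is alone at the leftmost position of its fibre. -/
def Leftmost (F : Factorization f) (c : θ.Vertex) : Prop :=
  ∀ t, F.SameFibre c t → t ≠ c → val F.right c < val F.right t

/-- `c` is the first vertex above `b` that is not alone at the leftmost position of its fibre. -/
structure IsToggle (F : Factorization f) (b c : θ.Vertex) : Prop where
  ancestor : θ.Ancestor c b
  not_leftmost : ¬ F.Leftmost c
  leftmost : ∀ d, θ.Ancestor d b → number d < number c → F.Leftmost d

/-- `c` is merged with another vertex in the middle tree. -/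
def IsMerged (F : Factorization f) (c : θ.Vertex) : Prop :=
  ∃ t, t ≠ c ∧ onVertex F.right t = onVertex F.right c

/-- `G` is a quotient of `F` by a morphism of degree one. -/
def Covers (F G : Factorization f) : Prop :=
  ∃ e : F.mid ⟶ G.mid, homDeg e = 1 ∧ F.right ≫ e = G.right

open Classical in
/-- The number of vertices that are not to the right of `c` in its fibre. -/
noncomputable def position (F : Factorization f) (c : θ.Vertex) : ℕ :=
  (Finset.univ.filter fun t => F.SameFibre c t ∧ t ≠ c ∧ val F.right t ≤ val F.right c).card

lemma Covers.refines (h : F.Covers G) : Refines F.right G.right := by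
  obtain ⟨e, -, he⟩ := h
  rw [← he]
  exact refines_comp _ _

lemma Covers.homDeg (h : F.Covers G) : homDeg G.right = homDeg F.right + 1 := by
  obtain ⟨e, h1, he⟩ := h
  rw [← he, homDeg_comp, h1]

lemma SameFibre.of_refines (h : Refines F.right G.right) (ht : F.SameFibre c t) :
    G.SameFibre c t :=
  ⟨h.onVertex_eq ht.1, ht.2⟩

lemma Leftmost.eq (h : F.Leftmost c) (e : onVertex F.right t = onVertex F.right c) : t = c := by
  by_contra hne
  exact (h t ⟨onVertex_par_congr e, F.onVertex_eq e⟩ hne).ne' (val_eq e)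

lemma IsToggle.unique (h : F.IsToggle b c) (h' : F.IsToggle b d) : c = d := by
  rcases lt_trichotomy (number c) (number d) with hlt | e | hlt
  · exact absurd (h'.leftmost c h.ancestor hlt) h.not_leftmost
  · exact number_injective e
  · exact absurd (h.leftmost d h'.ancestor hlt) h'.not_leftmost

end Factorization

/-! ### Splitting and merging at the toggle -/

section Pivot

open Factorization

variable {f : θ ⟶ σ} {b c d t : θ.Vertex} {F G : Factorization f}

lemma Pivot.not_last (hb : Pivot f b) : b.1 ≠ Fin.last n := fun e => by
  obtain ⟨a, ha, -, hlt⟩ := hb.exists_left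
  rw [root_unique ((level_eq ha).trans e) e] at hlt
  exact lt_irrefl _ hlt

lemma Pivot.level_lt (hc : θ.Ancestor c b) (hne : c ≠ b) : c.1.val < b.1.val :=
  lt_of_le_of_ne hc.iterate.1 fun e => hne (hc.eq_of_level (Fin.ext e))

lemma Pivot.level_ne (hb : Pivot f b) (hc : θ.Ancestor c b) : c.1 ≠ Fin.last n := fun e => by
  by_cases h : c = b
  · exact hb.not_last (h ▸ e)
  · have h1 := Pivot.level_lt hc h
    have h2 := b.1.isLt
    rw [e, Fin.val_last] at h1
    omega

lemma Pivot.ancestor_par (hc : θ.Ancestor c b) (hne : c ≠ b) : θ.Ancestor (θ.par c) b := by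
  rcases Relation.ReflTransGen.cases_head hc with h | ⟨d, h1, h2⟩
  · exact absurd h hne
  · rwa [(parent_iff.1 h1).2]

lemma Pivot.ancestor_child (hc : θ.Ancestor c b) (h : θ.par d = c) : θ.Ancestor d b := by
  subst h
  exact (PrunedTree.ancestor_par d).trans hc

lemma Pivot.child_level (hb : Pivot f b) (hc : θ.Ancestor c b) (h : θ.par d = c) :
    d.1.val < c.1.val := by
  have hd : d.1 ≠ Fin.last n := fun e => by
    rw [par_of_last e] at h
    exact hb.level_ne hc (h ▸ e)
  have := level_par hd
  rw [h] at this
  omega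

/-- Induction along the branch: identified vertices above `b` have identified parents, which are
equal by induction. They are then merged siblings of a level below that of `b`, and such siblings
coincide. -/
lemma Pivot.injective (hb : Pivot f b) (hc : θ.Ancestor c b) (hd : θ.Ancestor d b)
    (e : onVertex f c = onVertex f d) : c = d := by
  refine pair_induction (P := fun c d => θ.Ancestor c b → θ.Ancestor d b →
    onVertex f c = onVertex f d → c = d) (fun X Y hX hY _ _ _ => root_unique hX hY)
    (fun X Y hl _ ih hX hY e => ?_) c d (level_eq e) hc hd e
  by_cases hXb : X = b
  · subst hXb
    exact (hY.eq_of_level hl.symm).symm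
  by_cases hYb : Y = b
  · subst hYb
    exact hX.eq_of_level hl
  exact hb.low X Y (Pivot.level_lt hX hXb) e
    (ih (Pivot.ancestor_par hX hXb) (Pivot.ancestor_par hY hYb) (onVertex_par_congr e))

/-- For `b` this is part of the definition of a pivot, and the other vertices above `b` have no
merged siblings. It allows every vertex above `b` to be split off to the right. -/
lemma Pivot.last_of_ancestor (hb : Pivot f b) (hc : θ.Ancestor c b)
    (e : onVertex f t = onVertex f c) (hp : θ.par t = θ.par c) : t.2.val ≤ c.2.val := by
  by_cases h : c = b
  · subst h
    exact hb.last t e hp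
  · rw [hb.low t c (by rw [level_eq e]; exact Pivot.level_lt hc h) e hp]

lemma Pivot.child_unique (hb : Pivot f b) (hc : θ.Ancestor c b) {X Y : θ.Vertex}
    (hX : θ.par X = c) (hY : θ.par Y = c) (e : onVertex f X = onVertex f Y) : X = Y :=
  hb.injective (Pivot.ancestor_child hc hX) (Pivot.ancestor_child hc hY) e

lemma Pivot.leftmost_child (hb : Pivot f b) (hF : F.IsToggle b c) (h : θ.par d = c) :
    F.Leftmost d :=
  hF.leftmost d (Pivot.ancestor_child hF.ancestor h) (number_lt (hb.child_level hF.ancestor h))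

lemma Pivot.par_ne (hb : Pivot f b) (hc : θ.Ancestor c b) (h : d.1 = c.1) : θ.par d ≠ c :=
  par_ne_of_level (hb.level_ne hc) h

/-- The pivot itself is never leftmost, since it has a merged sibling to its left; so the search for
the toggle ends. -/
lemma Pivot.exists_toggle (hb : Pivot f b) (F : Factorization f) : ∃ c, F.IsToggle b c := by
  classical
  let A : Finset θ.Vertex := Finset.univ.filter fun c => θ.Ancestor c b ∧ ¬ F.Leftmost c
  have hbA : b ∈ A := by
    refine Finset.mem_filter.2 ⟨Finset.mem_univ _, Relation.ReflTransGen.refl, fun h => ?_⟩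
    obtain ⟨a, e, hp, hlt⟩ := hb.exists_left
    have h1 := h a ⟨by rw [hp], e⟩ (fun e => by rw [e] at hlt; exact lt_irrefl _ hlt)
    have h2 := val_mono F.right (level_eq e) hp hlt.le
    omega
  obtain ⟨c, hc, hmin⟩ := Finset.exists_min_image A number ⟨b, hbA⟩
  have hc' := (Finset.mem_filter.1 hc).2
  refine ⟨c, hc'.1, hc'.2, fun d hd hlt => ?_⟩
  by_contra h
  exact absurd (hmin d (Finset.mem_filter.2 ⟨Finset.mem_univ _, hd, h⟩)) (not_le.2 hlt)

open Classical in
/-- The coordinates after the vertex `c` has been split off to the right. -/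
noncomputable def splitCoord (F : Factorization f) (c X : θ.Vertex) : ℕ :=
  -- Doubling leaves a free position immediately to the right of every block.
  2 * val F.right X + if X = c then 1 else 0

lemma Pivot.exists_split (hb : Pivot f b) (F : Factorization f) (hc : θ.Ancestor c b) :
    ∃ F' : Factorization f, F'.IsSortedBy (splitCoord F c) := by
  refine exists_isSortedBy f _ fun X Y e hp hle => ?_
  have h1 := val_mono F.right (level_eq e) hp hle
  unfold splitCoord
  by_cases hX : X = c
  · subst hX
    have h2 := hb.last_of_ancestor hc e.symm hp.symm
    rw [vertex_ext (level_eq e) (le_antisymm hle h2)]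
  · rw [if_neg hX]
    omega

/-- The factorization in which the toggle `c` is split off to the right of its block. -/
noncomputable def Pivot.split (hb : Pivot f b) (F : Factorization f) (c : θ.Vertex)
    (hc : θ.Ancestor c b) : Factorization f :=
  (hb.exists_split F hc).choose

lemma Pivot.split_sorted (hb : Pivot f b) (F : Factorization f) (hc : θ.Ancestor c b) :
    (hb.split F c hc).IsSortedBy (splitCoord F c) :=
  (hb.exists_split F hc).choose_spec

/-- Splitting `c` off separates nothing else. The vertices in danger are the children of `c`, and
these are alone in their positions because they lie above `b` and precede the toggle. -/
lemma Pivot.split_eq_iff (hb : Pivot f b) (hF : F.IsToggle b c) {X Y : θ.Vertex} :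
    onVertex (hb.split F c hF.ancestor).right X = onVertex (hb.split F c hF.ancestor).right Y ↔
      onVertex F.right X = onVertex F.right Y ∧ (X = c ↔ Y = c) := by
  have hs := hb.split_sorted F hF.ancestor
  constructor
  · intro h
    obtain ⟨-, h1, h2⟩ := hs.onVertex_eq_iff.1 h
    unfold splitCoord at h2
    rw [onVertex_eq_iff]
    split_ifs at h2 with h3 h4 h4
    · exact ⟨⟨level_eq h1, by omega⟩, by simp [h3, h4]⟩
    · omega
    · omega
    · exact ⟨⟨level_eq h1, by omega⟩, by simp [h3, h4]⟩
  · rintro ⟨h, h'⟩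
    refine pair_induction (P := fun X Y => onVertex F.right X = onVertex F.right Y →
      (X = c ↔ Y = c) → onVertex (hb.split F c hF.ancestor).right X =
        onVertex (hb.split F c hF.ancestor).right Y)
      (fun X Y hX hY _ _ => by rw [root_unique hX hY])
      (fun X Y hl _ ih h h' => ?_) X Y (level_eq h) h h'
    refine hs.onVertex_eq_iff.2 ⟨ih (onVertex_par_congr h) ⟨fun e => ?_, fun e => ?_⟩,
      F.onVertex_eq h, ?_⟩
    · rw [(hb.leftmost_child hF e).eq h.symm, e]
    · rw [(hb.leftmost_child hF e).eq h, e]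
    · unfold splitCoord
      rw [val_eq h]
      simp only [h']

lemma Pivot.split_refines (hb : Pivot f b) (hF : F.IsToggle b c) :
    Refines (hb.split F c hF.ancestor).right F.right := by
  intro X Y hl hp hle
  have hp' := ((hb.split_eq_iff hF).1 hp).1
  rcases ((hb.split_sorted F hF.ancestor) X Y hl hp).1 hle with h | ⟨-, h⟩
  · by_contra hlt
    have := F.refines Y X hl.symm hp'.symm (le_of_not_ge hlt)
    omega
  · unfold splitCoord at h
    split_ifs at h <;> omega

lemma Pivot.split_covers (hb : Pivot f b) (hF : F.IsToggle b c) (hm : F.IsMerged c) :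
    (hb.split F c hF.ancestor).Covers F := by
  obtain ⟨e, he⟩ := (hb.split_refines hF).exists_fac
  refine ⟨e, ?_, he⟩
  obtain ⟨t, hne, ht⟩ := hm
  have hval : ∀ X, onVertex e (onVertex (hb.split F c hF.ancestor).right X)
      = onVertex F.right X := fun X => by rw [← onVertex_comp, he]
  refine homDeg_eq_one_iff.2 ⟨onVertex (hb.split F c hF.ancestor).right c,
    onVertex (hb.split F c hF.ancestor).right t, fun h => ?_, ?_, fun X Y hXY h => ?_⟩
  · exact hne (((hb.split_eq_iff hF).1 h).2.1 rfl)
  · rw [hval, hval, ht]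
  · obtain ⟨X, rfl⟩ := onVertex_surjective (hb.split F c hF.ancestor).right X
    obtain ⟨Y, rfl⟩ := onVertex_surjective (hb.split F c hF.ancestor).right Y
    rw [hval, hval] at h
    by_cases hX : X = c
    · by_cases hY : Y = c
      · rw [hX, hY] at hXY
        exact absurd rfl hXY
      · refine Or.inl ⟨by rw [hX], (hb.split_eq_iff hF).2 ⟨?_, by simp [hY, hne]⟩⟩
        rw [← h, hX, ht]
    · by_cases hY : Y = c
      · refine Or.inr ⟨(hb.split_eq_iff hF).2 ⟨?_, by simp [hX, hne]⟩, by rw [hY]⟩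
        rw [h, hY, ht]
      · exact absurd ((hb.split_eq_iff hF).2 ⟨h, by simp [hX, hY]⟩) hXY

lemma Pivot.split_not_merged (hb : Pivot f b) (hF : F.IsToggle b c) :
    ¬ (hb.split F c hF.ancestor).IsMerged c := by
  rintro ⟨t, hne, ht⟩
  exact hne (((hb.split_eq_iff hF).1 ht).2.2 rfl)

lemma Pivot.split_sameFibre (hb : Pivot f b) (hF : F.IsToggle b c) (ht : F.SameFibre c t) :
    (hb.split F c hF.ancestor).SameFibre c t := by
  refine ⟨(hb.split_eq_iff hF).2 ⟨ht.1, ⟨fun h => ?_, fun h => ?_⟩⟩, ht.2⟩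
  · exact absurd h (hb.par_ne hF.ancestor (level_eq ht.2))
  · exact absurd h (hb.par_ne hF.ancestor rfl)

lemma Pivot.split_val_lt (hb : Pivot f b) (hF : F.IsToggle b c) (ht : F.SameFibre c t)
    (hne : t ≠ c) (hle : val F.right t ≤ val F.right c) :
    val (hb.split F c hF.ancestor).right t < val (hb.split F c hF.ancestor).right c := by
  have h := hb.split_sameFibre hF ht
  by_contra hlt
  have := (hb.split_sorted F hF.ancestor c t (level_eq ht.2).symm h.1.symm).1 (le_of_not_gt hlt)
  have e := val_eq ht.2
  simp only [splitCoord, if_true, hne, if_false] at this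
  omega

/-- The splitting refines the fibres and moves only `c`, to the right. The vertices before `c` stay
leftmost, and those that kept `c` from being leftmost still lie to its left. -/
lemma Pivot.split_toggle (hb : Pivot f b) (hF : F.IsToggle b c) :
    (hb.split F c hF.ancestor).IsToggle b c := by
  refine ⟨hF.ancestor, fun h => ?_, fun d hd hlt t ht hne => ?_⟩
  · have h1 := hF.not_leftmost
    unfold Leftmost at h1
    push Not at h1
    obtain ⟨t, ht, hne, hle⟩ := h1
    have h2 := hb.split_val_lt hF ht hne hle
    have h3 := h t (hb.split_sameFibre hF ht) hne
    omega
  · have ht' := ht.of_refines (hb.split_refines hF)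
    have h1 := hF.leftmost d hd hlt t ht' hne
    have hdc : d ≠ c := fun e => by rw [e] at hlt; exact lt_irrefl _ hlt
    by_contra h2
    have h3 := (hb.split_sorted F hF.ancestor t d (level_eq ht.2) ht.1).1 (le_of_not_gt h2)
    have e := val_eq ht.2
    simp only [splitCoord, hdc, if_false] at h3
    omega

lemma Pivot.position_le_split (hb : Pivot f b) (hF : F.IsToggle b c) :
    F.position c ≤ (hb.split F c hF.ancestor).position c := by
  classical
  refine Finset.card_le_card fun t ht => ?_
  simp only [Finset.mem_filter, Finset.mem_univ, true_and] at ht ⊢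
  exact ⟨hb.split_sameFibre hF ht.1, ht.2.1, (hb.split_val_lt hF ht.1 ht.2.1 ht.2.2).le⟩

/-- The degrees agree, so one comparison suffices. It could fail only for a vertex to the right of
`c` in `F` that `G` identifies with `c`; but the only block that `F.Covers G` merges with `c` is
that of `t`, on the left. -/
lemma Pivot.split_eq_of_covers (hb : Pivot f b) (hm : ¬ F.IsMerged c) (hFG : F.Covers G)
    (hG : G.IsToggle b c) (hne : t ≠ c) (ht : onVertex G.right t = onVertex G.right c)
    (hlt : val F.right t < val F.right c) : hb.split G c hG.ancestor = F := by
  have hd := (hb.split_covers hG ⟨t, hne, ht⟩).homDeg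
  have hd' := hFG.homDeg
  have hr := hFG.refines
  have hsingle : ∀ X, onVertex F.right X = onVertex F.right c → X = c := fun X e => by
    by_contra h
    exact hm ⟨X, h, e⟩
  symm
  refine Factorization.ext_of_refines (fun X Y hl hp hle => ?_) (by omega)
  have hp' : onVertex (hb.split G c hG.ancestor).right (θ.par X)
      = onVertex (hb.split G c hG.ancestor).right (θ.par Y) :=
    (hb.split_eq_iff hG).2 ⟨hr.onVertex_eq hp,
      fun e => hsingle _ (by rw [← hp, e]), fun e => hsingle _ (by rw [hp, e])⟩
  refine (hb.split_sorted G hG.ancestor X Y hl hp').2 ?_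
  rcases (F.refines X Y hl hp hle).lt_or_eq with h | h
  · exact Or.inl h
  refine Or.inr ⟨h, ?_⟩
  have h1 := hr X Y hl hp hle
  unfold splitCoord
  by_cases hX : X = c
  · by_cases hY : Y = c
    · rw [hX, hY]
    · rw [if_pos hX, if_neg hY]
      suffices val G.right X ≠ val G.right Y by omega
      intro e
      obtain ⟨m, hm1, hme⟩ := hFG
      have hval : ∀ X, onVertex m (onVertex F.right X) = onVertex G.right X := fun X => by
        rw [← onVertex_comp, hme]
      have hmt : Merges m (onVertex F.right t) (onVertex F.right c) :=
        merges_of_homDeg hm1 (fun e => hne (hsingle t e)) (by rw [hval, hval, ht])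
      have hXY : onVertex F.right X ≠ onVertex F.right Y := fun e => hY (hsingle Y (by
        rw [← e, hX]))
      rcases hmt.2.2 _ _ hXY (by rw [hval, hval]; exact onVertex_eq_iff.2 ⟨hl, e⟩) with h | h
      · exact hY (hsingle _ h.2)
      · have := val_eq h.2
        rw [hX] at hle
        omega
  · rw [if_neg hX]
    omega

/-- Coarsening keeps `c` from being leftmost, so the toggle cannot move to a later vertex. If it is
still `c`, then `c` has been merged either with a block on its left, and `F` is the partner of `G`,
or with one on its right, which raises the position of `c`. -/
lemma Pivot.cover_cases (hb : Pivot f b) (hF : F.IsToggle b c) (hm : ¬ F.IsMerged c)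
    (hFG : F.Covers G) (hG : G.IsToggle b d) (hm' : G.IsMerged d) :
    hb.split G d hG.ancestor = F ∨ number d < number c ∨
      d = c ∧ F.position c < G.position c := by
  classical
  have hr := hFG.refines
  have hnl : ¬ G.Leftmost c := fun h => by
    have h1 := hF.not_leftmost
    unfold Leftmost at h1
    push Not at h1
    obtain ⟨t, ht, hne, hle⟩ := h1
    have h2 := h t (ht.of_refines hr) hne
    have h3 := hr t c (level_eq ht.2) ht.1 hle
    omega
  rcases lt_trichotomy (number d) (number c) with hlt | e | hlt
  · exact Or.inr (Or.inl hlt)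
  · obtain rfl := number_injective e
    obtain ⟨t, hne, ht⟩ := hm'
    have hne' : onVertex F.right t ≠ onVertex F.right d := fun e => hm ⟨t, hne, e⟩
    rcases lt_trichotomy (val F.right t) (val F.right d) with h | h | h
    · exact Or.inl (hb.split_eq_of_covers hm hFG hG hne ht h)
    · exact absurd (onVertex_eq_iff.2 ⟨level_eq ht, h⟩) hne'
    · refine Or.inr (Or.inr ⟨rfl, Finset.card_lt_card ?_⟩)
      rw [Finset.ssubset_iff_of_subset]
      · refine ⟨t, ?_, ?_⟩
        · simp only [Finset.mem_filter, Finset.mem_univ, true_and]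
          exact ⟨⟨onVertex_par_congr ht, G.onVertex_eq ht⟩, hne, (val_eq ht).le⟩
        · simp only [Finset.mem_filter, Finset.mem_univ, true_and]
          rintro ⟨-, -, hle⟩
          omega
      · intro X hX
        simp only [Finset.mem_filter, Finset.mem_univ, true_and] at hX ⊢
        exact ⟨hX.1.of_refines hr, hX.2.1, hr X d (level_eq hX.1.2) hX.1.1 hX.2.2⟩
  · exact absurd (hG.leftmost c hF.ancestor hlt) hnl

/-- In both cases the block that was merged with `c` is the last one to the left of `c` in the
common splitting, so it is the same block. The orders of `F` and `G` then agree. -/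
lemma Pivot.split_injective (hb : Pivot f b) (hF : F.IsToggle b c) (hG : G.IsToggle b d)
    (hm : F.IsMerged c) (hm' : G.IsMerged d)
    (h : hb.split F c hF.ancestor = hb.split G d hG.ancestor) : F = G := by
  have hdF := (hb.split_covers hF hm).homDeg
  have hdG := (hb.split_covers hG hm').homDeg
  have hd : homDeg F.right = homDeg G.right := by rw [hdF, hdG, h]
  have ht := hb.split_toggle hG
  rw [← h] at ht
  obtain rfl : c = d := (hb.split_toggle hF).unique ht
  have rF := hb.split_refines hF
  have rG := hb.split_refines hG
  have iF := fun X Y => hb.split_eq_iff hF (X := X) (Y := Y)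
  have iG := fun X Y => hb.split_eq_iff hG (X := X) (Y := Y)
  have vF := fun t => hb.split_val_lt hF (t := t)
  have vG := fun t => hb.split_val_lt hG (t := t)
  have sF := fun t => hb.split_sameFibre hF (t := t)
  have sG := fun t => hb.split_sameFibre hG (t := t)
  rw [← h] at rG iG vG sG
  set F' := hb.split F c hF.ancestor
  obtain ⟨t, hne, htF⟩ := hm
  obtain ⟨t', hne', htG⟩ := hm'
  have ft : F.SameFibre c t := ⟨onVertex_par_congr htF, F.onVertex_eq htF⟩
  have ft' : G.SameFibre c t' := ⟨onVertex_par_congr htG, G.onVertex_eq htG⟩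
  have hlt := vF t ft hne (val_eq htF).le
  have hlt' := vG t' ft' hne' (val_eq htG).le
  have hl : t.1 = t'.1 := (level_eq htF).trans (level_eq htG).symm
  have hpp : onVertex F'.right (θ.par t) = onVertex F'.right (θ.par t') :=
    (sF t ft).1.trans (sG t' ft').1.symm
  -- If the blocks were different, the one nearer to `c` would be squeezed between the other one and
  -- `c`, and it would be merged with them too.
  have htt : onVertex F'.right t = onVertex F'.right t' := by
    rcases lt_trichotomy (val F'.right t) (val F'.right t') with hh | hh | hh
    · have h1 := rF t t' hl hpp hh.le
      have h2 := rF t' c (level_eq htG) (sG t' ft').1 hlt'.le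
      have h3 := val_eq htF
      exact (iF t t').2 ⟨onVertex_eq_iff.2 ⟨hl, by omega⟩, by simp [hne, hne']⟩
    · exact onVertex_eq_iff.2 ⟨hl, hh⟩
    · have h1 := rG t' t hl.symm hpp.symm hh.le
      have h2 := rG t c (level_eq htF) (sF t ft).1 hlt.le
      have h3 := val_eq htG
      exact (iG t t').2 ⟨onVertex_eq_iff.2 ⟨hl, by omega⟩, by simp [hne, hne']⟩
  have hGt : onVertex G.right t = onVertex G.right c := (rG.onVertex_eq htt).trans htG
  have key : ∀ X Y, onVertex F.right X = onVertex F.right Y →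
      onVertex G.right X = onVertex G.right Y := by
    have aux : ∀ Y, Y ≠ c → onVertex F.right Y = onVertex F.right c →
        onVertex G.right Y = onVertex G.right c := fun Y hY e => by
      rw [← hGt]
      exact rG.onVertex_eq ((iF Y t).2 ⟨by rw [e, htF], by simp [hY, hne]⟩)
    intro X Y e
    by_cases hX : X = c
    · by_cases hY : Y = c
      · rw [hX, hY]
      · rw [hX, aux Y hY (by rw [← e, hX])]
    · by_cases hY : Y = c
      · rw [hY, aux X hX (by rw [e, hY])]
      · exact rG.onVertex_eq ((iF X Y).2 ⟨e, by simp [hX, hY]⟩)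
  refine Factorization.ext_of_refines (fun X Y hl hp hle => ?_) hd
  by_contra hgt
  have hgt := lt_of_not_ge hgt
  by_cases hcp : θ.par X = c ↔ θ.par Y = c
  · have hp' := (iF _ _).2 ⟨hp, hcp⟩
    rcases le_total (val F'.right X) (val F'.right Y) with h1 | h1
    · have := rG X Y hl hp' h1
      omega
    · have h2 := rF Y X hl.symm hp'.symm h1
      have h3 := val_eq (key X Y (onVertex_eq_iff.2 ⟨hl, le_antisymm hle h2⟩))
      omega
  -- Exactly one of the parents is `c`. The children of `c` are leftmost in both factorizations, so
  -- the orders cannot differ here.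
  · have e : onVertex f X = onVertex f Y := onVertex_eq_iff.2 ⟨hl, le_antisymm
      (F.refines X Y hl hp hle) (G.refines Y X hl.symm (key _ _ hp).symm hgt.le)⟩
    have hXY : X ≠ Y := fun e => hcp (by rw [e])
    by_cases hX : θ.par X = c
    · have := hb.leftmost_child hG hX Y ⟨(key _ _ hp).symm, e.symm⟩ hXY.symm
      omega
    · have hY : θ.par Y = c := by
        by_contra hY
        exact hcp (by simp [hX, hY])
      have := hb.leftmost_child hF hY X ⟨hp, e⟩ hXY
      omega

/-- As `c` is not leftmost and stands alone, there is a nearest block to its left, and `c` is merged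
with it. The children of `c` become the leftmost children of the merged vertex, so that splitting
again recovers `F`. -/
lemma Pivot.exists_merge (hb : Pivot f b) (hF : F.IsToggle b c) (hm : ¬ F.IsMerged c) :
    ∃ (G : Factorization f) (hG : G.IsToggle b c), G.IsMerged c ∧ F.Covers G ∧
      hb.split G c hG.ancestor = F := by
  classical
  have hc := hF.ancestor
  have hsingle : ∀ X, onVertex F.right X = onVertex F.right c → X = c := fun X e => by
    by_contra h
    exact hm ⟨X, h, e⟩
  let A : Finset θ.Vertex := Finset.univ.filter fun t =>
    F.SameFibre c t ∧ t ≠ c ∧ val F.right t ≤ val F.right c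
  have hA : A.Nonempty := by
    have h1 := hF.not_leftmost
    unfold Leftmost at h1
    push Not at h1
    obtain ⟨t, ht, hne, hle⟩ := h1
    exact ⟨t, Finset.mem_filter.2 ⟨Finset.mem_univ _, ht, hne, hle⟩⟩
  obtain ⟨t, htA, hmax⟩ := Finset.exists_max_image A (fun t => val F.right t) hA
  obtain ⟨-, ht, hne, hle⟩ := Finset.mem_filter.1 htA
  have hmax' : ∀ X, F.SameFibre c X → X ≠ c → val F.right X ≤ val F.right c →
      val F.right X ≤ val F.right t := fun X h1 h2 h3 =>
    hmax X (Finset.mem_filter.2 ⟨Finset.mem_univ _, h1, h2, h3⟩)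
  have hlc : t.1 = c.1 := level_eq ht.2
  have hlt : val F.right t < val F.right c := lt_of_le_of_ne hle fun e =>
    hne (hsingle t (onVertex_eq_iff.2 ⟨hlc, e⟩))
  -- The substitution of `t` for `c` describes the blocks after the merge: `G` identifies two
  -- vertices exactly if `F` identifies their images under `m` (`key1`, `key2`).
  let m : θ.Vertex → θ.Vertex := fun X => if X = c then t else X
  have mc : m c = t := if_pos rfl
  have mne : ∀ {X}, X ≠ c → m X = X := fun h => if_neg h
  have mlev : ∀ X, (m X).1 = X.1 := fun X => by
    by_cases h : X = c
    · rw [h, mc, hlc]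
    · rw [mne h]
  have mpar : ∀ X, onVertex F.right (θ.par (m X)) = onVertex F.right (θ.par X) := fun X => by
    by_cases h : X = c
    · rw [h, mc, ht.1]
    · rw [mne h]
  have mf : ∀ X, onVertex f (m X) = onVertex f X := fun X => by
    by_cases h : X = c
    · rw [h, mc, ht.2]
    · rw [mne h]
  -- The value 0 is reserved for the children of `c`, which forces the shift by one for all other
  -- vertices.
  let δ : θ.Vertex → ℕ := fun X => if θ.par X = c then 0 else val F.right (m X) + 1
  have δ0 : ∀ {X}, θ.par X = c → δ X = 0 := fun h => if_pos h
  have δ1 : ∀ {X}, θ.par X ≠ c → δ X = val F.right (m X) + 1 := fun h => if_neg h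
  have mono : ∀ X Y, onVertex f X = onVertex f Y →
      onVertex F.right (θ.par X) = onVertex F.right (θ.par Y) →
      val F.right X ≤ val F.right Y → δ X ≤ δ Y := by
    intro X Y e hp hXY
    by_cases hX : θ.par X = c
    · rw [δ0 hX]; exact Nat.zero_le _
    · have hY : θ.par Y ≠ c := fun h => hX (hsingle _ (by rw [hp, h]))
      rw [δ1 hX, δ1 hY]
      by_cases hXc : X = c
      · by_cases hYc : Y = c
        · rw [hXc, hYc]
        · rw [hXc, mc, mne hYc]
          rw [hXc] at hXY
          omega
      · by_cases hYc : Y = c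
        · rw [hYc, mc, mne hXc]
          rw [hYc] at hXY hp e
          have := hmax' X ⟨hp, e⟩ hXc hXY
          omega
        · rw [mne hXc, mne hYc]
          omega
  obtain ⟨G, hG⟩ := exists_isSortedBy f δ fun X Y e hp h =>
    mono X Y e (by rw [hp]) (val_mono F.right (level_eq e) hp h)
  have key1 : ∀ X Y, onVertex G.right X = onVertex G.right Y →
      onVertex F.right (m X) = onVertex F.right (m Y) := by
    intro X Y h
    obtain ⟨-, e, hδ⟩ := hG.onVertex_eq_iff.1 h
    by_cases hX : θ.par X = c
    · by_cases hY : θ.par Y = c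
      · rw [hb.child_unique hc hX hY e]
      · rw [δ0 hX, δ1 hY] at hδ
        omega
    · by_cases hY : θ.par Y = c
      · rw [δ1 hX, δ0 hY] at hδ
        omega
      · rw [δ1 hX, δ1 hY] at hδ
        exact onVertex_eq_iff.2 ⟨by rw [mlev, mlev, level_eq e], by omega⟩
  have mcongr : ∀ X Y, onVertex F.right X = onVertex F.right Y →
      onVertex F.right (m X) = onVertex F.right (m Y) := by
    intro X Y e
    by_cases hX : X = c
    · rw [hsingle Y (by rw [← e, hX]), hX]
    · have hY : Y ≠ c := fun h => hX (hsingle X (by rw [e, h]))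
      rw [mne hX, mne hY, e]
  have key2 : ∀ X Y, onVertex F.right (m X) = onVertex F.right (m Y) →
      onVertex G.right X = onVertex G.right Y := by
    intro X Y h
    refine pair_induction (P := fun X Y => onVertex F.right (m X) = onVertex F.right (m Y) →
      onVertex G.right X = onVertex G.right Y) (fun X Y hX hY _ => by rw [root_unique hX hY])
      (fun X Y hl _ ih h => ?_) X Y (by rw [← mlev, level_eq h, mlev]) h
    have hp : onVertex F.right (θ.par X) = onVertex F.right (θ.par Y) := by
      rw [← mpar X, ← mpar Y, onVertex_par_congr h]
    have e : onVertex f X = onVertex f Y := by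
      rw [← mf X, ← mf Y, F.onVertex_eq h]
    refine hG.onVertex_eq_iff.2 ⟨ih (mcongr _ _ hp), e, ?_⟩
    by_cases hX : θ.par X = c
    · rw [δ0 hX, δ0 (hsingle _ (by rw [← hp, hX]))]
    · have hY : θ.par Y ≠ c := fun h => hX (hsingle _ (by rw [hp, h]))
      rw [δ1 hX, δ1 hY, val_eq h]
  have href : Refines F.right G.right := by
    intro X Y hl hp hXY
    refine (hG X Y hl (key2 _ _ (mcongr _ _ hp))).2 ?_
    rcases (F.refines X Y hl hp hXY).lt_or_eq with h | h
    · exact Or.inl h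
    · exact Or.inr ⟨h, mono X Y (onVertex_eq_iff.2 ⟨hl, h⟩) hp hXY⟩
  have hGt : onVertex G.right t = onVertex G.right c := key2 _ _ (by rw [mc, mne hne])
  have hcov : F.Covers G := by
    obtain ⟨e, he⟩ := href.exists_fac
    have hval : ∀ X, onVertex e (onVertex F.right X) = onVertex G.right X := fun X => by
      rw [← onVertex_comp, he]
    refine ⟨e, homDeg_eq_one_iff.2 ⟨onVertex F.right t, onVertex F.right c,
      fun h => hne (hsingle t h), by rw [hval, hval, hGt], fun X Y hXY h => ?_⟩, he⟩
    obtain ⟨X, rfl⟩ := onVertex_surjective F.right X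
    obtain ⟨Y, rfl⟩ := onVertex_surjective F.right Y
    rw [hval, hval] at h
    have h' := key1 X Y h
    by_cases hX : X = c
    · by_cases hY : Y = c
      · rw [hX, hY] at hXY
        exact absurd rfl hXY
      · rw [hX, mc, mne hY] at h'
        exact Or.inr ⟨by rw [hX], h'.symm⟩
    · by_cases hY : Y = c
      · rw [hY, mc, mne hX] at h'
        exact Or.inl ⟨h', by rw [hY]⟩
      · rw [mne hX, mne hY] at h'
        exact absurd h' hXY
  -- `G` ties `t` with `c`, so `c` is not leftmost. An earlier vertex `d` stays leftmost: no other
  -- vertex above `b` lies in its fibre, and the remaining ones are ordered as in `F`.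
  have htog : G.IsToggle b c := by
    refine ⟨hc, fun h => ?_, fun d hd hlt s hs hsd => ?_⟩
    · have := h t ⟨onVertex_par_congr hGt, ht.2⟩ hne
      have := val_eq hGt
      omega
    · by_contra hge
      have e := val_eq hs.2
      have hδ := (hG s d (level_eq hs.2) hs.1).1 (le_of_not_gt hge)
      have hδ : δ s ≤ δ d := by omega
      have hdc : d ≠ c := fun e => by rw [e] at hlt; exact lt_irrefl _ hlt
      have hsc : s ≠ c := fun e => hdc (hb.injective hd hc (by rw [← hs.2, e]))
      by_cases hpd : θ.par d = c
      · by_cases hps : θ.par s = c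
        · exact hsd (hb.child_unique hc hps hpd hs.2)
        · rw [δ0 hpd, δ1 hps] at hδ
          omega
      · by_cases hps : θ.par s = c
        · exact hsd (hb.injective (Pivot.ancestor_child hc hps) hd hs.2)
        · rw [δ1 hpd, δ1 hps, mne hdc, mne hsc] at hδ
          have hp := key1 _ _ hs.1
          rw [mne hpd, mne hps] at hp
          have := hF.leftmost d hd hlt s ⟨hp, hs.2⟩ hsd
          omega
  exact ⟨G, htog, ⟨t, hne, hGt⟩, hcov, hb.split_eq_of_covers hm hcov htog hne hGt hlt⟩

end Pivot

end PrunedTree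

/-! ### The matching for the chosen pivots, and its acyclicity -/

namespace PrunedTree.Factorization

variable {n : ℕ} {σ θ : PrunedTree n} {f : θ ⟶ σ} {F G : Factorization f}

/-- A chosen pivot of a morphism of positive degree. -/
noncomputable def pivot (hf : homDeg f ≠ 0) : θ.Vertex := (exists_pivot hf).choose

lemma pivot_spec (hf : homDeg f ≠ 0) : Pivot f (pivot hf) := (exists_pivot hf).choose_spec

/-- The toggle of a factorization with respect to the chosen pivot. -/
noncomputable def toggle (F : Factorization f) (hf : homDeg f ≠ 0) : θ.Vertex :=
  ((pivot_spec hf).exists_toggle F).choose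

lemma toggle_spec (F : Factorization f) (hf : homDeg f ≠ 0) :
    F.IsToggle (pivot hf) (F.toggle hf) :=
  ((pivot_spec hf).exists_toggle F).choose_spec

/-- A factorization is lower if it merges its toggle with another vertex. -/
def IsLower (F : Factorization f) : Prop := ∃ hf : homDeg f ≠ 0, F.IsMerged (F.toggle hf)

/-- The partner of a lower factorization in the matching. -/
noncomputable def upper (F : Factorization f) (hF : F.IsLower) : Factorization f :=
  (pivot_spec hF.1).split F (F.toggle hF.1) (F.toggle_spec hF.1).ancestor

lemma toggle_upper (hF : F.IsLower) : (F.upper hF).toggle hF.1 = F.toggle hF.1 :=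
  ((F.upper hF).toggle_spec hF.1).unique ((pivot_spec hF.1).split_toggle (F.toggle_spec hF.1))

lemma upper_covers (hF : F.IsLower) : (F.upper hF).Covers F :=
  (pivot_spec hF.1).split_covers (F.toggle_spec hF.1) hF.2

lemma upper_not_isLower (hF : F.IsLower) : ¬ (F.upper hF).IsLower := by
  rintro ⟨hf, h⟩
  rw [toggle_upper] at h
  exact (pivot_spec hF.1).split_not_merged (F.toggle_spec hF.1) h

lemma upper_injective (hF : F.IsLower) (hG : G.IsLower) (h : F.upper hF = G.upper hG) : F = G :=
  (pivot_spec hF.1).split_injective (F.toggle_spec hF.1) (G.toggle_spec hF.1) hF.2 hG.2 h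

/-- Every factorization of a morphism of positive degree that is not lower is the partner of a lower
one. The matching thus leaves only factorizations of morphisms of degree zero unmatched. -/
lemma exists_upper_eq (hf : homDeg f ≠ 0) (hF : ¬ F.IsLower) :
    ∃ (G : Factorization f) (hG : G.IsLower), F.Covers G ∧ G.upper hG = F := by
  obtain ⟨G, hG, hm, hc, h⟩ := (pivot_spec hf).exists_merge (F.toggle_spec hf)
    fun h => hF ⟨hf, h⟩
  have e : G.toggle hf = F.toggle hf := (G.toggle_spec hf).unique hG
  refine ⟨G, ⟨hf, e ▸ hm⟩, hc, ?_⟩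
  unfold upper
  simp only [e]
  exact h

lemma position_lt (F : Factorization f) (c : θ.Vertex) :
    F.position c < Fintype.card θ.Vertex + 1 :=
  Nat.lt_succ_of_le (Finset.card_le_univ _)

/-- The rank along which the matching decreases. -/
noncomputable def rank (F : Factorization f) (hf : homDeg f ≠ 0) : ℕ :=
  number (F.toggle hf) * (Fintype.card θ.Vertex + 1) +
    (Fintype.card θ.Vertex - F.position (F.toggle hf))

lemma rank_upper_le (hF : F.IsLower) : (F.upper hF).rank hF.1 ≤ F.rank hF.1 := by
  have h := (pivot_spec hF.1).position_le_split (F.toggle_spec hF.1)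
  unfold rank
  rw [toggle_upper]
  change F.position (F.toggle hF.1) ≤ (F.upper hF).position (F.toggle hF.1) at h
  omega

/-- This is the acyclicity of the matching. By `Pivot.cover_cases`, either the number of the toggle
drops, which outweighs everything else in the rank, or the toggle stays and its position, which
enters negatively, grows. -/
lemma Covers.rank_lt (hf : PrunedTree.homDeg f ≠ 0) (hF : ¬ F.IsLower) (h : F.Covers G) (hG : G.IsLower)
    (hne : G.upper hG ≠ F) : G.rank hf < F.rank hf := by
  rcases (pivot_spec hf).cover_cases (F.toggle_spec hf) (fun h => hF ⟨hf, h⟩) h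
    (G.toggle_spec hf) hG.2 with h' | h' | ⟨h1, h2⟩
  · exact absurd h' hne
  · have := Nat.mul_le_mul_right (Fintype.card θ.Vertex + 1) (Nat.succ_le_of_lt h')
    rw [Nat.succ_mul] at this
    unfold rank
    omega
  · unfold rank
    rw [h1]
    have := G.position_lt (F.toggle hf)
    rw [h1] at *
    omega

/-- The factorization obtained by moving a factor of the left morphism to the right one. -/
def push (F : Factorization f) (R : Factorization F.left) : Factorization f where
  mid := R.mid
  right := F.right ≫ R.right
  left := R.left
  fac := by rw [Category.assoc, R.fac, F.fac]

/-- The factorization that remains when a factor of the left morphism is dropped. -/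
def drop (F : Factorization f) (L : Factorization F.left) : Factorization (F.right ≫ L.right) where
  mid := F.mid
  right := F.right
  left := L.right
  fac := rfl

lemma push_injective (F : Factorization f) : Function.Injective F.push := by
  rintro ⟨m, r, l, h⟩ ⟨m', r', l', h'⟩ e
  simp only [push, mk.injEq] at e
  obtain ⟨rfl, e1, e2⟩ := e
  obtain rfl := eq_of_heq e2
  obtain rfl := (cancel_epi F.right).1 (eq_of_heq e1)
  rfl

/-- The covered factorizations are those that occur in the last sum of the differential. -/
lemma Covers.exists_push (h : F.Covers G) :
    ∃ R : RightFactorization F.left, F.push R.1 = G := by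
  obtain ⟨e, h1, he⟩ := h
  refine ⟨⟨⟨G.mid, e, G.left, ?_⟩, h1⟩, ?_⟩
  · rw [← cancel_epi F.right, ← Category.assoc, he, G.fac, F.fac]
  · obtain ⟨m, r, l, hG⟩ := G
    dsimp only at e he
    subst he
    rfl

lemma covers_push (F : Factorization f) (R : RightFactorization F.left) :
    F.Covers (F.push R.1) :=
  ⟨R.1.right, R.2, rfl⟩

end PrunedTree.Factorization

/-! ### The bar-type resolution of a diagram -/

section Resolution

open PrunedTree

variable {k : Type u} [CommRing k] {n : ℕ}

variable (k) in
/-- The diagram `τ ↦ k[Hom(θ, τ)]`, concentrated in degree zero. -/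
noncomputable def freeAt (θ : PrunedTree n) : CovDiagram k n where
  obj τ :=
    -- The index type is empty for `q ≠ 0`, which concentrates the complex in degree zero.
    { X := fun q => ModuleCat.of k ({_w : θ ⟶ τ // q = 0} →₀ k)
      d := fun _ _ => 0 }
  map v := { f := fun _ => ModuleCat.ofHom (Finsupp.lmapDomain k k fun w => ⟨w.1 ≫ v, w.2⟩) }
  map_id τ := by
    ext q : 2
    refine Finsupp.lhom_ext' fun w => LinearMap.ext_ring ?_
    change Finsupp.mapDomain _ (Finsupp.single w 1) = Finsupp.single w 1
    rw [Finsupp.mapDomain_single]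
    simp
  map_comp v v' := by
    ext q : 2
    refine Finsupp.lhom_ext' fun w => LinearMap.ext_ring ?_
    change Finsupp.mapDomain _ (Finsupp.single w 1) =
      Finsupp.mapDomain _ (Finsupp.mapDomain _ (Finsupp.single w 1))
    simp only [Finsupp.mapDomain_single, Category.assoc]

/-- The generator `[w]` of `k[Hom(θ, τ)]`. -/
noncomputable def freeGen {θ τ : PrunedTree n} (w : θ ⟶ τ) : ((freeAt k θ).obj τ).X 0 :=
  (Finsupp.single ⟨w, rfl⟩ 1 : {_w : θ ⟶ τ // (0 : ℤ) = 0} →₀ k)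

lemma freeAt_map_freeGen {θ τ σ : PrunedTree n} (w : θ ⟶ τ) (v : τ ⟶ σ) :
    ((freeAt k θ).map v).f 0 (freeGen w) = freeGen (w ≫ v) :=
  Finsupp.mapDomain_single

/-- The map `[w] ↦ [a ≫ w]`. -/
noncomputable def freeMap {θ θ' : PrunedTree n} (a : θ' ⟶ θ) : freeAt k θ ⟶ freeAt k θ' where
  app τ :=
    { f := fun _ => ModuleCat.ofHom (Finsupp.lmapDomain k k fun w => ⟨a ≫ w.1, w.2⟩)
      comm' := fun i j _ => by
        exact Limits.comp_zero.trans Limits.zero_comp.symm }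
  naturality τ σ v := by
    ext q : 2
    refine Finsupp.lhom_ext' fun w => LinearMap.ext_ring ?_
    change Finsupp.mapDomain _ (Finsupp.mapDomain _ (Finsupp.single w 1)) =
      Finsupp.mapDomain _ (Finsupp.mapDomain _ (Finsupp.single w 1))
    simp only [Finsupp.mapDomain_single, Category.assoc]

lemma freeMap_freeGen {θ θ' τ : PrunedTree n} (a : θ' ⟶ θ) (w : θ ⟶ τ) :
    ((freeMap (k := k) a).app τ).f 0 (freeGen w) = freeGen (a ≫ w) :=
  Finsupp.mapDomain_single

variable (S : ContraDiagram k n) {θ σ : PrunedTree n}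

/-- The element `x ⊗ {v} ⊗ [w]` that belongs to a factorization `f = v w`. -/
noncomputable def gen {i : ℤ} {f : θ ⟶ σ} (F : Factorization f) (p : ℤ)
    (h : p + homDeg F.left = i) : (S.obj (op σ)).X p →ₗ[k] KoszulX S (freeAt k θ) i :=
  koszulIncl S (freeAt k θ) F.left p 0 (by rw [add_zero, h]) ∘ₗ
    (TensorProduct.mk k _ _).flip (freeGen F.right)

lemma gen_apply {i : ℤ} {f : θ ⟶ σ} (F : Factorization f) (p : ℤ) (h : p + homDeg F.left = i)
    (x : (S.obj (op σ)).X p) : gen S F p h x =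
      koszulIncl S (freeAt k θ) F.left p 0 (by rw [add_zero, h]) (x ⊗ₜ freeGen F.right) := rfl

variable {S} in
/-- The linear map with given values on the elements `gen`. -/
noncomputable def desc {i : ℤ} {M : Type*} [AddCommGroup M] [Module k M]
    (H : ∀ {σ : PrunedTree n} {f : θ ⟶ σ} (F : Factorization f) (p : ℤ),
      p + homDeg F.left = i → (S.obj (op σ)).X p →ₗ[k] M) : KoszulX S (freeAt k θ) i →ₗ[k] M :=
  DirectSum.toModule k (KoszulIndex n i) M fun a => TensorProduct.lift (LinearMap.flip
    (Finsupp.linearCombination k fun w : {_w : θ ⟶ a.src // a.q = 0} =>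
      H ⟨a.src, w.1, a.u, rfl⟩ a.p (by have := a.deg_eq; have := w.2; dsimp only; omega)))

variable {S} in
lemma desc_gen {i : ℤ} {M : Type*} [AddCommGroup M] [Module k M]
    (H : ∀ {σ : PrunedTree n} {f : θ ⟶ σ} (F : Factorization f) (p : ℤ),
      p + homDeg F.left = i → (S.obj (op σ)).X p →ₗ[k] M)
    {f : θ ⟶ σ} (F : Factorization f) (p : ℤ) (h : p + homDeg F.left = i)
    (x : (S.obj (op σ)).X p) : desc H (gen S F p h x) = H F p h x := by
  obtain ⟨τ, w, u, rfl⟩ := F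
  rw [gen_apply, desc, koszulIncl, DirectSum.toModule_lof]
  change (Finsupp.linearCombination k (fun w : {_w : θ ⟶ τ // (0 : ℤ) = 0} =>
    H ⟨τ, w.1, u, rfl⟩ p h) (Finsupp.single ⟨w, rfl⟩ 1)) x = _
  rw [Finsupp.linearCombination_single, one_smul]

/-- A factorization with arbitrary composite is a pair of `v` and `w`, and the `[w]` form a basis of
the coefficients. -/
lemma span_gen {i : ℤ} (A : Submodule k (KoszulX S (freeAt k θ) i))
    (h : ∀ {σ : PrunedTree n} {f : θ ⟶ σ} (F : Factorization f) (p : ℤ)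
      (h : p + homDeg F.left = i) (x : (S.obj (op σ)).X p), gen S F p h x ∈ A) : A = ⊤ := by
  rw [← Submodule.ker_mkQ A, LinearMap.ker_eq_top]
  refine DirectSum.linearMap_ext _ fun a => TensorProduct.ext' fun x y => ?_
  obtain ⟨τ, σ, u, p, q, e⟩ := a
  have : (A.mkQ ∘ₗ koszulIncl S (freeAt k θ) u p q e) ∘ₗ TensorProduct.mk k _ _ x = 0 := by
    refine Finsupp.lhom_ext' fun w => LinearMap.ext_ring ?_
    obtain ⟨w, rfl⟩ := w
    exact (Submodule.Quotient.mk_eq_zero _).2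
      (h (⟨τ, w, u, rfl⟩ : Factorization (w ≫ u)) p (by dsimp only; omega) x)
  exact LinearMap.congr_fun this y

variable {S} in
lemma koszulX_ext {i : ℤ} {M : Type*} [AddCommGroup M] [Module k M]
    {g g' : KoszulX S (freeAt k θ) i →ₗ[k] M}
    (h : ∀ {σ : PrunedTree n} {f : θ ⟶ σ} (F : Factorization f) (p : ℤ)
      (h : p + homDeg F.left = i) (x : (S.obj (op σ)).X p),
      g (gen S F p h x) = g' (gen S F p h x)) : g = g' := by
  rw [← LinearMap.eqLocus_eq_top]
  exact span_gen S _ h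

/-- The coefficients have no internal differential. The first sum passes to morphisms of smaller
degree, whereas the second one stays with the same `f`; this filtration makes the matching
effective. -/
lemma koszulD_gen {i j : ℤ} (hij : j + 1 = i) {f : θ ⟶ σ} (F : Factorization f) (p : ℤ)
    (h : p + homDeg F.left = i) (x : (S.obj (op σ)).X p) :
    koszulD S (freeAt k θ) hij (gen S F p h x) =
      gen S F (p - 1) (by omega) ((S.obj (op σ)).d p (p - 1) x)
      + ∑ L : LeftFactorization F.left, (p.negOnePow * sgn L.1.left) •
          gen S (F.drop L.1) p
            (by have := L.1.homDeg_eq; have := L.2; dsimp only [Factorization.drop]; omega)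
            ((S.map L.1.left.op).f p x)
      + ∑ R : RightFactorization F.left,
          ((p + homDeg R.1.left).negOnePow * sgn R.1.right) •
          gen S (F.push R.1) p
            (by have := R.1.homDeg_eq; have := R.2; dsimp only [Factorization.push]; omega) x := by
  simp only [gen_apply]
  rw [koszulD_incl]
  simp only [freeAt_map_freeGen]
  rw [show ((freeAt k θ).obj F.mid).d 0 (0 - 1) (freeGen F.right) = 0 from rfl,
    TensorProduct.tmul_zero, map_zero, smul_zero, add_zero]
  rfl

end Resolution

/-! ### Reduction of the resolution along the matching -/

section Reduction

open PrunedTree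

variable {k : Type u} [CommRing k] {n : ℕ} (S : ContraDiagram k n) {θ σ : PrunedTree n}

lemma gen_congr {i : ℤ} {f : θ ⟶ σ} {F G : Factorization f} (e : F = G) (p : ℤ)
    (h : p + homDeg F.left = i) (x : (S.obj (op σ)).X p) :
    gen S F p h x = gen S G p (e ▸ h) x := by
  subst e
  rfl

lemma units_smul_mem {M : Type*} [AddCommGroup M] [Module k M] (A : Submodule k M) (ε : ℤˣ)
    {z : M} (hz : z ∈ A) : ε • z ∈ A := by
  rw [Units.smul_def]
  exact zsmul_mem hz _

/-- The last factor of a factorization of the partner of a lower factorization. -/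
noncomputable def upperPush {f : θ ⟶ σ} {F : Factorization f} (hF : F.IsLower) :
    RightFactorization (F.upper hF).left :=
  (Factorization.upper_covers hF).exists_push.choose

lemma push_upperPush {f : θ ⟶ σ} {F : Factorization f} (hF : F.IsLower) :
    (F.upper hF).push (upperPush hF).1 = F :=
  (Factorization.upper_covers hF).exists_push.choose_spec

lemma homDeg_upper {f : θ ⟶ σ} {F : Factorization f} (hF : F.IsLower) :
    homDeg (F.upper hF).left = homDeg F.left + 1 := by
  have h1 := (Factorization.upper_covers hF).homDeg
  have h2 := F.homDeg_eq
  have h3 := (F.upper hF).homDeg_eq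
  omega

/-- The coefficient of a lower factorization in the differential of its partner. -/
noncomputable def upperSign {f : θ ⟶ σ} {F : Factorization f} (hF : F.IsLower) (p : ℤ) : ℤˣ :=
  (p + homDeg (upperPush hF).1.left).negOnePow * sgn (upperPush hF).1.right

lemma upperSign_sub_one {f : θ ⟶ σ} {F : Factorization f} (hF : F.IsLower) (p : ℤ) :
    upperSign hF (p - 1) = -upperSign hF p := by
  unfold upperSign
  rw [show p - 1 + homDeg (upperPush hF).1.left = p + homDeg (upperPush hF).1.left - 1 by ring,
    Int.negOnePow_sub, Int.negOnePow_one, mul_neg_one, neg_mul]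

open Classical in
/-- The degree one operator that replaces a lower factorization by its partner. -/
noncomputable def contraction {i j : ℤ} (hij : j + 1 = i) :
    KoszulX S (freeAt k θ) j →ₗ[k] KoszulX S (freeAt k θ) i :=
  desc fun F p h => if hF : F.IsLower then
    upperSign hF p • gen S (F.upper hF) p (by rw [homDeg_upper]; omega) else 0

lemma contraction_lower {i j : ℤ} (hij : j + 1 = i) {f : θ ⟶ σ} {F : Factorization f}
    (hF : F.IsLower) (p : ℤ) (h : p + homDeg F.left = j) (x : (S.obj (op σ)).X p) :
    contraction S hij (gen S F p h x) =
      upperSign hF p • gen S (F.upper hF) p (by rw [homDeg_upper]; omega) x := by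
  rw [contraction, desc_gen, dif_pos hF]
  rfl

lemma contraction_not_lower {i j : ℤ} (hij : j + 1 = i) {f : θ ⟶ σ} {F : Factorization f}
    (hF : ¬ F.IsLower) (p : ℤ) (h : p + homDeg F.left = j) (x : (S.obj (op σ)).X p) :
    contraction S hij (gen S F p h x) = 0 := by
  rw [contraction, desc_gen, dif_neg hF]
  rfl

lemma contraction_mem {i j : ℤ} (hij : j + 1 = i) {f : θ ⟶ σ} {F : Factorization f} (p : ℤ)
    (h : p + homDeg F.left = j) (x : (S.obj (op σ)).X p)
    (A : Submodule k (KoszulX S (freeAt k θ) i))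
    (hA : ∀ hF : F.IsLower, gen S (F.upper hF) p (by rw [homDeg_upper]; omega) x ∈ A) :
    contraction S hij (gen S F p h x) ∈ A := by
  by_cases hF : F.IsLower
  · rw [contraction_lower S hij hF]
    exact units_smul_mem A _ (hA hF)
  · rw [contraction_not_lower S hij hF]
    exact A.zero_mem

/-- The trivial factorization of the identity. -/
def trivialFactorization (θ : PrunedTree n) : Factorization (𝟙 θ) := ⟨θ, 𝟙 θ, 𝟙 θ, by simp⟩

lemma add_homDeg_trivial (i : ℤ) : i + homDeg (trivialFactorization θ).left = i :=
  (congrArg (i + ·) (homDeg_id θ)).trans (add_zero i)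

/-- The map `x ↦ x ⊗ {id} ⊗ [id]`. -/
noncomputable def critical {i : ℤ} : (S.obj (op θ)).X i →ₗ[k] KoszulX S (freeAt k θ) i :=
  gen S (trivialFactorization θ) i (add_homDeg_trivial i)

/-- If `f` has degree zero, then so do both factors, and morphisms of degree zero are identities. -/
lemma gen_mem_critical {i : ℤ} {f : θ ⟶ σ} (hf : homDeg f = 0) (F : Factorization f) (p : ℤ)
    (h : p + homDeg F.left = i) (x : (S.obj (op σ)).X p) :
    gen S F p h x ∈ LinearMap.range (critical S (θ := θ) (i := i)) := by
  have h0 := F.homDeg_eq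
  have h1 := homDeg_nonneg F.left
  have h2 := homDeg_nonneg F.right
  obtain ⟨τ, w, u, rfl⟩ := F
  dsimp only at h0 h1 h2 h
  obtain ⟨e, hw⟩ := exists_eqToHom_of_homDeg (u := w) (by omega)
  subst e
  obtain ⟨e, hu⟩ := exists_eqToHom_of_homDeg (u := u) (by omega)
  subst e
  have hp : p = i := by rw [hu, eqToHom_refl, homDeg_id, add_zero] at h; exact h
  subst hp
  refine ⟨x, ?_⟩
  subst hw hu
  rfl

/-- An identity has no factors of degree one, so only the internal differential survives. -/
lemma koszulD_critical {i j : ℤ} (hij : j + 1 = i) (x : (S.obj (op θ)).X i) :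
    koszulD S (freeAt k θ) hij (critical S x) = critical S ((S.obj (op θ)).d i j x) := by
  obtain rfl : j = i - 1 := by omega
  have h0 : ∀ F : Factorization (𝟙 θ), homDeg F.left = 0 ∧ homDeg F.right = 0 := fun F => by
    have h1 := homDeg_nonneg F.left
    have h2 := homDeg_nonneg F.right
    have h3 := F.homDeg_eq
    rw [homDeg_id] at h3
    omega
  rw [critical, koszulD_gen, Finset.sum_eq_zero, Finset.sum_eq_zero, add_zero, add_zero]
  · rfl
  · intro R _
    exact absurd ((h0 R.1).2.symm.trans R.2) zero_ne_one
  · intro L _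
    exact absurd ((h0 L.1).1.symm.trans L.2) zero_ne_one

lemma contraction_critical {i j : ℤ} (hij : j + 1 = i) (x : (S.obj (op θ)).X j) :
    contraction S hij (critical S x) = 0 :=
  contraction_not_lower S hij (fun h => h.1 (homDeg_id _)) _ _ _

variable {i j l : ℤ} (hij : j + 1 = i) (hjl : l + 1 = j)

/-- The operator `1 - d h - h d`. -/
noncomputable def reduction : Module.End k (KoszulX S (freeAt k θ) j) :=
  LinearMap.id - koszulD S (freeAt k θ) hij ∘ₗ contraction S hij -
    contraction S hjl ∘ₗ koszulD S (freeAt k θ) hjl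

lemma reduction_apply (z : KoszulX S (freeAt k θ) j) : reduction S hij hjl z =
    z - koszulD S (freeAt k θ) hij (contraction S hij z) -
      contraction S hjl (koszulD S (freeAt k θ) hjl z) := rfl

lemma reduction_critical (x : (S.obj (op θ)).X j) :
    reduction S hij hjl (critical S x) = critical S x := by
  rw [reduction_apply, contraction_critical, koszulD_critical, contraction_critical, map_zero,
    sub_zero, sub_zero]

/-- The elements that are critical after sufficiently many reductions. -/
noncomputable def eventuallyCritical : Submodule k (KoszulX S (freeAt k θ) j) where
  carrier := {z | ∃ m, ∀ m' ≥ m,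
    (reduction S hij hjl ^ m') z ∈ LinearMap.range (critical S (θ := θ) (i := j))}
  zero_mem' := ⟨0, fun m' _ => by rw [map_zero]; exact zero_mem _⟩
  add_mem' := by
    rintro z z' ⟨m, h⟩ ⟨m', h'⟩
    refine ⟨max m m', fun r hr => ?_⟩
    rw [map_add]
    exact add_mem (h r ((le_max_left _ _).trans hr)) (h' r ((le_max_right _ _).trans hr))
  smul_mem' := by
    rintro c z ⟨m, h⟩
    refine ⟨m, fun r hr => ?_⟩
    rw [map_smul]
    exact Submodule.smul_mem _ _ (h r hr)

lemma critical_mem (x : (S.obj (op θ)).X j) :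
    critical S x ∈ eventuallyCritical S (θ := θ) hij hjl := by
  refine ⟨0, fun m _ => ⟨x, ?_⟩⟩
  induction m with
  | zero => rfl
  | succ m ih =>
    rw [pow_succ, Module.End.mul_apply, reduction_critical]
    exact ih (Nat.zero_le _)

lemma mem_of_reduction_mem {z : KoszulX S (freeAt k θ) j}
    (h : reduction S hij hjl z ∈ eventuallyCritical S hij hjl) :
    z ∈ eventuallyCritical S hij hjl := by
  obtain ⟨m, h⟩ := h
  refine ⟨m + 1, fun r hr => ?_⟩
  obtain ⟨r, rfl⟩ : ∃ r', r = r' + 1 := ⟨r - 1, by omega⟩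
  rw [pow_succ, Module.End.mul_apply]
  exact h r (by omega)

/-- All elements that belong to morphisms of smaller degree are eventually critical. -/
def LowerDegrees (f : θ ⟶ σ) : Prop :=
  ∀ {σ' : PrunedTree n} (f' : θ ⟶ σ'), homDeg f' < homDeg f → ∀ (F : Factorization f')
    (p : ℤ) (h : p + homDeg F.left = j) (x : (S.obj (op σ')).X p),
    gen S F p h x ∈ eventuallyCritical S hij hjl

variable {S hij hjl} {f : θ ⟶ σ}

lemma homDeg_drop {F : Factorization f} (L : LeftFactorization F.left) :
    homDeg (F.right ≫ L.1.right) < homDeg f := by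
  rw [homDeg_comp, F.homDeg_eq, L.1.homDeg_eq, L.2]
  omega

lemma LowerDegrees.contraction_mem (low : LowerDegrees S hij hjl f) {F : Factorization f}
    (L : LeftFactorization F.left) (p : ℤ)
    (h : p + homDeg (F.drop L.1).left = l) (x : (S.obj (op L.1.mid)).X p) :
    contraction S hjl (gen S (F.drop L.1) p h x) ∈ eventuallyCritical S hij hjl :=
  _root_.contraction_mem S hjl _ _ _ _ fun _ => low _ (homDeg_drop L) _ _ _ _

/-- The contraction vanishes on `F`, and the partner term of its differential gives the element
back, so the reduction removes it. What remains are contractions of elements of smaller degree and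
partners of other lower factorizations covered by `F`, which have smaller rank. -/
lemma gen_mem_of_not_lower (hf : homDeg f ≠ 0) (low : LowerDegrees S hij hjl f) (r : ℕ) :
    ∀ F : Factorization f, F.rank hf = r → ¬ F.IsLower → ∀ (p : ℤ) (h : p + homDeg F.left = j)
      (x : (S.obj (op σ)).X p), gen S F p h x ∈ eventuallyCritical S hij hjl := by
  classical
  induction r using Nat.strong_induction_on with
  | _ r ih =>
  intro F hr hF p h x
  obtain ⟨G, hG, hc, rfl⟩ := Factorization.exists_upper_eq hf hF
  refine mem_of_reduction_mem S hij hjl ?_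
  rw [reduction_apply, contraction_not_lower S hij hF, map_zero, sub_zero, koszulD_gen, map_add,
    map_add, contraction_not_lower S hjl hF, zero_add, map_sum, map_sum,
    ← Finset.add_sum_erase _ _ (Finset.mem_univ (upperPush hG)), map_units_smul,
    gen_congr S (push_upperPush hG), contraction_lower S hjl hG, smul_smul]
  change gen S _ p h x - (_ + ((upperSign hG p * upperSign hG p) • gen S _ p h x + _)) ∈ _
  -- The sign of the partner occurs once in the differential and once in the contraction, hence
  -- cancels.
  rw [Int.units_mul_self, one_smul, add_left_comm, sub_add_cancel_left]
  refine neg_mem (add_mem (sum_mem fun L _ => ?_) (sum_mem fun R hR => ?_))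
  · rw [map_units_smul]
    exact units_smul_mem _ _ (low.contraction_mem L _ _ _)
  · rw [map_units_smul]
    refine units_smul_mem _ _ (contraction_mem S hjl _ _ _ _ fun hR' => ?_)
    refine ih _ (hr ▸ ?_) _ rfl (Factorization.upper_not_isLower hR') _ _ _
    refine (Factorization.rank_upper_le hR').trans_lt
      ((Factorization.covers_push _ R).rank_lt hf hF hR' fun e => ?_)
    refine (Finset.mem_erase.1 hR).1 (Subtype.ext (Factorization.push_injective _ ?_))
    rw [push_upperPush]
    exact Factorization.upper_injective _ _ e

/-- Now dh returns the element itself. The terms left over have smaller degree, or are lower of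
smaller rank, or are not lower; the last kind is settled by the preceding lemma. -/
lemma gen_mem_of_lower (hf : homDeg f ≠ 0) (low : LowerDegrees S hij hjl f) (r : ℕ) :
    ∀ F : Factorization f, F.rank hf = r → F.IsLower → ∀ (p : ℤ) (h : p + homDeg F.left = j)
      (x : (S.obj (op σ)).X p), gen S F p h x ∈ eventuallyCritical S hij hjl := by
  classical
  induction r using Nat.strong_induction_on with
  | _ r ih =>
  intro F hr hF p h x
  refine mem_of_reduction_mem S hij hjl ?_
  -- The element `g` cancels its partner term. The two internal terms `a` and `-a` cancel as well,
  -- since the sign of the contraction changes with `p`.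
  have e1 : ∀ a b c d e g : KoszulX S (freeAt k θ) j,
      g - (a + b + (g + c)) - (-a + d + e) = -(b + c + (d + e)) := fun a b c d e g => by abel
  rw [reduction_apply, contraction_lower S hij hF, koszulD_gen, map_units_smul, koszulD_gen,
    map_add, map_add, contraction_lower S hjl hF, upperSign_sub_one, smul_add, smul_add,
    ← Finset.add_sum_erase _ _ (Finset.mem_univ (upperPush hF)),
    gen_congr S (push_upperPush hF), smul_add, Units.neg_smul, map_sum, map_sum]
  change gen S _ p h x - (_ + _ + (upperSign hF p • (upperSign hF p • gen S _ p h x) + _)) - _ ∈ _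
  rw [smul_smul, Int.units_mul_self, one_smul, e1]
  refine neg_mem (add_mem (add_mem (units_smul_mem _ _ (sum_mem fun L _ => ?_))
    (units_smul_mem _ _ (sum_mem fun R hR => ?_)))
    (add_mem (sum_mem fun L _ => ?_) (sum_mem fun R _ => ?_)))
  · exact units_smul_mem _ _ (low _ (homDeg_drop L) _ _ _ _)
  · refine units_smul_mem _ _ ?_
    by_cases hR' : ((F.upper hF).push R.1).IsLower
    · refine ih _ (hr ▸ ?_) _ rfl hR' _ _ _
      refine ((Factorization.covers_push _ R).rank_lt hf (Factorization.upper_not_isLower hF) hR'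
        fun e => ?_).trans_le (Factorization.rank_upper_le hF)
      refine (Finset.mem_erase.1 hR).1 (Subtype.ext (Factorization.push_injective _ ?_))
      rw [push_upperPush]
      exact Factorization.upper_injective _ _ e
    · exact gen_mem_of_not_lower hf low _ _ rfl hR' _ _ _
  · rw [map_units_smul]
    exact units_smul_mem _ _ (low.contraction_mem L _ _ _)
  · rw [map_units_smul]
    exact units_smul_mem _ _ (contraction_mem S hjl _ _ _ _ fun hR' =>
      gen_mem_of_not_lower hf low _ _ rfl (Factorization.upper_not_isLower hR') _ _ _)

lemma gen_mem_eventuallyCritical (d : ℕ) : ∀ {σ : PrunedTree n} (f : θ ⟶ σ), homDeg f = d →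
    ∀ (F : Factorization f) (p : ℤ) (h : p + homDeg F.left = j) (x : (S.obj (op σ)).X p),
      gen S F p h x ∈ eventuallyCritical S hij hjl := by
  induction d using Nat.strong_induction_on with
  | _ d ih =>
  intro σ f hd F p h x
  by_cases hf : homDeg f = 0
  · obtain ⟨y, hy⟩ := gen_mem_critical S hf F p h x
    rw [← hy]
    exact critical_mem S hij hjl y
  have low : LowerDegrees S hij hjl f := fun f' h' => by
    obtain ⟨m, hm⟩ := Int.eq_ofNat_of_zero_le (homDeg_nonneg f')
    exact ih m (by omega) f' hm
  by_cases hF : F.IsLower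
  · exact gen_mem_of_lower hf low _ F rfl hF p h x
  · exact gen_mem_of_not_lower hf low _ F rfl hF p h x

variable (S) in
/-- Every cycle of the resolution is homologous to a critical one. -/
theorem exists_critical (hij : j + 1 = i) (hjl : l + 1 = j) (z : KoszulX S (freeAt k θ) j)
    (hz : koszulD S (freeAt k θ) hjl z = 0) :
    ∃ (x : (S.obj (op θ)).X j) (y : KoszulX S (freeAt k θ) i),
      z = critical S x + koszulD S (freeAt k θ) hij y := by
  have htop : eventuallyCritical S (θ := θ) hij hjl = ⊤ := span_gen S _ fun {_ f} F p h x => by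
    obtain ⟨m, hm⟩ := Int.eq_ofNat_of_zero_le (homDeg_nonneg f)
    exact gen_mem_eventuallyCritical m f hm F p h x
  obtain ⟨m, hm⟩ : z ∈ eventuallyCritical S hij hjl := htop ▸ Submodule.mem_top
  obtain ⟨x, hx⟩ := hm m le_rfl
  -- On cycles the reduction subtracts only the boundary dh, so it preserves the homology class.
  have key : ∀ m, koszulD S (freeAt k θ) hjl ((reduction S hij hjl ^ m) z) = 0 ∧
      ∃ y, z = (reduction S hij hjl ^ m) z + koszulD S (freeAt k θ) hij y := by
    intro m
    induction m with
    | zero => exact ⟨hz, 0, by rw [map_zero, add_zero]; rfl⟩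
    | succ m ih =>
      obtain ⟨h1, y, h2⟩ := ih
      rw [pow_succ', Module.End.mul_apply, reduction_apply, h1, map_zero, sub_zero, map_sub, h1]
      refine ⟨?_, contraction S hij ((reduction S hij hjl ^ m) z) + y, ?_⟩
      · rw [zero_sub, neg_eq_zero]
        exact LinearMap.congr_fun (koszulSquareZero S _ hij hjl) _
      · rw [map_add, ← add_assoc, sub_add_cancel]
        exact h2
  obtain ⟨-, y, hy⟩ := key m
  exact ⟨x, y, by rw [hx]; exact hy⟩

end Reduction

/-! ### Homology classes and quasi-isomorphisms of dg-modules -/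

section Homology

variable {k : Type u} [CommRing k] {C D E : DGMod k}

lemma next_eq {i j : ℤ} (hij : j + 1 = i) : (ComplexShape.down ℤ).next i = j :=
  (ComplexShape.down ℤ).next_eq' hij

lemma prev_eq {i j : ℤ} (hij : j + 1 = i) : (ComplexShape.down ℤ).prev j = i :=
  (ComplexShape.down ℤ).prev_eq' hij

/-- A cycle as an element of the object of cycles. -/
noncomputable def toCyc (C : DGMod k) {i j : ℤ} (hij : j + 1 = i) :
    ModuleCat.of k (LinearMap.ker (C.d i j).hom) ⟶ C.cycles i :=
  C.liftCycles (ModuleCat.ofHom (LinearMap.ker (C.d i j).hom).subtype) j (next_eq hij)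
    (by ext x; exact x.2)

lemma iCycles_toCyc (C : DGMod k) {i j : ℤ} (hij : j + 1 = i)
    (z : LinearMap.ker (C.d i j).hom) : C.iCycles i (toCyc C hij z) = z.1 := by
  rw [toCyc, ← ModuleCat.comp_apply, C.liftCycles_i]
  rfl

/-- The class of a cycle. -/
noncomputable def cls (C : DGMod k) {i j : ℤ} (hij : j + 1 = i) :
    ModuleCat.of k (LinearMap.ker (C.d i j).hom) ⟶ C.homology i :=
  toCyc C hij ≫ C.homologyπ i

lemma cls_surjective (C : DGMod k) {i j : ℤ} (hij : j + 1 = i) :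
    Function.Surjective (cls C hij) := by
  intro h
  obtain ⟨c, rfl⟩ := (ModuleCat.epi_iff_surjective (C.homologyπ i)).1 inferInstance h
  have hc : C.d i j (C.iCycles i c) = 0 := by
    rw [← ModuleCat.comp_apply, C.iCycles_d]
    rfl
  refine ⟨⟨C.iCycles i c, hc⟩, ?_⟩
  rw [cls, ModuleCat.comp_apply]
  congr 1
  refine (ModuleCat.mono_iff_injective (C.iCycles i)).1 inferInstance ?_
  rw [iCycles_toCyc]

lemma cls_eq_zero_iff (C : DGMod k) {i j l : ℤ} (hij : j + 1 = i) (hli : i + 1 = l)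
    (z : LinearMap.ker (C.d i j).hom) : cls C hij z = 0 ↔ ∃ y, C.d l i y = z.1 := by
  have ex : (ShortComplex.mk _ _ (C.toCycles_comp_homologyπ l i)).Exact :=
    ShortComplex.exact_of_g_is_cokernel _ (C.homologyIsCokernel l i (prev_eq hli))
  rw [ShortComplex.moduleCat_exact_iff] at ex
  rw [cls, ModuleCat.comp_apply]
  constructor
  · intro h
    obtain ⟨y, hy⟩ := ex _ h
    refine ⟨y, ?_⟩
    rw [← iCycles_toCyc C hij z, ← hy]
    change _ = C.iCycles i (C.toCycles l i y)
    rw [← ModuleCat.comp_apply, C.toCycles_i]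
  · rintro ⟨y, hy⟩
    have : C.toCycles l i y = toCyc C hij z := by
      refine (ModuleCat.mono_iff_injective (C.iCycles i)).1 inferInstance ?_
      rw [iCycles_toCyc, ← ModuleCat.comp_apply, C.toCycles_i, hy]
    rw [← this, ← ModuleCat.comp_apply, C.toCycles_comp_homologyπ]
    rfl

lemma homologyMap_cls (f : C ⟶ D) {i j : ℤ} (hij : j + 1 = i)
    (z : LinearMap.ker (C.d i j).hom) :
    HomologicalComplex.homologyMap f i (cls C hij z) =
      cls D hij ⟨f.f i z.1, by
        rw [LinearMap.mem_ker]
        have := z.2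
        rw [LinearMap.mem_ker] at this
        change D.d i j (f.f i z.1) = 0
        rw [f_d_apply]
        change f.f j ((C.d i j).hom z.1) = 0
        rw [this, map_zero]⟩ := by
  rw [cls, cls, ModuleCat.comp_apply, ModuleCat.comp_apply, ← ModuleCat.comp_apply,
    HomologicalComplex.homologyπ_naturality, ModuleCat.comp_apply]
  congr 1
  refine (ModuleCat.mono_iff_injective (D.iCycles i)).1 inferInstance ?_
  rw [← ModuleCat.comp_apply, HomologicalComplex.cyclesMap_i, ModuleCat.comp_apply,
    iCycles_toCyc, iCycles_toCyc]

/-- Maps that differ by boundaries on cycles agree on homology. -/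
lemma homologyMap_eq {f g : C ⟶ D} {i j l : ℤ} (hij : j + 1 = i) (hli : i + 1 = l)
    (h : ∀ z, C.d i j z = 0 → ∃ y, D.d l i y = f.f i z - g.f i z) :
    HomologicalComplex.homologyMap f i = HomologicalComplex.homologyMap g i := by
  ext x
  obtain ⟨z, rfl⟩ := cls_surjective C hij x
  refine sub_eq_zero.1 ?_
  erw [homologyMap_cls, homologyMap_cls, ← map_sub]
  obtain ⟨y, hy⟩ := h z.1 z.2
  exact (cls_eq_zero_iff D hij hli _).2 ⟨y, hy⟩

lemma quasiIso_iff_elements (f : C ⟶ D) : QuasiIso f ↔ ∀ i j l : ℤ, j + 1 = i → i + 1 = l →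
    (∀ z, C.d i j z = 0 → ∀ y, D.d l i y = f.f i z → ∃ y', C.d l i y' = z) ∧
    (∀ z, D.d i j z = 0 → ∃ x y, C.d i j x = 0 ∧ z = f.f i x + D.d l i y) := by
  have key : ∀ i j l : ℤ, j + 1 = i → i + 1 = l →
      (IsIso (HomologicalComplex.homologyMap f i) ↔
      (∀ z, C.d i j z = 0 → ∀ y, D.d l i y = f.f i z → ∃ y', C.d l i y' = z) ∧
      (∀ z, D.d i j z = 0 → ∃ x y, C.d i j x = 0 ∧ z = f.f i x + D.d l i y)) := by
    intro i j l hij hli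
    rw [ConcreteCategory.isIso_iff_bijective]
    refine and_congr ?_ ?_
    · rw [injective_iff_map_eq_zero]
      constructor
      · intro h z hz y hy
        refine (cls_eq_zero_iff C hij hli ⟨z, hz⟩).1 (h _ ?_)
        rw [homologyMap_cls]
        exact (cls_eq_zero_iff D hij hli _).2 ⟨y, hy⟩
      · intro h x hx
        obtain ⟨z, rfl⟩ := cls_surjective C hij x
        rw [homologyMap_cls] at hx
        obtain ⟨y, hy⟩ := (cls_eq_zero_iff D hij hli _).1 hx
        exact (cls_eq_zero_iff C hij hli z).2 (h z.1 z.2 y hy)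
    · constructor
      · intro h z hz
        obtain ⟨x, hx⟩ := h (cls D hij ⟨z, hz⟩)
        obtain ⟨x, rfl⟩ := cls_surjective C hij x
        rw [homologyMap_cls, eq_comm, ← sub_eq_zero, ← map_sub] at hx
        obtain ⟨y, hy⟩ := (cls_eq_zero_iff D hij hli _).1 hx
        refine ⟨x.1, y, x.2, ?_⟩
        rw [hy]
        exact (add_sub_cancel _ _).symm
      · intro h x
        obtain ⟨z, rfl⟩ := cls_surjective D hij x
        obtain ⟨x, y, hx, hy⟩ := h z.1 z.2
        refine ⟨cls C hij ⟨x, hx⟩, ?_⟩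
        rw [homologyMap_cls, eq_comm, ← sub_eq_zero, ← map_sub]
        refine (cls_eq_zero_iff D hij hli _).2 ⟨y, ?_⟩
        exact (sub_eq_of_eq_add' hy).symm
  rw [quasiIso_iff]
  simp only [quasiIsoAt_iff_isIso_homologyMap]
  constructor
  · intro h i j l hij hli
    exact (key i j l hij hli).1 (h i)
  · intro h i
    exact (key i (i - 1) (i + 1) (by omega) rfl).2 (h _ _ _ (by omega) rfl)

/-- An acyclic fibration detects cycles of its kernel as boundaries of its kernel, and lifts
cycles to cycles. -/
lemma isAcyclicFibration_iff (p : C ⟶ D) : IsAcyclicFibration p ↔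
    (∀ i, Function.Surjective (p.f i)) ∧ ∀ i j l : ℤ, j + 1 = i → i + 1 = l →
      ∀ z, C.d i j z = 0 → p.f i z = 0 → ∃ y, C.d l i y = z ∧ p.f l y = 0 := by
  refine and_congr_right fun hs => ?_
  rw [quasiIso_iff_elements]
  constructor
  · intro h i j l hij hli z hz hpz
    obtain ⟨y, rfl⟩ := (h i j l hij hli).1 z hz 0 (by rw [map_zero, hpz])
    have h2 : D.d l i (p.f l y) = 0 := by rw [f_d_apply, hpz]
    obtain ⟨x, y', hx, hy'⟩ := (h l i (l + 1) hli rfl).2 _ h2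
    obtain ⟨w, rfl⟩ := hs _ y'
    refine ⟨y - x - C.d (l + 1) l w, ?_, ?_⟩
    · rw [map_sub, map_sub, hx, dgMod_d_d, sub_zero, sub_zero]
    · rw [map_sub, map_sub, hy', f_d_apply, add_sub_cancel_left, sub_self]
  · intro h i j l hij hli
    refine ⟨fun z hz y hy => ?_, fun z hz => ?_⟩
    · obtain ⟨w, rfl⟩ := hs _ y
      rw [f_d_apply] at hy
      obtain ⟨y', hy', -⟩ := h i j l hij hli (z - C.d l i w)
        (by rw [map_sub, hz, dgMod_d_d, sub_zero]) (by rw [map_sub, hy, sub_self])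
      exact ⟨y' + w, by rw [map_add, hy', sub_add_cancel]⟩
    · obtain ⟨x, rfl⟩ := hs _ z
      rw [f_d_apply] at hz
      obtain ⟨y, hy, hpy⟩ := h j (j - 1) i (by omega) hij (C.d i j x) (dgMod_d_d _ _ _ _) hz
      refine ⟨x - y, 0, by rw [map_sub, hy, sub_self], ?_⟩
      rw [map_sub, hpy, map_zero, sub_zero, add_zero]

end Homology

/-! ### Homotopy pullbacks of dg-modules -/

section Path

variable {k : Type u} [CommRing k] {A B C A' B' C' Q : DGMod k}

/-- The differential of the homotopy pullback. -/
noncomputable def pathD (p : A ⟶ B) (q : C ⟶ B) (j : ℤ) :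
    (B.X (j + 1 + 1) × A.X (j + 1) × C.X (j + 1)) →ₗ[k] (B.X (j + 1) × A.X j × C.X j) where
  toFun z := (p.f (j + 1) z.2.1 - q.f (j + 1) z.2.2 - B.d (j + 1 + 1) (j + 1) z.1,
    A.d (j + 1) j z.2.1, C.d (j + 1) j z.2.2)
  map_add' z z' := by
    simp only [Prod.fst_add, Prod.snd_add, map_add, Prod.mk_add_mk, Prod.mk.injEq, and_true]
    abel
  map_smul' c z := by
    simp only [Prod.smul_fst, Prod.smul_snd, map_smul, Prod.smul_mk, smul_sub, RingHom.id_apply]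

/-- The homotopy pullback of two morphisms of dg-modules. -/
noncomputable def path (p : A ⟶ B) (q : C ⟶ B) : DGMod k :=
  ChainComplex.of (fun i => ModuleCat.of k (B.X (i + 1) × A.X i × C.X i))
    (fun j => ModuleCat.ofHom (pathD p q j)) fun j => by
      refine ModuleCat.hom_ext (LinearMap.ext fun z => ?_)
      change pathD p q j (pathD p q (j + 1) z) = 0
      simp only [pathD, LinearMap.coe_mk, AddHom.coe_mk, map_sub, dgMod_d_d, f_d_apply, sub_self,
        sub_zero]
      rfl

lemma path_d (p : A ⟶ B) (q : C ⟶ B) (j : ℤ)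
    (z : B.X (j + 1 + 1) × A.X (j + 1) × C.X (j + 1)) :
    (path p q).d (j + 1) j z = pathD p q j z := by
  have : (path p q).d (j + 1) j = ModuleCat.ofHom (pathD p q j) :=
    ChainComplex.of_d (fun i => ModuleCat.of k (B.X (i + 1) × A.X i × C.X i))
      (fun j => ModuleCat.ofHom (pathD p q j)) j
  rw [this]
  rfl

/-- A morphism to a homotopy pullback. -/
noncomputable def pathLift (p : A ⟶ B) (q : C ⟶ B) (a : Q ⟶ A) (c : Q ⟶ C)
    (b : ∀ i : ℤ, Q.X i →ₗ[k] B.X (i + 1))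
    (h : ∀ (j : ℤ) (x : Q.X (j + 1)), p.f (j + 1) (a.f (j + 1) x) - q.f (j + 1) (c.f (j + 1) x)
      = B.d (j + 1 + 1) (j + 1) (b (j + 1) x) + b j (Q.d (j + 1) j x)) : Q ⟶ path p q where
  f i := ModuleCat.ofHom ((b i).prod ((a.f i).hom.prod (c.f i).hom))
  comm' i j hij := by
    obtain rfl : j + 1 = i := hij
    ext x
    change (path p q).d (j + 1) j (b (j + 1) x, a.f (j + 1) x, c.f (j + 1) x) =
      (b j (Q.d (j + 1) j x), a.f j (Q.d (j + 1) j x), c.f j (Q.d (j + 1) j x))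
    rw [path_d]
    simp only [pathD, LinearMap.coe_mk, AddHom.coe_mk, f_d_apply]
    rw [h, add_sub_cancel_left]

/-- The functoriality of the homotopy pullback. -/
noncomputable def pathMap {p : A ⟶ B} {q : C ⟶ B} {p' : A' ⟶ B'} {q' : C' ⟶ B'} (α : A ⟶ A')
    (β : B ⟶ B') (γ : C ⟶ C') (h : p ≫ β = α ≫ p') (h' : q ≫ β = γ ≫ q') :
    path p q ⟶ path p' q' where
  f i := ModuleCat.ofHom ((β.f (i + 1)).hom.prodMap ((α.f i).hom.prodMap (γ.f i).hom))
  comm' i j hij := by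
    obtain rfl : j + 1 = i := hij
    ext z
    change B.X (j + 1 + 1) × A.X (j + 1) × C.X (j + 1) at z
    change (path p' q').d (j + 1) j (β.f _ z.1, α.f _ z.2.1, γ.f _ z.2.2) =
      ((β.f (j + 1)).hom.prodMap ((α.f j).hom.prodMap (γ.f j).hom)) ((path p q).d (j + 1) j z)
    have e : ∀ a, p'.f (j + 1) (α.f (j + 1) a) = β.f (j + 1) (p.f (j + 1) a) := fun a => by
      rw [← ModuleCat.comp_apply, ← ModuleCat.comp_apply, ← HomologicalComplex.comp_f,
        ← HomologicalComplex.comp_f, h]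
    have e' : ∀ a, q'.f (j + 1) (γ.f (j + 1) a) = β.f (j + 1) (q.f (j + 1) a) := fun a => by
      rw [← ModuleCat.comp_apply, ← ModuleCat.comp_apply, ← HomologicalComplex.comp_f,
        ← HomologicalComplex.comp_f, h']
    rw [path_d, path_d]
    simp only [pathD, LinearMap.coe_mk, AddHom.coe_mk, f_d_apply, e, e']
    refine Prod.ext ?_ rfl
    change _ - _ - _ = β.f (j + 1) (p.f (j + 1) z.2.1 - q.f (j + 1) z.2.2 -
      B.d (j + 1 + 1) (j + 1) z.1)
    rw [map_sub, map_sub]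

/-- The first projection of the homotopy pullback. -/
noncomputable def pathFst (p : A ⟶ B) (q : C ⟶ B) : path p q ⟶ A where
  f i := ModuleCat.ofHom (LinearMap.fst k (A.X i) (C.X i) ∘ₗ LinearMap.snd k _ _)
  comm' i j hij := by
    obtain rfl : j + 1 = i := hij
    ext z
    change B.X (j + 1 + 1) × A.X (j + 1) × C.X (j + 1) at z
    change A.d _ _ z.2.1 = (LinearMap.fst k (A.X j) (C.X j) ∘ₗ LinearMap.snd k _ _)
      ((path p q).d (j + 1) j z)
    rw [path_d]
    rfl

/-- The second projection of the homotopy pullback. -/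
noncomputable def pathSnd (p : A ⟶ B) (q : C ⟶ B) : path p q ⟶ C where
  f i := ModuleCat.ofHom (LinearMap.snd k (A.X i) (C.X i) ∘ₗ LinearMap.snd k _ _)
  comm' i j hij := by
    obtain rfl : j + 1 = i := hij
    ext z
    change B.X (j + 1 + 1) × A.X (j + 1) × C.X (j + 1) at z
    change C.d _ _ z.2.2 = (LinearMap.snd k (A.X j) (C.X j) ∘ₗ LinearMap.snd k _ _)
      ((path p q).d (j + 1) j z)
    rw [path_d]
    rfl

/-- The homotopy that comes with a homotopy pullback. -/
noncomputable def pathHomotopy (p : A ⟶ B) (q : C ⟶ B) (i : ℤ) :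
    (path p q).X i →ₗ[k] B.X (i + 1) :=
  LinearMap.fst k (B.X (i + 1)) (A.X i × C.X i)

lemma pathHomotopy_d (p : A ⟶ B) (q : C ⟶ B) (j : ℤ) (z : (path p q).X (j + 1)) :
    pathHomotopy p q j ((path p q).d (j + 1) j z) =
      p.f (j + 1) ((pathFst p q).f (j + 1) z) - q.f (j + 1) ((pathSnd p q).f (j + 1) z) -
        B.d (j + 1 + 1) (j + 1) (pathHomotopy p q (j + 1) z) := by
  change B.X (j + 1 + 1) × A.X (j + 1) × C.X (j + 1) at z
  rw [path_d]
  rfl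

/-- The kernel is the kernel of `β`, shifted and with the opposite differential, hence acyclic. -/
lemma isAcyclicFibration_pathMap (p : A ⟶ B) (q : C ⟶ B) (β : B ⟶ B')
    (hβ : IsAcyclicFibration β) :
    IsAcyclicFibration (pathMap (p := p) (q := q) (p' := p ≫ β) (q' := q ≫ β) (𝟙 A) β (𝟙 C)
      (Category.id_comp _).symm (Category.id_comp _).symm) := by
  rw [isAcyclicFibration_iff] at hβ ⊢
  refine ⟨fun i => ?_, fun i j l hij hli z hz hpz => ?_⟩
  · rintro ⟨b, a, c⟩
    obtain ⟨b, rfl⟩ := hβ.1 _ b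
    exact ⟨(b, a, c), rfl⟩
  · subst hij hli
    obtain ⟨b, a, c⟩ := z
    have h1 : β.f (j + 1 + 1) b = 0 := congrArg Prod.fst hpz
    obtain rfl : a = 0 := congrArg (fun z => z.2.1) hpz
    obtain rfl : c = 0 := congrArg (fun z => z.2.2) hpz
    rw [path_d] at hz
    have h2 : p.f (j + 1) 0 - q.f (j + 1) 0 - B.d (j + 1 + 1) (j + 1) b = 0 :=
      congrArg Prod.fst hz
    rw [map_zero, map_zero, sub_zero, zero_sub, neg_eq_zero] at h2
    obtain ⟨y, hy, hy'⟩ := hβ.2 (j + 1 + 1) (j + 1) (j + 1 + 1 + 1) rfl rfl b h2 h1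
    refine ⟨(-y, 0, 0), ?_, ?_⟩
    · rw [path_d]
      refine Prod.ext ?_ (Prod.ext (map_zero _) (map_zero _))
      change p.f _ 0 - q.f _ 0 - B.d _ _ (-y) = b
      rw [map_zero, map_zero, sub_zero, zero_sub, map_neg, neg_neg, hy]
    · refine Prod.ext ?_ rfl
      change β.f _ (-y) = 0
      rw [map_neg, hy', neg_zero]

/-- The kernel is, up to shift and signs, the mapping cone of `p`, which is acyclic as `p` is a
quasi-isomorphism. -/
lemma isAcyclicFibration_pathSnd (p : A ⟶ C) (hp : QuasiIso p) :
    IsAcyclicFibration (pathSnd p (𝟙 C)) := by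
  rw [quasiIso_iff_elements] at hp
  rw [isAcyclicFibration_iff]
  refine ⟨fun i c => ⟨(0, 0, c), rfl⟩, fun i j l hij hli z hz hpz => ?_⟩
  subst hij hli
  obtain ⟨b, a, c⟩ := z
  obtain rfl : c = 0 := hpz
  rw [path_d] at hz
  have h1 : p.f (j + 1) a - 0 - C.d (j + 1 + 1) (j + 1) b = 0 := congrArg Prod.fst hz
  have h2 : A.d (j + 1) j a = 0 := congrArg (fun z => z.2.1) hz
  rw [sub_zero] at h1
  -- Injectivity on homology bounds `a` by some `a'`. Surjectivity one degree higher then corrects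
  -- `a'` by a cycle, which makes the first coordinate a boundary too.
  obtain ⟨a', rfl⟩ := (hp _ _ _ rfl rfl).1 a h2 b (sub_eq_zero.1 h1).symm
  obtain ⟨x, y, hx, hy⟩ := (hp (j + 1 + 1) (j + 1) _ rfl rfl).2 (b - p.f _ a') (by
    rw [map_sub, f_d_apply, ← sub_eq_zero.1 h1, sub_self])
  refine ⟨(-y, a' + x, 0), ?_, rfl⟩
  rw [path_d]
  refine Prod.ext ?_ (Prod.ext ?_ (map_zero _))
  · change p.f _ (a' + x) - 0 - C.d _ _ (-y) = b
    rw [sub_zero, map_neg, sub_neg_eq_add, map_add, add_assoc (p.f _ a')]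
    exact (congrArg _ hy.symm).trans (add_sub_cancel _ _)
  · change A.d _ _ (a' + x) = A.d _ _ a'
    rw [map_add, hx, add_zero]

/-! ### Shifts, and lifting of maps that are not chain maps -/

/-- The shift of a dg-module, with the negative of its differential. -/
noncomputable def negShift (t : ℤ) (X : DGMod k) : DGMod k :=
  ChainComplex.of (fun i => X.X (i + t)) (fun j => -X.d (j + 1 + t) (j + t)) fun j => by
    rw [Preadditive.neg_comp_neg, X.d_comp_d]

lemma negShift_d (t : ℤ) (X : DGMod k) (j : ℤ) (x : X.X (j + 1 + t)) :
    (negShift t X).d (j + 1) j x = -X.d (j + 1 + t) (j + t) x := by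
  have : (negShift t X).d (j + 1) j = -X.d (j + 1 + t) (j + t) :=
    ChainComplex.of_d (fun i => X.X (i + t)) (fun j => -X.d (j + 1 + t) (j + t)) j
  rw [this]
  rfl

/-- The functoriality of the shift. -/
noncomputable def negShiftMap (t : ℤ) (f : A ⟶ B) : negShift t A ⟶ negShift t B where
  f i := f.f (i + t)
  comm' i j hij := by
    obtain rfl : j + 1 = i := hij
    ext x
    change A.X (j + 1 + t) at x
    change (negShift t B).d (j + 1) j (f.f (j + 1 + t) x) =
      f.f (j + t) ((negShift t A).d (j + 1) j x)
    rw [negShift_d, negShift_d, f_d_apply, map_neg]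

lemma isAcyclicFibration_negShiftMap (t : ℤ) (f : A ⟶ B) (hf : IsAcyclicFibration f) :
    IsAcyclicFibration (negShiftMap t f) := by
  rw [isAcyclicFibration_iff] at hf ⊢
  refine ⟨fun i => hf.1 (i + t), fun i j l hij hli z hz hpz => ?_⟩
  subst hij hli
  change A.X (j + 1 + t) at z
  rw [negShift_d] at hz
  replace hz : A.d (j + 1 + t) (j + t) z = 0 := neg_eq_zero.1 hz
  obtain ⟨y, hy, hy'⟩ := hf.2 (j + 1 + t) (j + t) (j + 1 + 1 + t) (by omega) (by omega) z hz hpz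
  refine ⟨(-y : A.X (j + 1 + 1 + t)), ?_, ?_⟩
  · rw [negShift_d]
    change -A.d (j + 1 + 1 + t) (j + 1 + t) (-y) = z
    rw [map_neg, neg_neg, hy]
  · change f.f (j + 1 + 1 + t) (-y) = 0
    rw [map_neg, hy', neg_zero]

/-- Twisted lifting: a map `f` of degree `m` from a cofibrant dg-module that fails to be a chain
map by `p r` lifts along the acyclic fibration `p` to a map that fails to be a chain map by `r`. -/
lemma IsCofibrantDGMod.exists_twisted_lift (hC : IsCofibrantDGMod C) (p : A ⟶ B)
    (hp : IsAcyclicFibration p) (m : ℤ) (f : ∀ i j : ℤ, i + m = j → C.X i →ₗ[k] B.X j)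
    (r : ∀ i j : ℤ, i + m = j + 1 → C.X i →ₗ[k] A.X j)
    (hf : ∀ (i i' j j' : ℤ) (hi : i' + 1 = i) (hj : j' + 1 = j) (h : i + m = j) (x : C.X i),
      B.d j j' (f i j h x) = f i' j' (by omega) (C.d i i' x) + p.f j' (r i j' (by omega) x))
    (hr : ∀ (i i' j j' : ℤ) (hi : i' + 1 = i) (hj : j' + 1 = j) (h : i + m = j + 1) (x : C.X i),
      A.d j j' (r i j h x) = -r i' j' (by omega) (C.d i i' x)) :
    ∃ g : ∀ i j : ℤ, i + m = j → C.X i →ₗ[k] A.X j,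
      (∀ i j h x, p.f j (g i j h x) = f i j h x) ∧
      ∀ (i i' j j' : ℤ) (hi : i' + 1 = i) (hj : j' + 1 = j) (h : i + m = j) (x : C.X i),
        A.d j j' (g i j h x) = g i' j' (by omega) (C.d i i' x) + r i j' (by omega) x := by
  -- The condition `hr` says that the error `r` is a chain map into the shift. A twisted map is, up
  -- to sign, a null-homotopy of it.
  let s : C ⟶ negShift (m - 1) A :=
    { f := fun i => ModuleCat.ofHom (r i (i + (m - 1)) (by omega))
      comm' := fun i j hij => by
        obtain rfl : j + 1 = i := hij
        ext x
        change (negShift (m - 1) A).d (j + 1) j (r (j + 1) (j + 1 + (m - 1)) (by omega) x) =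
          r j (j + (m - 1)) (by omega) (C.d (j + 1) j x)
        rw [negShift_d, hr (j + 1) j _ _ rfl (by omega)]
        exact neg_neg _ }
  let q := negShiftMap (m - 1) p
  -- Maps into this homotopy pullback encode null-homotopies: the second leg is zero, so the third
  -- coordinate is a dummy. The given `f` is a null-homotopy over `B`, and lifting along `Φ`
  -- produces the one over `A`.
  let Φ := pathMap (p := 𝟙 (negShift (m - 1) A)) (q := (0 : A ⟶ negShift (m - 1) A))
    (p' := 𝟙 _ ≫ q) (q' := (0 : A ⟶ negShift (m - 1) A) ≫ q) (𝟙 _) q (𝟙 _)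
    (Category.id_comp _).symm (Category.id_comp _).symm
  have hΦ : IsAcyclicFibration Φ :=
    isAcyclicFibration_pathMap _ _ q (isAcyclicFibration_negShiftMap _ p hp)
  let F : C ⟶ path (𝟙 _ ≫ q) ((0 : A ⟶ negShift (m - 1) A) ≫ q) :=
    pathLift _ _ s 0 (fun i => -f i (i + 1 + (m - 1)) (by omega)) fun j x => by
      have h3 : ((0 : A ⟶ negShift (m - 1) A) ≫ q).f (j + 1) ((0 : C ⟶ A).f (j + 1) x) = 0 :=
        map_zero _
      have main : p.f _ (r (j + 1) (j + 1 + (m - 1)) (by omega) x) - 0 =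
          -B.d (j + 1 + 1 + (m - 1)) (j + 1 + (m - 1))
            (-f (j + 1) (j + 1 + 1 + (m - 1)) (by omega) x) +
            -f j (j + 1 + (m - 1)) (by omega) (C.d (j + 1) j x) := by
        rw [map_neg, neg_neg, hf (j + 1) j _ _ rfl (by omega), sub_zero]
        exact (add_neg_cancel_comm _ _).symm
      exact (congrArg (HSub.hSub _) h3).trans (main.trans (congrArg (fun z => z + _)
        (negShift_d (m - 1) B (j + 1) (-f (j + 1) (j + 1 + 1 + (m - 1)) (by omega) x)).symm))
  obtain ⟨G, hG⟩ := hC Φ hΦ F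
  let b : ∀ i : ℤ, C.X i →ₗ[k] A.X (i + 1 + (m - 1)) := fun i =>
    (pathHomotopy (𝟙 (negShift (m - 1) A)) (0 : A ⟶ negShift (m - 1) A) i ∘ₗ (G.f i).hom :)
  have hb1 : ∀ i x, p.f _ (b i x) = -f i (i + 1 + (m - 1)) (by omega) x := fun i x =>
    congrArg (fun H : C ⟶ path _ _ => pathHomotopy _ _ i (H.f i x)) hG
  have ha : ∀ i x, (pathFst _ _).f i (G.f i x) = r i (i + (m - 1)) (by omega) x := fun i x =>
    congrArg (fun H : C ⟶ path _ _ => (pathFst _ _).f i (H.f i x)) hG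
  have hb2 : ∀ (j : ℤ) x, b j (C.d (j + 1) j x) =
      r (j + 1) (j + 1 + (m - 1)) (by omega) x +
        A.d (j + 1 + 1 + (m - 1)) (j + 1 + (m - 1)) (b (j + 1) x) := fun j x => by
    have h1 := pathHomotopy_d _ _ j (G.f (j + 1) x)
    rw [f_d_apply, ha] at h1
    refine h1.trans ?_
    have h2 := negShift_d (m - 1) A (j + 1) (b (j + 1) x)
    have h3 : ∀ v w : A.X (j + 1 + (m - 1)), v - 0 - -w = v + w := fun v w => by
      rw [sub_zero, sub_neg_eq_add]
    exact (congrArg (HSub.hSub _) h2).trans (h3 _ _)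
  refine ⟨fun i j h => by
    obtain rfl : i + 1 + (m - 1) = j := by omega
    exact -b i, fun i j h x => ?_, fun i i' j j' hi hj h x => ?_⟩
  · obtain rfl : i + 1 + (m - 1) = j := by omega
    change p.f _ (-b i x) = _
    rw [map_neg, hb1, neg_neg]
  · obtain rfl : i + 1 + (m - 1) = j := by omega
    subst hi
    obtain rfl : i' + 1 + (m - 1) = j' := by omega
    change A.d _ _ (-b (i' + 1) x) = -b i' _ + _
    rw [map_neg, hb2]
    abel

end Path

/-! ### The resolution as a diagram, and its augmentation -/

section Augmentation

open PrunedTree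

variable {k : Type u} [CommRing k] {n : ℕ}

/-- Precomposition of a factorization with a morphism. -/
def PrunedTree.Factorization.precomp {θ θ' σ : PrunedTree n} {f : θ ⟶ σ} (F : Factorization f)
    (a : θ' ⟶ θ) : Factorization (a ≫ f) where
  mid := F.mid
  right := a ≫ F.right
  left := F.left
  fac := by rw [Category.assoc, F.fac]

lemma add_homDeg_precomp {θ θ' σ : PrunedTree n} {i p : ℤ} {g : θ ⟶ σ} {F : Factorization g}
    (h : p + homDeg F.left = i) (a : θ' ⟶ θ) : p + homDeg (F.precomp a).left = i := h

lemma koszulXMap_gen {S S' : ContraDiagram k n} (f : S ⟶ S') {θ θ' σ : PrunedTree n}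
    (a : θ' ⟶ θ) {i : ℤ} {g : θ ⟶ σ} (F : Factorization g) (p : ℤ) (h : p + homDeg F.left = i)
    (x : (S.obj (op σ)).X p) :
    koszulXMap f (freeMap a) i (gen S F p h x) =
      gen S' (F.precomp a) p (add_homDeg_precomp h a) ((f.app (op σ)).f p x) := by
  rw [gen_apply, koszulXMap_incl, freeMap_freeGen]
  rfl

lemma gen_precomp_id (S : ContraDiagram k n) {θ σ : PrunedTree n} {i : ℤ} {g : θ ⟶ σ}
    (F : Factorization g) (p : ℤ) (h : p + homDeg F.left = i) (x : (S.obj (op σ)).X p) :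
    gen S (F.precomp (𝟙 θ)) p (add_homDeg_precomp h _) x = gen S F p h x := by
  obtain ⟨m, r, l, rfl⟩ := F
  exact congrArg (fun r' => koszulIncl S (freeAt k θ) l p 0 (by rw [add_zero]; exact h)
    (x ⊗ₜ freeGen r')) (Category.id_comp r)

lemma gen_precomp_comp (S : ContraDiagram k n) {θ θ' θ'' σ : PrunedTree n} {i : ℤ} {g : θ ⟶ σ}
    (F : Factorization g) (a : θ' ⟶ θ) (b : θ'' ⟶ θ') (p : ℤ) (h : p + homDeg F.left = i)
    (x : (S.obj (op σ)).X p) :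
    gen S (F.precomp (b ≫ a)) p (add_homDeg_precomp h _) x =
      gen S ((F.precomp a).precomp b) p
        (add_homDeg_precomp (add_homDeg_precomp h a) b) x := by
  obtain ⟨m, r, l, rfl⟩ := F
  exact congrArg (fun r' => koszulIncl S (freeAt k θ'') l p 0 (by rw [add_zero]; exact h)
    (x ⊗ₜ freeGen r')) (Category.assoc b a r)

/-- The diagram `θ ↦ K(S, Ω, k[Hom(θ, -)])`. -/
noncomputable def resolution (S : ContraDiagram k n) : ContraDiagram k n where
  obj θ := koszulComplex S (freeAt k θ.unop) (koszulSquareZero _ _)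
  map a := koszulMap (𝟙 S) (freeMap a.unop) (koszulSquareZero _ _) (koszulSquareZero _ _)
  map_id θ := by
    ext i : 2
    refine koszulX_ext fun F p h x => ?_
    change koszulXMap (𝟙 S) (freeMap (𝟙 θ.unop)) i (gen S F p h x) = gen S F p h x
    rw [koszulXMap_gen]
    exact gen_precomp_id S F p h x
  map_comp {θ θ' θ''} a b := by
    ext i : 2
    refine koszulX_ext fun F p h x => ?_
    change koszulXMap (𝟙 S) (freeMap (b.unop ≫ a.unop)) i (gen S F p h x) =
      koszulXMap (𝟙 S) (freeMap b.unop) i (koszulXMap (𝟙 S) (freeMap a.unop) i (gen S F p h x))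
    rw [koszulXMap_gen, koszulXMap_gen, koszulXMap_gen]
    exact gen_precomp_comp S F a.unop b.unop p h x

lemma koszulXMap_id_gen {S S' : ContraDiagram k n} (f : S ⟶ S') {θ σ : PrunedTree n}
    {i : ℤ} {g : θ ⟶ σ} (F : Factorization g) (p : ℤ) (h : p + homDeg F.left = i)
    (x : (S.obj (op σ)).X p) :
    koszulXMap f (𝟙 (freeAt k θ)) i (gen S F p h x) =
      gen S' F p h ((f.app (op σ)).f p x) := by
  rw [gen_apply, koszulXMap_incl]
  rfl

/-- The functoriality of the resolution. -/
noncomputable def resolutionMap {S S' : ContraDiagram k n} (f : S ⟶ S') :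
    resolution S ⟶ resolution S' where
  app θ := koszulMap f (𝟙 (freeAt k θ.unop)) (koszulSquareZero _ _) (koszulSquareZero _ _)
  naturality θ θ' a := by
    ext i : 2
    refine koszulX_ext fun F p h x => ?_
    change koszulXMap f (𝟙 _) i (koszulXMap (𝟙 S) (freeMap a.unop) i (gen S F p h x)) =
      koszulXMap (𝟙 S') (freeMap a.unop) i (koszulXMap f (𝟙 _) i (gen S F p h x))
    rw [koszulXMap_gen, koszulXMap_id_gen, koszulXMap_id_gen, koszulXMap_gen]
    rfl

lemma koszulComplex_d (S : ContraDiagram k n) (T : CovDiagram k n) (hK : KoszulSquareZero S T)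
    {i j : ℤ} (hij : j + 1 = i) (z : KoszulX S T i) :
    (koszulComplex S T hK).d i j z = koszulD S T hij z := by
  have : (koszulComplex S T hK).d i j = ModuleCat.ofHom (koszulD S T hij) := dif_pos hij
  rw [this]
  rfl

variable (S : ContraDiagram k n) {θ σ : PrunedTree n}

lemma resolution_d (θ : (PrunedTree n)ᵒᵖ) {i j : ℤ} (hij : j + 1 = i)
    (z : KoszulX S (freeAt k θ.unop) i) :
    ((resolution S).obj θ).d i j z = koszulD S (freeAt k θ.unop) hij z :=
  koszulComplex_d S _ (koszulSquareZero _ _) hij z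

/-- A contravariant map composed with the identification of two equal degrees. -/
noncomputable def mapOfEq (f : θ ⟶ σ) {p i : ℤ} (h : p = i) :
    (S.obj (op σ)).X p →ₗ[k] (S.obj (op θ)).X i :=
  h ▸ ((S.map f.op).f p).hom

open Classical in
/-- The augmentation `x ⊗ {v} ⊗ [w] ↦ ± w^*(v^*(x))` for `deg v = 0`. The sign is forced by the
equality of the signs of the two sums of the differential. -/
noncomputable def augX (θ : PrunedTree n) (i : ℤ) :
    KoszulX S (freeAt k θ) i →ₗ[k] (S.obj (op θ)).X i :=
  desc fun {_ f} F p _ => if hp : p = i then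
    (F.mid.degree : ℤ).negOnePow • mapOfEq S f hp else 0

lemma augX_gen {f : θ ⟶ σ} (F : Factorization f) {p : ℤ} (h : p + homDeg F.left = p)
    (x : (S.obj (op σ)).X p) :
    augX S θ p (gen S F p h x) = (F.mid.degree : ℤ).negOnePow • (S.map f.op).f p x := by
  rw [augX, desc_gen, dif_pos rfl]
  rfl

lemma augX_gen_of_ne {i : ℤ} {f : θ ⟶ σ} (F : Factorization f) {p : ℤ}
    (h : p + homDeg F.left = i) (hp : p ≠ i) (x : (S.obj (op σ)).X p) :
    augX S θ i (gen S F p h x) = 0 := by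
  rw [augX, desc_gen, dif_neg hp]
  rfl

lemma augX_critical {i : ℤ} (x : (S.obj (op θ)).X i) :
    augX S θ i (critical S x) = (θ.degree : ℤ).negOnePow • x := by
  rw [critical, augX_gen]
  have : (S.map (𝟙 θ : θ ⟶ θ).op) = 𝟙 _ := by rw [op_id, S.map_id]
  rw [this]
  rfl

lemma leftFactorization_unique {τ : PrunedTree n} {u : τ ⟶ σ} (hu : homDeg u = 1)
    (L : LeftFactorization u) : L = ⟨⟨τ, 𝟙 τ, u, Category.id_comp u⟩, hu⟩ := by
  obtain ⟨⟨m, w, v, rfl⟩, hv⟩ := L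
  dsimp only at hv
  obtain ⟨e, hw⟩ := exists_eqToHom_of_homDeg (u := w) (by rw [homDeg_comp] at hu; omega)
  subst e
  rw [eqToHom_refl] at hw
  subst hw
  simp

lemma rightFactorization_unique {τ : PrunedTree n} {u : τ ⟶ σ} (hu : homDeg u = 1)
    (R : RightFactorization u) : R = ⟨⟨σ, u, 𝟙 σ, Category.comp_id u⟩, hu⟩ := by
  obtain ⟨⟨m, w, v, rfl⟩, hv⟩ := R
  dsimp only at hv
  obtain ⟨e, hw⟩ := exists_eqToHom_of_homDeg (u := v) (by rw [homDeg_comp] at hu; omega)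
  subst e
  rw [eqToHom_refl] at hw
  subst hw
  simp

lemma homDeg_drop_left {f : θ ⟶ σ} {F : Factorization f} (L : LeftFactorization F.left) :
    homDeg (F.drop L.1).left = homDeg F.left - 1 := by
  have h := L.1.homDeg_eq
  rw [L.2] at h
  change homDeg L.1.right = _
  omega

lemma homDeg_push_left {f : θ ⟶ σ} {F : Factorization f} (R : RightFactorization F.left) :
    homDeg (F.push R.1).left = homDeg F.left - 1 := by
  have h := R.1.homDeg_eq
  rw [R.2] at h
  change homDeg R.1.left = _
  omega

/-- The only case beyond the internal differential is deg v = 1. Both sums then have a single term,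
with the same sign and the same pullback of x. The middle trees have degrees that differ by one, so
the sign of the augmentation makes the terms cancel. -/
lemma augX_comm {i j : ℤ} (hij : j + 1 = i) (z : KoszulX S (freeAt k θ) i) :
    (S.obj (op θ)).d i j (augX S θ i z) = augX S θ j (koszulD S (freeAt k θ) hij z) := by
  refine LinearMap.congr_fun (f := ((S.obj (op θ)).d i j).hom ∘ₗ augX S θ i)
    (g := augX S θ j ∘ₗ koszulD S (freeAt k θ) hij) (koszulX_ext fun {σ f} F p h x => ?_) z
  change (S.obj (op θ)).d i j (augX S θ i (gen S F p h x)) =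
    augX S θ j (koszulD S (freeAt k θ) hij (gen S F p h x))
  rw [koszulD_gen, map_add, map_add, map_sum, map_sum]
  simp only [map_units_smul]
  by_cases hp : p = i
  · subst hp
    obtain rfl : j = p - 1 := by omega
    rw [augX_gen, augX_gen, Finset.sum_eq_zero, Finset.sum_eq_zero, add_zero, add_zero]
    · change ((S.obj (op θ)).d p (p - 1)).hom (_ • _) = _
      rw [map_units_smul]
      congr 1
      exact f_d_apply _ _ _ _
    · intro R _
      rw [augX_gen_of_ne S _ _ (by omega), smul_zero]
    · intro L _
      rw [augX_gen_of_ne S _ _ (by omega), smul_zero]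
  · rw [augX_gen_of_ne S F h hp, augX_gen_of_ne S _ _ (by omega), map_zero, zero_add]
    by_cases hp' : p = j
    · subst hp'
      have hu : homDeg F.left = 1 := by omega
      rw [Finset.sum_eq_single (⟨⟨F.mid, 𝟙 _, F.left, Category.id_comp _⟩, hu⟩ :
          LeftFactorization F.left) (fun L _ hL => absurd (leftFactorization_unique hu L) hL)
          (fun h => absurd (Finset.mem_univ _) h),
        Finset.sum_eq_single (⟨⟨σ, F.left, 𝟙 σ, Category.comp_id _⟩, hu⟩ :
          RightFactorization F.left) (fun L _ hL => absurd (rightFactorization_unique hu L) hL)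
          (fun h => absurd (Finset.mem_univ _) h), augX_gen, augX_gen, smul_smul, smul_smul]
      dsimp only [Factorization.drop, Factorization.push]
      have h1 : (F.mid.degree : ℤ) = σ.degree + 1 := by
        unfold homDeg at hu
        omega
      have h2 : (S.map (F.right ≫ 𝟙 F.mid).op).f p ((S.map F.left.op).f p x) =
          (S.map f.op).f p x := by
        rw [← diagram_map_comp, ← op_comp, Category.comp_id, F.fac]
      rw [h2, h1, Int.negOnePow_succ, homDeg_id, add_zero, mul_neg, Units.neg_smul]
      exact (neg_add_cancel _).symm
    · rw [Finset.sum_eq_zero, Finset.sum_eq_zero, add_zero]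
      · intro R _
        rw [augX_gen_of_ne S _ _ hp', smul_zero]
      · intro L _
        rw [augX_gen_of_ne S _ _ hp', smul_zero]

/-- The augmentation of the resolution. -/
noncomputable def augmentation : resolution S ⟶ S where
  app θ :=
    { f := fun i => ModuleCat.ofHom (augX S θ.unop i)
      comm' := fun i j hij => by
        ext z
        exact (augX_comm S hij z).trans
          (congrArg (augX S θ.unop j) (resolution_d S θ hij z).symm) }
  naturality θ θ' a := by
    ext i : 2
    refine koszulX_ext fun {σ f} F p h x => ?_
    change augX S θ'.unop i (koszulXMap (𝟙 S) (freeMap a.unop) i (gen S F p h x)) =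
      (S.map a).f i (augX S θ.unop i (gen S F p h x))
    rw [koszulXMap_gen]
    by_cases hp : p = i
    · subst hp
      rw [augX_gen, augX_gen]
      change _ = ((S.map a).f p).hom (_ • _)
      rw [map_units_smul, op_comp, diagram_map_comp]
      rfl
    · rw [augX_gen_of_ne S F h hp, augX_gen_of_ne S _ _ hp, map_zero]

lemma augmentation_naturality {S S' : ContraDiagram k n} (f : S ⟶ S') :
    resolutionMap f ≫ augmentation S' = augmentation S ≫ f := by
  ext θ i : 4
  refine koszulX_ext fun {σ g} F p h x => ?_
  change augX S' θ.unop i (koszulXMap f (𝟙 _) i (gen S F p h x)) =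
    (f.app θ).f i (augX S θ.unop i (gen S F p h x))
  rw [koszulXMap_id_gen]
  by_cases hp : p = i
  · subst hp
    rw [augX_gen, augX_gen]
    change _ = ((f.app θ).f p).hom (_ • _)
    rw [map_units_smul]
    congr 1
    exact (nat_apply f g.op p x).symm
  · rw [augX_gen_of_ne S F h hp, augX_gen_of_ne S' F h hp, map_zero]

/-- The augmentation of the resolution is an objectwise acyclic fibration. -/
theorem isAcyclicFibration_augmentation (θ : (PrunedTree n)ᵒᵖ) :
    IsAcyclicFibration ((augmentation S).app θ) := by
  have hsq : ∀ (θ : PrunedTree n) {i : ℤ} (x : (S.obj (op θ)).X i),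
      augX S θ i ((θ.degree : ℤ).negOnePow • critical S x) = x := fun θ i x => by
    rw [map_units_smul, augX_critical, smul_smul, Int.units_mul_self, one_smul]
  obtain ⟨θ⟩ := θ
  refine ⟨fun i x => ⟨(θ.degree : ℤ).negOnePow • critical S x, hsq θ x⟩, ?_⟩
  rw [quasiIso_iff_elements]
  intro i j l hij hli
  refine ⟨fun z hz y hy => ?_, fun x hx => ?_⟩
  -- Modulo boundaries the cycle is critical, and on critical elements the augmentation is the
  -- identity up to sign.
  · change KoszulX S (freeAt k θ) i at z
    rw [resolution_d S _ hij] at hz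
    obtain ⟨x, w, hw⟩ := exists_critical S hli hij z hz
    change (S.obj (op θ)).d l i y = augX S θ i z at hy
    rw [hw, map_add, augX_critical, ← augX_comm, ← sub_eq_iff_eq_add, ← map_sub] at hy
    refine ⟨(θ.degree : ℤ).negOnePow • critical S (y - augX S θ l w) + w, ?_⟩
    refine (resolution_d S _ hli _).trans ?_
    rw [map_add, map_units_smul, koszulD_critical, hy, ← map_units_smul, smul_smul,
      Int.units_mul_self, one_smul]
    exact hw.symm
  · refine ⟨(θ.degree : ℤ).negOnePow • critical S x, 0, ?_, ?_⟩
    · refine (resolution_d S _ hij _).trans ?_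
      rw [map_units_smul, koszulD_critical, hx, map_zero, smul_zero]
      rfl
    · rw [map_zero, add_zero]
      exact (hsq θ x).symm

end Augmentation

/-! ### Cofibrancy of the resolution -/

section Cofibrant

open PrunedTree

/-- Dependent recursion along a measure: values can be chosen one after the other such that a
property holds which depends only on the current value and on the values of smaller measure. -/
lemma exists_forall_of_step {α : Type*} {β : α → Type*} [∀ a, Inhabited (β a)] (d : α → ℕ)
    (P : (∀ a, β a) → α → Prop)
    (hcongr : ∀ g g' a, (∀ b, d b < d a → g b = g' b) → g a = g' a → P g a → P g' a)
    (step : ∀ g a, (∀ b, d b < d a → P g b) →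
      ∃ g', (∀ b, d b < d a → g b = g' b) ∧ P g' a) : ∃ g, ∀ a, P g a := by
  classical
  have step' : ∀ g a, ∃ g', (∀ b, d b < d a → P g b) →
      (∀ b, d b < d a → g b = g' b) ∧ P g' a := fun g a => by
    by_cases h : ∀ b, d b < d a → P g b
    · obtain ⟨g', hg'⟩ := step g a h
      exact ⟨g', fun _ => hg'⟩
    · exact ⟨g, fun h' => absurd h' h⟩
  choose V hV using step'
  -- Values not chosen yet are filled in by a default. By `hcongr`, they do not affect the property
  -- at elements of smaller measure.
  let T : ∀ a, (∀ b, d b < d a → β b) → ∀ b, β b := fun a rec b =>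
    if h : d b < d a then rec b h else default
  let G : ∀ a, β a := (measure d).wf.fix fun a rec => V (T a rec) a a
  have hG : ∀ a, G a = V (T a fun b _ => G b) a a := fun a => (measure d).wf.fix_eq _ a
  have hT : ∀ a b, d b < d a → T a (fun b _ => G b) b = G b := fun a b h => dif_pos h
  refine ⟨G, fun a => ?_⟩
  induction hN : d a using Nat.strong_induction_on generalizing a with
  | _ N ih =>
  subst hN
  obtain ⟨h1, h2⟩ := hV (T a fun b _ => G b) a fun b hb =>
    hcongr G _ b (fun c hc => (hT a c (hc.trans hb)).symm) (hT a b hb).symm (ih _ hb b rfl)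
  exact hcongr _ G a (fun b hb => by rw [← h1 b hb, hT a b hb]) (hG a).symm h2

variable {k : Type u} [CommRing k] {n : ℕ}

/-- Morphisms of pruned trees with arbitrary source and target. -/
structure TreeHom (n : ℕ) where
  src : PrunedTree n
  tgt : PrunedTree n
  hom : src ⟶ tgt

/-- The factorization of a morphism through its source. -/
def sourceFactorization {τ σ : PrunedTree n} (u : τ ⟶ σ) : Factorization u :=
  ⟨τ, 𝟙 τ, u, Category.id_comp u⟩

lemma add_homDeg_source {τ σ : PrunedTree n} {u : τ ⟶ σ} {i j : ℤ} (h : i + homDeg u = j) :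
    i + homDeg (sourceFactorization u).left = j := h

/-- Every generator is the pullback along `w` of the one with `[id]`. A morphism out of the
resolution is therefore given by its values on the latter. -/
lemma koszulXMap_source (S : ContraDiagram k n) {θ σ : PrunedTree n} {i : ℤ} {f : θ ⟶ σ}
    (F : Factorization f) (p : ℤ) (h : p + homDeg F.left = i) (x : (S.obj (op σ)).X p) :
    koszulXMap (𝟙 S) (freeMap F.right) i
      (gen S (sourceFactorization F.left) p (add_homDeg_source h) x) = gen S F p h x := by
  rw [koszulXMap_gen]
  exact congrArg (fun r' => koszulIncl S (freeAt k θ) F.left p 0 (by rw [add_zero]; exact h)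
    (x ⊗ₜ freeGen r')) (Category.comp_id F.right)

variable (S : ContraDiagram k n)

/-- The span of the elements that belong to morphisms of degree less than `m`. -/
noncomputable def lowSpan (θ : PrunedTree n) (i m : ℤ) :
    Submodule k (KoszulX S (freeAt k θ) i) :=
  Submodule.span k {z | ∃ (σ : PrunedTree n) (f : θ ⟶ σ) (F : Factorization f) (p : ℤ)
    (h : p + homDeg F.left = i) (x : (S.obj (op σ)).X p),
      homDeg F.left < m ∧ gen S F p h x = z}

/-- The part of the differential of `x ⊗ {u} ⊗ [id]` that lowers the degree of `u`. -/
noncomputable def rest {τ σ : PrunedTree n} (u : τ ⟶ σ) {i j : ℤ} (h : i + homDeg u = j + 1) :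
    (S.obj (op σ)).X i →ₗ[k] KoszulX S (freeAt k τ) j :=
  koszulD S (freeAt k τ) rfl ∘ₗ gen S (sourceFactorization u) i (add_homDeg_source h) -
    gen S (sourceFactorization u) (i - 1) (add_homDeg_source (by omega)) ∘ₗ
      ((S.obj (op σ)).d i (i - 1)).hom

lemma koszulD_source {τ σ : PrunedTree n} (u : τ ⟶ σ) {i j : ℤ} (h : i + homDeg u = j + 1)
    (x : (S.obj (op σ)).X i) :
    koszulD S (freeAt k τ) rfl (gen S (sourceFactorization u) i (add_homDeg_source h) x) =
      gen S (sourceFactorization u) (i - 1) (add_homDeg_source (by omega))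
        ((S.obj (op σ)).d i (i - 1) x) + rest S u h x :=
  (add_sub_cancel _ _).symm

/-- Both sums of the differential remove a factor of degree one from `u`. This is the triangularity
on which the inductive choice of a lift rests. -/
lemma rest_mem {τ σ : PrunedTree n} (u : τ ⟶ σ) {i j : ℤ} (h : i + homDeg u = j + 1)
    (x : (S.obj (op σ)).X i) : rest S u h x ∈ lowSpan S τ j (homDeg u) := by
  have h1 := koszulD_gen S (rfl : j + 1 = j + 1) (sourceFactorization u) i
    (add_homDeg_source h) x
  rw [koszulD_source S u h, add_assoc] at h1
  rw [add_left_cancel h1]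
  refine add_mem (sum_mem fun L _ => units_smul_mem _ _ ?_) (sum_mem fun R _ =>
    units_smul_mem _ _ ?_)
  · refine Submodule.subset_span ⟨_, _, _, _, _, _, ?_, rfl⟩
    rw [homDeg_drop_left]
    exact Int.sub_lt_self _ one_pos
  · refine Submodule.subset_span ⟨_, _, _, _, _, _, ?_, rfl⟩
    rw [homDeg_push_left]
    exact Int.sub_lt_self _ one_pos

variable {S} (X : ContraDiagram k n)

/-- Families of maps from which maps out of the resolution are built. -/
abbrev LiftFamily (S X : ContraDiagram k n) (a : TreeHom n) : Type u :=
  ∀ i j : ℤ, i + homDeg a.hom = j → (S.obj (op a.tgt)).X i →ₗ[k] (X.obj (op a.src)).X j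

noncomputable instance (a : TreeHom n) : Inhabited (LiftFamily S X a) := ⟨fun _ _ _ => 0⟩

variable {X}

/-- The extension `x ⊗ {u} ⊗ [w] ↦ w^*(g_u(x))`. -/
noncomputable def extend (g : ∀ a, LiftFamily S X a) (θ : PrunedTree n) (i : ℤ) :
    KoszulX S (freeAt k θ) i →ₗ[k] (X.obj (op θ)).X i :=
  desc fun F p h => ((X.map F.right.op).f i).hom ∘ₗ g ⟨F.mid, _, F.left⟩ p i h

lemma extend_gen (g : ∀ a, LiftFamily S X a) {θ σ : PrunedTree n} {i : ℤ} {f : θ ⟶ σ}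
    (F : Factorization f) (p : ℤ) (h : p + homDeg F.left = i) (x : (S.obj (op σ)).X p) :
    extend g θ i (gen S F p h x) =
      (X.map F.right.op).f i (g ⟨F.mid, _, F.left⟩ p i h x) := by
  rw [extend, desc_gen]
  rfl

lemma extend_source (g : ∀ a, LiftFamily S X a) {τ σ : PrunedTree n} (u : τ ⟶ σ) {i j : ℤ}
    (h : i + homDeg u = j) (x : (S.obj (op σ)).X i) :
    extend g τ j (gen S (sourceFactorization u) i (add_homDeg_source h) x) =
      g ⟨τ, σ, u⟩ i j h x := by
  rw [extend_gen]
  have : X.map (𝟙 τ : τ ⟶ τ).op = 𝟙 _ := by rw [op_id, X.map_id]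
  change (X.map (𝟙 τ : τ ⟶ τ).op).f j _ = _
  rw [this]
  rfl

lemma extend_map (g : ∀ a, LiftFamily S X a) {θ θ' : PrunedTree n} (a : θ' ⟶ θ) (i : ℤ)
    (z : KoszulX S (freeAt k θ) i) :
    extend g θ' i (koszulXMap (𝟙 S) (freeMap a) i z) = (X.map a.op).f i (extend g θ i z) := by
  refine LinearMap.congr_fun (f := extend g θ' i ∘ₗ koszulXMap (𝟙 S) (freeMap a) i)
    (g := ((X.map a.op).f i).hom ∘ₗ extend g θ i) (koszulX_ext fun {σ f} F p h x => ?_) z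
  change extend g θ' i (koszulXMap (𝟙 S) (freeMap a) i (gen S F p h x)) =
    (X.map a.op).f i (extend g θ i (gen S F p h x))
  rw [koszulXMap_gen, extend_gen, extend_gen]
  exact diagram_map_comp X F.right.op a.op i (g ⟨F.mid, _, F.left⟩ p i h x)

lemma extend_congr {g g' : ∀ a, LiftFamily S X a} {m : ℤ}
    (h : ∀ a : TreeHom n, homDeg a.hom < m → g a = g' a) {θ : PrunedTree n} {i : ℤ}
    {z : KoszulX S (freeAt k θ) i} (hz : z ∈ lowSpan S θ i m) :
    extend g θ i z = extend g' θ i z := by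
  refine LinearMap.eqOn_span (f := extend g θ i) (g := extend g' θ i) ?_ hz
  rintro _ ⟨σ, f, F, p, h', x, hF, rfl⟩
  rw [extend_gen, extend_gen, h ⟨F.mid, _, F.left⟩ hF]

/-! ### Lifting morphisms out of the resolution -/

section Lifting

variable {Y : ContraDiagram k n} (p : X ⟶ Y) (f : resolution S ⟶ Y)

/-- The components of a morphism from the resolution. -/
noncomputable def component (θ : PrunedTree n) (i : ℤ) :
    KoszulX S (freeAt k θ) i →ₗ[k] (Y.obj (op θ)).X i := ((f.app (op θ)).f i).hom

lemma component_d (θ : PrunedTree n) {i j : ℤ} (hij : j + 1 = i)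
    (z : KoszulX S (freeAt k θ) i) : (Y.obj (op θ)).d i j (component f θ i z) =
      component f θ j (koszulD S (freeAt k θ) hij z) :=
  (f_d_apply (f.app (op θ)) i j z).trans
    (congrArg (component f θ j) (resolution_d S (op θ) hij z))

lemma component_map {θ θ' : PrunedTree n} (a : θ' ⟶ θ) (i : ℤ) (z : KoszulX S (freeAt k θ) i) :
    component f θ' i (koszulXMap (𝟙 S) (freeMap a) i z) =
      (Y.map a.op).f i (component f θ i z) :=
  nat_apply f a.op i z

/-- The family `g` is correct at `a`: it lifts `f`, and it is compatible with the differential. -/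
def IsLiftAt (g : ∀ a, LiftFamily S X a) (a : TreeHom n) : Prop :=
  (∀ (i j : ℤ) (h : i + homDeg a.hom = j) (x : (S.obj (op a.tgt)).X i),
    (p.app (op a.src)).f j (g a i j h x) =
      component f a.src j (gen S (sourceFactorization a.hom) i (add_homDeg_source h) x)) ∧
  ∀ (i j : ℤ) (h : i + homDeg a.hom = j + 1) (x : (S.obj (op a.tgt)).X i),
    (X.obj (op a.src)).d (j + 1) j (g a i (j + 1) h x) =
      g a (i - 1) j (by omega) ((S.obj (op a.tgt)).d i (i - 1) x) +
        extend g a.src j (rest S a.hom h x)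

variable {p f} {g : ∀ a, LiftFamily S X a}

lemma extend_lifts_gen {θ σ : PrunedTree n} {e : θ ⟶ σ} (F : Factorization e)
    (hg : IsLiftAt p f g ⟨F.mid, σ, F.left⟩) {i : ℤ} (q : ℤ) (h : q + homDeg F.left = i)
    (x : (S.obj (op σ)).X q) : (p.app (op θ)).f i (extend g θ i (gen S F q h x)) =
      component f θ i (gen S F q h x) := by
  rw [extend_gen, nat_apply, hg.1, ← component_map, koszulXMap_source]

lemma koszulD_map {θ θ' : PrunedTree n} (a : θ' ⟶ θ) {i j : ℤ} (hij : j + 1 = i)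
    (z : KoszulX S (freeAt k θ) i) :
    koszulD S (freeAt k θ') hij (koszulXMap (𝟙 S) (freeMap a) i z) =
      koszulXMap (𝟙 S) (freeMap a) j (koszulD S (freeAt k θ) hij z) :=
  LinearMap.congr_fun (koszulXMap_comm _ _ hij) z

/-- Naturality in the tree reduces the claim to the generator with `[id]`, where it is the condition
imposed on the family. -/
lemma extend_d_gen {θ σ : PrunedTree n} {e : θ ⟶ σ} (F : Factorization e)
    (hg : IsLiftAt p f g ⟨F.mid, σ, F.left⟩) {i j : ℤ} (hij : j + 1 = i) (q : ℤ)
    (h : q + homDeg F.left = i) (x : (S.obj (op σ)).X q) :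
    (X.obj (op θ)).d i j (extend g θ i (gen S F q h x)) =
      extend g θ j (koszulD S (freeAt k θ) hij (gen S F q h x)) := by
  subst hij
  have e1 : extend g F.mid j (koszulD S (freeAt k F.mid) (rfl : j + 1 = j + 1)
      (gen S (sourceFactorization F.left) q (add_homDeg_source h) x)) =
      g ⟨F.mid, σ, F.left⟩ (q - 1) j (show q - 1 + homDeg F.left = j by omega)
        ((S.obj (op σ)).d q (q - 1) x) + extend g F.mid j (rest S F.left h x) := by
    rw [koszulD_source S F.left h, map_add, extend_source]
  rw [← koszulXMap_source S F q h, koszulD_map, extend_map, extend_map, f_d_apply, extend_source g F.left h, e1]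
  exact congrArg _ (hg.2 q j h x)

lemma extend_lifts_low {m : ℤ} (hg : ∀ a : TreeHom n, homDeg a.hom < m → IsLiftAt p f g a)
    {θ : PrunedTree n} {i : ℤ} {z : KoszulX S (freeAt k θ) i} (hz : z ∈ lowSpan S θ i m) :
    (p.app (op θ)).f i (extend g θ i z) = component f θ i z := by
  refine LinearMap.eqOn_span (f := ((p.app (op θ)).f i).hom ∘ₗ extend g θ i)
    (g := component f θ i) ?_ hz
  rintro _ ⟨σ, e, F, q, h, x, hF, rfl⟩
  exact extend_lifts_gen F (hg ⟨F.mid, σ, F.left⟩ hF) q h x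

lemma extend_d_low {m : ℤ} (hg : ∀ a : TreeHom n, homDeg a.hom < m → IsLiftAt p f g a)
    {θ : PrunedTree n} {i j : ℤ} (hij : j + 1 = i) {z : KoszulX S (freeAt k θ) i}
    (hz : z ∈ lowSpan S θ i m) : (X.obj (op θ)).d i j (extend g θ i z) =
      extend g θ j (koszulD S (freeAt k θ) hij z) := by
  refine LinearMap.eqOn_span (f := ((X.obj (op θ)).d i j).hom ∘ₗ extend g θ i)
    (g := extend g θ j ∘ₗ koszulD S (freeAt k θ) hij) ?_ hz
  rintro _ ⟨σ, e, F, q, h, x, hF, rfl⟩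
  exact extend_d_gen F (hg ⟨F.mid, σ, F.left⟩ hF) hij q h x

/-- This is d² = 0 applied to x ⊗ {u} ⊗ [id]. It supplies the condition on the error term in the
twisted lifting. -/
lemma rest_d {τ σ : PrunedTree n} (u : τ ⟶ σ) {i j : ℤ} (h : i + homDeg u = j + 1 + 1)
    (x : (S.obj (op σ)).X i) : koszulD S (freeAt k τ) rfl (rest S u h x) =
      -rest S u (j := j) (by omega) ((S.obj (op σ)).d i (i - 1) x) := by
  have h1 := koszulD_source S u h x
  have h2 := koszulD_source S u (j := j) (by omega : i - 1 + homDeg u = j + 1)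
    ((S.obj (op σ)).d i (i - 1) x)
  rw [dgMod_d_d, map_zero, zero_add] at h2
  have h3 := congrArg (koszulD S (freeAt k τ) (rfl : j + 1 = j + 1)) h1
  have h4 : koszulD S (freeAt k τ) (rfl : j + 1 = j + 1) (koszulD S (freeAt k τ)
      (rfl : j + 1 + 1 = j + 1 + 1) (gen S (sourceFactorization u) i
        (add_homDeg_source h) x)) = 0 :=
    LinearMap.congr_fun (koszulSquareZero S (freeAt k τ) rfl rfl) _
  rw [h4, map_add, h2] at h3
  exact (neg_eq_of_add_eq_zero_right h3.symm).symm

end Lifting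

/-- The resolution of a dg-cofibrant diagram is cofibrant. -/
theorem isCofibrantDiagram_resolution (hS : IsDGCofibrant S) :
    IsCofibrantDiagram (resolution S) := by
  classical
  intro X Y p hp f
  suffices h : ∃ g : ∀ a, LiftFamily S X a, ∀ a, IsLiftAt p f g a by
    obtain ⟨g, hg⟩ := h
    refine ⟨⟨fun θ => ⟨fun i => ModuleCat.ofHom (extend g θ.unop i), ?_⟩, ?_⟩, ?_⟩
    · intro i j hij
      refine ModuleCat.hom_ext (koszulX_ext fun {σ e} F q h x => ?_)
      exact (extend_d_gen F (hg _) hij q h x).trans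
        (congrArg (extend g θ.unop j) (resolution_d S θ hij _).symm)
    · intro θ θ' a
      ext i : 2
      exact LinearMap.ext fun z => extend_map g a.unop i z
    · ext θ i : 4
      exact koszulX_ext fun {σ e} F q h x => extend_lifts_gen F (hg _) q h x
  -- Other members of the family enter the condition at `u` only through `rest`, hence only with
  -- smaller degree.
  refine exists_forall_of_step (β := LiftFamily S X) (fun a => (homDeg a.hom).toNat)
    (IsLiftAt p f) ?_ ?_
  · rintro g g' a hlow ha ⟨h1, h2⟩
    refine ⟨by rw [← ha]; exact h1, fun i j h x => ?_⟩
    rw [← ha, h2]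
    congr 1
    refine extend_congr (fun b hb => hlow b ?_) (rest_mem S a.hom h x)
    have := homDeg_nonneg b.hom
    omega
  · intro g a hlow
    have hlow' : ∀ b : TreeHom n, homDeg b.hom < homDeg a.hom → IsLiftAt p f g b := fun b hb =>
      hlow b (by have := homDeg_nonneg b.hom; omega)
    suffices h : ∃ v : LiftFamily S X a, (∀ i j h x, (p.app (op a.src)).f j (v i j h x) =
        component f a.src j (gen S (sourceFactorization a.hom) i (add_homDeg_source h) x)) ∧
        ∀ (i i' j j' : ℤ) (hi : i' + 1 = i) (hj : j' + 1 = j) (h : i + homDeg a.hom = j)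
          (x : (S.obj (op a.tgt)).X i), (X.obj (op a.src)).d j j' (v i j h x) =
            v i' j' (by omega) ((S.obj (op a.tgt)).d i i' x) +
              extend g a.src j' (rest S a.hom (by omega) x) by
      obtain ⟨v, hv1, hv2⟩ := h
      have hne : ∀ b : TreeHom n, homDeg b.hom < homDeg a.hom →
          g b = Function.update g a v b := fun b hb => by
        rw [Function.update_of_ne]
        rintro rfl
        exact lt_irrefl _ hb
      refine ⟨Function.update g a v, fun b hb => hne b ?_, fun i j h x => ?_, fun i j h x => ?_⟩
      · have := homDeg_nonneg b.hom
        omega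
      · rw [Function.update_self]
        exact hv1 i j h x
      · rw [Function.update_self, hv2 i (i - 1) (j + 1) j (by omega) rfl h x,
          ← extend_congr hne (rest_mem S a.hom h x)]
    -- The value at `u` is a map of degree deg u out of the cofibrant dg-module S(σ). Its failure to
    -- be a chain map is the contribution of `rest`, which is already fixed.
    refine (hS (op a.tgt)).exists_twisted_lift (p.app (op a.src))
      (hp (op a.src)) (homDeg a.hom)
      (fun i j h => component f a.src j ∘ₗ
        gen S (sourceFactorization a.hom) i (add_homDeg_source h))
      (fun i j h => extend g a.src j ∘ₗ rest S a.hom h) ?_ ?_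
    · intro i i' j j' hi hj h x
      obtain rfl : i' = i - 1 := by omega
      subst hj
      change (Y.obj (op a.src)).d (j' + 1) j' (component f a.src (j' + 1) _) =
        component f a.src j' _ + (p.app (op a.src)).f j' (extend g a.src j' (rest S a.hom h x))
      rw [component_d f a.src rfl, extend_lifts_low hlow' (rest_mem S a.hom h x), ← map_add]
      exact congrArg _ (koszulD_source S a.hom h x)
    · intro i i' j j' hi hj h x
      obtain rfl : i' = i - 1 := by omega
      subst hj
      change (X.obj (op a.src)).d (j' + 1) j' (extend g a.src (j' + 1) (rest S a.hom h x)) =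
        -extend g a.src j' (rest S a.hom _ _)
      rw [extend_d_low hlow' rfl (rest_mem S a.hom h x), rest_d, map_neg]

end Cofibrant

/-! ### Homotopies and tensor products of diagrams -/

section TensorHomotopy

variable {k : Type u} [CommRing k] {n : ℕ} {Q Q' Q'' X Y : ContraDiagram k n}
  {T T' T'' : CovDiagram k n}

lemma tensorOver_d (Q : ContraDiagram k n) (T : CovDiagram k n) {i j : ℤ} (hij : j + 1 = i)
    (z : PreTensor Q T i) : (tensorOver Q T).d i j ((coendRel Q T i).mkQ z) =
      (coendRel Q T j).mkQ (preTensorD Q T hij z) := by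
  have : (tensorOver Q T).d i j = ModuleCat.ofHom (tensorD Q T hij) := dif_pos hij
  rw [this]
  rfl

lemma preTensor_ext {M : Type*} [AddCommGroup M] [Module k M] {i : ℤ}
    {f g : PreTensor Q T i →ₗ[k] M}
    (h : ∀ (τ : PrunedTree n) (p q : ℤ) (e : p + q = i) (x : (Q.obj (op τ)).X p)
      (y : (T.obj τ).X q), f (preTensorIncl Q T τ p q e (x ⊗ₜ y)) =
        g (preTensorIncl Q T τ p q e (x ⊗ₜ y))) : f = g :=
  DirectSum.linearMap_ext _ fun a => TensorProduct.ext' fun x y =>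
    h a.obj a.p a.q a.deg_eq x y

lemma tensorOverMap_comp (f : Q ⟶ Q') (f' : Q' ⟶ Q'') (g : T ⟶ T') (g' : T' ⟶ T'') :
    tensorOverMap (f ≫ f') (g ≫ g') = tensorOverMap f g ≫ tensorOverMap f' g' := by
  ext i : 1
  refine ModuleCat.hom_ext (Submodule.linearMap_qext _ (preTensor_ext fun τ p q e x y => ?_))
  change (coendRel Q'' T'' i).mkQ (preTensorMap (f ≫ f') (g ≫ g') i _) =
    (coendRel Q'' T'' i).mkQ (preTensorMap f' g' i (preTensorMap f g i _))
  rw [preTensorMap_incl, preTensorMap_incl, preTensorMap_incl]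
  rfl

lemma tensorOverMap_id : tensorOverMap (𝟙 Q) (𝟙 T) = 𝟙 (tensorOver Q T) := by
  ext i : 1
  refine ModuleCat.hom_ext (Submodule.linearMap_qext _ (preTensor_ext fun τ p q e x y => ?_))
  change (coendRel Q T i).mkQ (preTensorMap (𝟙 Q) (𝟙 T) i _) = (coendRel Q T i).mkQ _
  rw [preTensorMap_incl]
  rfl

lemma preTensorD_incl_of_eq {i j : ℤ} (hij : j + 1 = i) (τ : PrunedTree n) {p q p' q' : ℤ}
    (hp : p' + 1 = p) (hq : q' + 1 = q) (h : p + q = i) (x : (Q.obj (op τ)).X p)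
    (y : (T.obj τ).X q) : preTensorD Q T hij (preTensorIncl Q T τ p q h (x ⊗ₜ y)) =
      preTensorIncl Q T τ p' q (by omega) ((Q.obj (op τ)).d p p' x ⊗ₜ y)
      + p.negOnePow • preTensorIncl Q T τ p q' (by omega) (x ⊗ₜ (T.obj τ).d q q' y) := by
  obtain rfl : p' = p - 1 := by omega
  obtain rfl : q' = q - 1 := by omega
  exact preTensorD_incl Q T hij τ p q h x y

variable (h : ∀ (τ : PrunedTree n) (i l : ℤ), i + 1 = l →
  (Q.obj (op τ)).X i →ₗ[k] (X.obj (op τ)).X l)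

variable (T) in
/-- The map `x ⊗ y ↦ h(x) ⊗ y`. -/
noncomputable def preTensorHomotopy {i l : ℤ} (hil : i + 1 = l) :
    PreTensor Q T i →ₗ[k] PreTensor X T l :=
  DirectSum.toModule k (TensorIndex n i) (PreTensor X T l) fun a =>
    preTensorIncl X T a.obj (a.p + 1) a.q (by have := a.deg_eq; omega) ∘ₗ
      (h a.obj a.p (a.p + 1) rfl).rTensor _

lemma preTensorHomotopy_incl {i l : ℤ} (hil : i + 1 = l) (τ : PrunedTree n) {p p' q : ℤ}
    (hp : p + 1 = p') (e : p + q = i) (x : (Q.obj (op τ)).X p) (y : (T.obj τ).X q) :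
    preTensorHomotopy T h hil (preTensorIncl Q T τ p q e (x ⊗ₜ y)) =
      preTensorIncl X T τ p' q (by omega) (h τ p p' hp x ⊗ₜ y) := by
  subst hp
  rw [preTensorHomotopy, preTensorIncl, DirectSum.toModule_lof]
  rfl

/-- Two morphisms of diagrams that are naturally chain homotopic induce the same map on the
homology of the tensor product with a diagram. -/
lemma homologyMap_tensorOverMap_eq (g g' : Q ⟶ X)
    (hnat : ∀ {τ σ : PrunedTree n} (w : τ ⟶ σ) (i l : ℤ) (e : i + 1 = l) (x : (Q.obj (op σ)).X i),
      h τ i l e ((Q.map w.op).f i x) = (X.map w.op).f l (h σ i l e x))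
    (hd : ∀ (τ : PrunedTree n) (i j l : ℤ) (hij : j + 1 = i) (hil : i + 1 = l)
      (x : (Q.obj (op τ)).X i), (g.app (op τ)).f i x - (g'.app (op τ)).f i x =
        (X.obj (op τ)).d l i (h τ i l hil x) + h τ j i hij ((Q.obj (op τ)).d i j x)) (i : ℤ) :
    HomologicalComplex.homologyMap (tensorOverMap g (𝟙 T)) i =
      HomologicalComplex.homologyMap (tensorOverMap g' (𝟙 T)) i := by
  have hrel : ∀ {i l : ℤ} (hil : i + 1 = l),
      coendRel Q T i ≤ (coendRel X T l).comap (preTensorHomotopy T h hil) := by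
    intro i l hil
    refine Submodule.span_le.2 ?_
    rintro _ ⟨τ, σ, w, p, q, e, x, y, rfl⟩
    simp only [SetLike.mem_coe, Submodule.mem_comap, map_sub]
    rw [preTensorHomotopy_incl h hil τ rfl, preTensorHomotopy_incl h hil σ rfl, hnat]
    exact Submodule.subset_span ⟨τ, σ, w, p + 1, q, by omega, _, _, rfl⟩
  have key : ∀ {i j l : ℤ} (hij : j + 1 = i) (hil : i + 1 = l) (z : PreTensor Q T i),
      preTensorMap g (𝟙 T) i z - preTensorMap g' (𝟙 T) i z =
        preTensorD X T hil (preTensorHomotopy T h hil z) +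
          preTensorHomotopy T h hij (preTensorD Q T hij z) := by
    intro i j l hij hil z
    refine LinearMap.congr_fun (f := preTensorMap g (𝟙 T) i - preTensorMap g' (𝟙 T) i)
      (g := preTensorD X T hil ∘ₗ preTensorHomotopy T h hil +
        preTensorHomotopy T h hij ∘ₗ preTensorD Q T hij) (preTensor_ext fun τ p q e x y => ?_) z
    change preTensorMap g (𝟙 T) i (preTensorIncl Q T τ p q e (x ⊗ₜ y)) -
        preTensorMap g' (𝟙 T) i (preTensorIncl Q T τ p q e (x ⊗ₜ y)) =
      preTensorD X T hil (preTensorHomotopy T h hil (preTensorIncl Q T τ p q e (x ⊗ₜ y))) +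
        preTensorHomotopy T h hij (preTensorD Q T hij (preTensorIncl Q T τ p q e (x ⊗ₜ y)))
    rw [preTensorMap_incl, preTensorMap_incl, preTensorHomotopy_incl h hil τ rfl,
      preTensorD_incl_of_eq hil τ rfl (sub_add_cancel q 1),
      preTensorD_incl_of_eq hij τ (sub_add_cancel p 1) (sub_add_cancel q 1), map_add,
      map_units_smul, preTensorHomotopy_incl h hij τ (sub_add_cancel p 1),
      preTensorHomotopy_incl h hij τ rfl, ← map_sub, ← TensorProduct.sub_tmul,
      hd τ p (p - 1) (p + 1) (sub_add_cancel p 1) rfl, TensorProduct.add_tmul, map_add,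
      Int.negOnePow_succ, Units.neg_smul]
    -- The cross terms h(x) ⊗ dy cancel, because h raises the degree of x by one and so changes the
    -- sign.
    have e2 : ∀ a b c : PreTensor X T i, a + b = a + -c + (b + c) := fun a b c => by abel
    exact e2 _ _ _
  refine homologyMap_eq (sub_add_cancel i 1) rfl fun z hz => ?_
  obtain ⟨z, rfl⟩ := Submodule.mkQ_surjective _ z
  have hz' : (coendRel Q T (i - 1)).mkQ (preTensorD Q T (sub_add_cancel i 1) z) = 0 :=
    (tensorOver_d Q T (sub_add_cancel i 1) z).symm.trans hz
  rw [Submodule.mkQ_apply, Submodule.Quotient.mk_eq_zero] at hz'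
  have h0 : (coendRel X T i).mkQ (preTensorHomotopy T h (sub_add_cancel i 1)
      (preTensorD Q T (sub_add_cancel i 1) z)) = 0 :=
    (Submodule.Quotient.mk_eq_zero _).2 (hrel _ hz')
  refine ⟨(coendRel X T (i + 1)).mkQ (preTensorHomotopy T h rfl z), ?_⟩
  refine (tensorOver_d X T rfl _).trans ?_
  have := congrArg (coendRel X T i).mkQ (key (sub_add_cancel i 1) rfl z)
  rw [map_add, h0, add_zero, map_sub] at this
  exact this.symm

end TensorHomotopy

/-! ### Homotopy pullbacks of diagrams -/

section PathDiagram

variable {k : Type u} [CommRing k] {n : ℕ} {F G H : ContraDiagram k n}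

/-- The homotopy pullback of two morphisms of diagrams. -/
noncomputable def pathDiagram (p : F ⟶ H) (q : G ⟶ H) : ContraDiagram k n where
  obj j := path (p.app j) (q.app j)
  map w := pathMap (F.map w) (H.map w) (G.map w) (p.naturality w).symm (q.naturality w).symm
  map_id j := by
    ext i : 1
    refine ModuleCat.hom_ext (LinearMap.ext fun z => ?_)
    change ((H.map (𝟙 j)).f (i + 1) z.1, (F.map (𝟙 j)).f i z.2.1, (G.map (𝟙 j)).f i z.2.2) = z
    rw [F.map_id, G.map_id, H.map_id]
    rfl
  map_comp {a b c} w v := by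
    ext i : 1
    refine ModuleCat.hom_ext (LinearMap.ext fun z => ?_)
    change ((H.map (w ≫ v)).f (i + 1) z.1, (F.map (w ≫ v)).f i z.2.1,
      (G.map (w ≫ v)).f i z.2.2) = _
    rw [F.map_comp, G.map_comp, H.map_comp]
    rfl

/-- The first projection of the homotopy pullback of diagrams. -/
noncomputable def pathDiagramFst (p : F ⟶ H) (q : G ⟶ H) : pathDiagram p q ⟶ F where
  app j := pathFst (p.app j) (q.app j)

/-- The second projection of the homotopy pullback of diagrams. -/
noncomputable def pathDiagramSnd (p : F ⟶ H) (q : G ⟶ H) : pathDiagram p q ⟶ G where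
  app j := pathSnd (p.app j) (q.app j)

/-- The first coordinate of the homotopy pullback is a chain homotopy between the two composites,
natural in the tree. -/
lemma homologyMap_pathDiagram (p : F ⟶ H) (q : G ⟶ H) (T : CovDiagram k n) (i : ℤ) :
    HomologicalComplex.homologyMap (tensorOverMap (pathDiagramFst p q ≫ p) (𝟙 T)) i =
      HomologicalComplex.homologyMap (tensorOverMap (pathDiagramSnd p q ≫ q) (𝟙 T)) i := by
  refine homologyMap_tensorOverMap_eq (fun τ i l e => by
    subst e
    exact pathHomotopy (p.app (op τ)) (q.app (op τ)) i) _ _ ?_ ?_ i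
  · intro τ σ w i l e x
    subst e
    rfl
  · intro τ i j l hij hil x
    subst hij hil
    exact eq_add_of_sub_eq' (pathHomotopy_d (p.app (op τ)) (q.app (op τ)) j x).symm

lemma homologyMap_path {A B C : DGMod k} (p : A ⟶ B) (q : C ⟶ B) (i : ℤ) :
    HomologicalComplex.homologyMap (pathFst p q ≫ p) i =
      HomologicalComplex.homologyMap (pathSnd p q ≫ q) i := by
  obtain ⟨j, rfl⟩ : ∃ j, i = j + 1 := ⟨i - 1, by omega⟩
  refine homologyMap_eq rfl rfl fun z hz => ⟨pathHomotopy p q (j + 1) z, ?_⟩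
  have h := pathHomotopy_d p q j z
  rw [hz, map_zero] at h
  exact (sub_eq_zero.1 h.symm).symm

/-- Two morphisms from a cofibrant diagram that agree after an acyclic fibration induce the same
map on the homology of the tensor product with a diagram. -/
lemma IsCofibrantDiagram.homologyMap_eq {Q X Y : ContraDiagram k n} (hQ : IsCofibrantDiagram Q)
    (p : X ⟶ Y) (hp : ∀ j, IsAcyclicFibration (p.app j)) {g g' : Q ⟶ X} (h : g ≫ p = g' ≫ p)
    (T : CovDiagram k n) (i : ℤ) :
    HomologicalComplex.homologyMap (tensorOverMap g (𝟙 T)) i =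
      HomologicalComplex.homologyMap (tensorOverMap g' (𝟙 T)) i := by
  let Φ : pathDiagram (𝟙 X) (𝟙 X) ⟶ pathDiagram (𝟙 X ≫ p) (𝟙 X ≫ p) :=
    { app := fun j => pathMap (p := 𝟙 _) (q := 𝟙 _) (p' := 𝟙 _ ≫ p.app j) (q' := 𝟙 _ ≫ p.app j)
        (𝟙 _) (p.app j) (𝟙 _) (Category.id_comp _).symm (Category.id_comp _).symm
      naturality := fun j j' w => by
        ext i : 1
        refine ModuleCat.hom_ext (LinearMap.ext fun z => ?_)
        exact Prod.ext (nat_apply p w _ _) rfl }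
  -- After composition with `p` the two morphisms agree, so the zero homotopy relates them. Lifting
  -- it along `Φ` gives a homotopy between `g` and `g'`.
  let F : Q ⟶ pathDiagram (𝟙 X ≫ p) (𝟙 X ≫ p) :=
    { app := fun j => pathLift _ _ (g.app j) (g'.app j) (fun _ => 0) fun i x => by
        have h1 : (p.app j).f (i + 1) ((g.app j).f (i + 1) x) =
            (p.app j).f (i + 1) ((g'.app j).f (i + 1) x) :=
          congrArg (fun e : Q ⟶ Y => (e.app j).f (i + 1) x) h
        rw [LinearMap.zero_apply, LinearMap.zero_apply, map_zero, add_zero]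
        exact sub_eq_zero.2 h1
      naturality := fun j j' w => by
        ext i : 1
        refine ModuleCat.hom_ext (LinearMap.ext fun z => ?_)
        exact Prod.ext (map_zero ((Y.map w).f (i + 1)).hom).symm
          (Prod.ext (nat_apply g w _ _) (nat_apply g' w _ _)) }
  obtain ⟨L, hL⟩ := hQ Φ (fun j => isAcyclicFibration_pathMap _ _ (p.app j) (hp j)) F
  have h1 : g = L ≫ pathDiagramFst (𝟙 X) (𝟙 X) ≫ 𝟙 X := by
    ext j i x
    exact (congrArg (fun e : Q ⟶ _ => (pathFst _ _).f i ((e.app j).f i x)) hL).symm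
  have h2 : g' = L ≫ pathDiagramSnd (𝟙 X) (𝟙 X) ≫ 𝟙 X := by
    ext j i x
    exact (congrArg (fun e : Q ⟶ _ => (pathSnd _ _).f i ((e.app j).f i x)) hL).symm
  rw [h1, h2, ← Category.comp_id (𝟙 T), tensorOverMap_comp, tensorOverMap_comp,
    HomologicalComplex.homologyMap_comp, HomologicalComplex.homologyMap_comp,
    homologyMap_pathDiagram]

/-- The projection of the homotopy pullback of `l` and the identity is an acyclic fibration, hence
has a section since `P` is cofibrant. The other projection then gives `s`, and the pullback carries
a homotopy from the composite of `s` and `l` to the identity. -/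
lemma IsCofibrantDiagram.exists_section {P Q : ContraDiagram k n} (hP : IsCofibrantDiagram P)
    (l : Q ⟶ P) (hl : ∀ j, QuasiIso (l.app j)) : ∃ s : P ⟶ Q, (∀ j, QuasiIso (s.app j)) ∧
      ∀ (T : CovDiagram k n) (i : ℤ),
        HomologicalComplex.homologyMap (tensorOverMap s (𝟙 T)) i ≫
          HomologicalComplex.homologyMap (tensorOverMap l (𝟙 T)) i = 𝟙 _ := by
  obtain ⟨G, hG⟩ := hP (pathDiagramSnd l (𝟙 P))
    (fun j => isAcyclicFibration_pathSnd (l.app j) (hl j)) (𝟙 P)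
  refine ⟨G ≫ pathDiagramFst l (𝟙 P), fun j => ?_, fun T i => ?_⟩
  · have h1 : QuasiIso ((G ≫ pathDiagramFst l (𝟙 P)).app j ≫ l.app j) := by
      have h2 : ∀ i, HomologicalComplex.homologyMap
          ((G ≫ pathDiagramFst l (𝟙 P)).app j ≫ l.app j) i = 𝟙 _ := fun i => by
        have h3 := homologyMap_path (l.app j) ((𝟙 P : P ⟶ P).app j) i
        let G' : P.obj j ⟶ path (l.app j) ((𝟙 P : P ⟶ P).app j) := G.app j
        have h4 : G' ≫ pathSnd (l.app j) ((𝟙 P : P ⟶ P).app j) ≫ (𝟙 P : P ⟶ P).app j =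
          𝟙 _ := congrArg (fun e : P ⟶ P => e.app j) hG
        change HomologicalComplex.homologyMap ((G' ≫ pathFst _ _) ≫ l.app j) i = _
        rw [Category.assoc, HomologicalComplex.homologyMap_comp, h3,
          ← HomologicalComplex.homologyMap_comp, h4, HomologicalComplex.homologyMap_id]
      rw [quasiIso_iff]
      intro i
      rw [quasiIsoAt_iff_isIso_homologyMap, h2]
      infer_instance
    have := hl j
    exact quasiIso_of_comp_right _ (l.app j)
  · rw [← HomologicalComplex.homologyMap_comp, ← tensorOverMap_comp, Category.assoc,
      tensorOverMap_comp, HomologicalComplex.homologyMap_comp, homologyMap_pathDiagram,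
      ← HomologicalComplex.homologyMap_comp, ← tensorOverMap_comp, Category.comp_id,
      Category.comp_id, hG, tensorOverMap_id, HomologicalComplex.homologyMap_id]

/-- Tensor products of cofibrant diagrams with a diagram preserve objectwise
quasi-isomorphisms. -/
lemma IsCofibrantDiagram.isIso_homologyMap {P Q : ContraDiagram k n} (hP : IsCofibrantDiagram P)
    (hQ : IsCofibrantDiagram Q) (l : Q ⟶ P) (hl : ∀ j, QuasiIso (l.app j)) (T : CovDiagram k n)
    (i : ℤ) : IsIso (HomologicalComplex.homologyMap (tensorOverMap l (𝟙 T)) i) := by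
  obtain ⟨s, hs, h1⟩ := hP.exists_section l hl
  obtain ⟨t, -, h2⟩ := hQ.exists_section s hs
  -- On homology `s` has an inverse on either side, namely `l` and `t`; these must coincide.
  have h3 : HomologicalComplex.homologyMap (tensorOverMap t (𝟙 T)) i =
      HomologicalComplex.homologyMap (tensorOverMap l (𝟙 T)) i := by
    rw [← Category.comp_id (HomologicalComplex.homologyMap (tensorOverMap t (𝟙 T)) i), ← h1 T i,
      ← Category.assoc, h2, Category.id_comp]
  exact ⟨_, h3 ▸ h2 T i, h1 T i⟩

end PathDiagram

/-! ### The Koszul complex as a tensor product with the resolution -/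

section Comparison

open PrunedTree

variable {k : Type u} [CommRing k] {n : ℕ} (S : ContraDiagram k n) (T : CovDiagram k n)

lemma add_homDeg_add {θ σ : PrunedTree n} {f : θ ⟶ σ} {F : Factorization f} {p q r i : ℤ}
    (hr : r + homDeg F.left = p) (h : p + q = i) : r + homDeg F.left + q = i := by
  rw [hr, h]

/-- The pairing `(x ⊗ {u} ⊗ [w], y) ↦ x ⊗ {u} ⊗ w_*(y)`. -/
noncomputable def pairing (θ : PrunedTree n) {p q i : ℤ} (h : p + q = i) :
    KoszulX S (freeAt k θ) p →ₗ[k] (T.obj θ).X q →ₗ[k] KoszulX S T i :=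
  desc (M := (T.obj θ).X q →ₗ[k] KoszulX S T i) fun F r hr =>
    ((TensorProduct.mk k _ _).compr₂ (koszulIncl S T F.left r q (add_homDeg_add hr h))).compl₂
      ((T.map F.right).f q).hom

variable {S T}

lemma pairing_gen {θ σ : PrunedTree n} {p q i : ℤ} (h : p + q = i) {f : θ ⟶ σ}
    (F : Factorization f) (r : ℤ) (hr : r + homDeg F.left = p) (x : (S.obj (op σ)).X r)
    (y : (T.obj θ).X q) : pairing S T θ h (gen S F r hr x) y =
      koszulIncl S T F.left r q (add_homDeg_add hr h) (x ⊗ₜ (T.map F.right).f q y) := by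
  rw [pairing, desc_gen]
  rfl

/-- Pulling back along a morphism precomposes `[w]`, which amounts to pushing `y` forward. Hence the
pairing descends to the coend. -/
lemma pairing_map {θ τ : PrunedTree n} (w : τ ⟶ θ) {p q i : ℤ} (h : p + q = i)
    (z : KoszulX S (freeAt k θ) p) (y : (T.obj τ).X q) :
    pairing S T τ h (koszulXMap (𝟙 S) (freeMap w) p z) y =
      pairing S T θ h z ((T.map w).f q y) := by
  refine LinearMap.congr_fun (f := (pairing S T τ h).flip y ∘ₗ koszulXMap (𝟙 S) (freeMap w) p)
    (g := (pairing S T θ h).flip ((T.map w).f q y)) (koszulX_ext fun {σ f} F r hr x => ?_) z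
  change pairing S T τ h (koszulXMap (𝟙 S) (freeMap w) p (gen S F r hr x)) y =
    pairing S T θ h (gen S F r hr x) ((T.map w).f q y)
  rw [koszulXMap_gen, pairing_gen, pairing_gen]
  exact congrArg (fun y' => koszulIncl S T F.left r q (add_homDeg_add hr h) (x ⊗ₜ y'))
    (diagram_map_comp T w F.right q y)

lemma pairing_units_smul {θ : PrunedTree n} {p q i : ℤ} (h : p + q = i) (ε : ℤˣ)
    (z : KoszulX S (freeAt k θ) p) (y : (T.obj θ).X q) :
    pairing S T θ h (ε • z) y = ε • pairing S T θ h z y :=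
  map_units_smul ((pairing S T θ h).flip y) ε z

lemma pairing_d {θ : PrunedTree n} {p q i p' q' j : ℤ} (h : p + q = i) (hp : p' + 1 = p)
    (hq : q' + 1 = q) (hij : j + 1 = i) (z : KoszulX S (freeAt k θ) p) (y : (T.obj θ).X q) :
    koszulD S T hij (pairing S T θ h z y) =
      pairing S T θ (by omega) (koszulD S (freeAt k θ) hp z) y +
        p.negOnePow • pairing S T θ (by omega : p + q' = j) z ((T.obj θ).d q q' y) := by
  refine LinearMap.congr_fun (f := koszulD S T hij ∘ₗ (pairing S T θ h).flip y)
    (g := (pairing S T θ (by omega)).flip y ∘ₗ koszulD S (freeAt k θ) hp +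
      p.negOnePow • (pairing S T θ (by omega : p + q' = j)).flip ((T.obj θ).d q q' y))
    (koszulX_ext fun {σ f} F r hr x => ?_) z
  change koszulD S T hij (pairing S T θ h (gen S F r hr x) y) =
    pairing S T θ (by omega) (koszulD S (freeAt k θ) hp (gen S F r hr x)) y +
      p.negOnePow • pairing S T θ (by omega : p + q' = j) (gen S F r hr x) ((T.obj θ).d q q' y)
  obtain rfl : q' = q - 1 := by omega
  obtain rfl : p' = p - 1 := by omega
  subst hr
  rw [pairing_gen, koszulD_incl, koszulD_gen, pairing_gen, map_add, map_add, map_sum, map_sum,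
    LinearMap.add_apply, LinearMap.add_apply, LinearMap.sum_apply, LinearMap.sum_apply,
    pairing_gen, f_d_apply]
  have hL : ∀ L : LeftFactorization F.left,
      pairing S T θ (by omega : r + homDeg F.left - 1 + q = j)
        ((r.negOnePow * sgn L.1.left) • gen S (F.drop L.1) r
          (by rw [homDeg_drop_left]; omega) ((S.map L.1.left.op).f r x)) y =
      (r.negOnePow * sgn L.1.left) • koszulIncl S T L.1.right r q
        (by have := L.1.homDeg_eq; have := L.2; omega)
          ((S.map L.1.left.op).f r x ⊗ₜ (T.map F.right).f q y) := fun L => by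
    exact (pairing_units_smul _ _ _ y).trans
      (congrArg _ (pairing_gen _ (F.drop L.1) r _ _ y))
  have hR : ∀ R : RightFactorization F.left,
      pairing S T θ (by omega : r + homDeg F.left - 1 + q = j)
        (((r + homDeg R.1.left).negOnePow * sgn R.1.right) • gen S (F.push R.1) r
          (by rw [homDeg_push_left]; omega) x) y =
      ((r + homDeg R.1.left).negOnePow * sgn R.1.right) • koszulIncl S T R.1.left r q
        (by have := R.1.homDeg_eq; have := R.2; omega)
          (x ⊗ₜ (T.map R.1.right).f q ((T.map F.right).f q y)) := fun R => by
    rw [← diagram_map_comp T]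
    exact (pairing_units_smul _ _ _ y).trans
      (congrArg _ (pairing_gen _ (F.push R.1) r _ _ y))
  refine Eq.trans ?_ (congrArg (· + _) (congrArg₂ (· + ·) (congrArg (_ + ·)
    (Finset.sum_congr rfl fun L _ => (hL L).symm)) (Finset.sum_congr rfl fun R _ => (hR R).symm)))
  abel

/-- The comparison of tensors before passing to the coend. -/
noncomputable def preComparison (i : ℤ) : PreTensor (resolution S) T i →ₗ[k] KoszulX S T i :=
  DirectSum.toModule k (TensorIndex n i) (KoszulX S T i) fun a =>
    TensorProduct.lift (pairing S T a.obj a.deg_eq)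

lemma preComparison_incl {i : ℤ} (τ : PrunedTree n) (p q : ℤ) (h : p + q = i)
    (z : KoszulX S (freeAt k τ) p) (y : (T.obj τ).X q) :
    preComparison i (preTensorIncl (resolution S) T τ p q h (z ⊗ₜ y)) =
      pairing S T τ h z y := by
  rw [preComparison, preTensorIncl, DirectSum.toModule_lof]
  rfl

lemma coendRel_le_ker (i : ℤ) :
    coendRel (resolution S) T i ≤ LinearMap.ker (preComparison (S := S) (T := T) i) := by
  refine Submodule.span_le.2 ?_
  rintro _ ⟨τ, σ, w, p, q, h, z, y, rfl⟩
  change preComparison i (_ - _) = 0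
  rw [map_sub, sub_eq_zero]
  exact (preComparison_incl τ p q h _ y).trans ((pairing_map w h z y).trans
    (preComparison_incl σ p q h z _).symm)

lemma preComparison_comm {i j : ℤ} (hij : j + 1 = i) (z : PreTensor (resolution S) T i) :
    koszulD S T hij (preComparison i z) =
      preComparison j (preTensorD (resolution S) T hij z) := by
  refine LinearMap.congr_fun (f := koszulD S T hij ∘ₗ preComparison i)
    (g := preComparison j ∘ₗ preTensorD (resolution S) T hij)
    (preTensor_ext fun τ p q e x y => ?_) z
  change koszulD S T hij (preComparison i (preTensorIncl (resolution S) T τ p q e (x ⊗ₜ y))) =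
    preComparison j (preTensorD (resolution S) T hij
      (preTensorIncl (resolution S) T τ p q e (x ⊗ₜ y)))
  rw [preTensorD_incl, map_add, map_units_smul]
  refine (congrArg _ (preComparison_incl τ p q e x y)).trans ?_
  refine (pairing_d e (sub_add_cancel p 1) (sub_add_cancel q 1) hij x y).trans ?_
  refine congrArg₂ (· + ·) ?_ (congrArg _ (preComparison_incl τ p _ _ x _).symm)
  refine Eq.trans ?_ (preComparison_incl τ (p - 1) q _ _ y).symm
  exact congrArg (fun z => pairing S T τ (by omega : p - 1 + q = j) z y)
    (resolution_d S (op τ) (sub_add_cancel p 1) x).symm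

variable (S T)

/-- The comparison of the tensor product with the resolution and of the Koszul complex. -/
noncomputable def comparisonX (i : ℤ) :
    (PreTensor (resolution S) T i ⧸ coendRel (resolution S) T i) →ₗ[k] KoszulX S T i :=
  Submodule.liftQ _ (preComparison i) (coendRel_le_ker i)

/-- The comparison as a morphism of dg-modules. -/
noncomputable def comparison (hK : KoszulSquareZero S T) :
    tensorOver (resolution S) T ⟶ koszulComplex S T hK where
  f i := ModuleCat.ofHom (comparisonX S T i)
  comm' i j hij := by
    refine ModuleCat.hom_ext (Submodule.linearMap_qext _ (LinearMap.ext fun z => ?_))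
    change (koszulComplex S T hK).d i j (preComparison i z) =
      comparisonX S T j ((tensorOver (resolution S) T).d i j
        ((coendRel (resolution S) T i).mkQ z))
    rw [koszulComplex_d S T hK hij, tensorOver_d _ _ hij]
    exact preComparison_comm (show j + 1 = i from hij) z

/-- The inverse `x ⊗ {u} ⊗ y ↦ (x ⊗ {u} ⊗ [id]) ⊗ y` of the comparison. -/
noncomputable def comparisonInv (i : ℤ) :
    KoszulX S T i →ₗ[k] (PreTensor (resolution S) T i ⧸ coendRel (resolution S) T i) :=
  DirectSum.toModule k (KoszulIndex n i) _ fun a => (coendRel (resolution S) T i).mkQ ∘ₗ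
    preTensorIncl (resolution S) T a.src (a.p + homDeg a.u) a.q a.deg_eq ∘ₗ
      (gen S (sourceFactorization a.u) a.p (add_homDeg_source rfl)).rTensor _

lemma comparisonInv_incl {i : ℤ} {τ σ : PrunedTree n} (u : τ ⟶ σ) (p q : ℤ)
    (h : p + homDeg u + q = i) (x : (S.obj (op σ)).X p) (y : (T.obj τ).X q) :
    comparisonInv S T i (koszulIncl S T u p q h (x ⊗ₜ y)) = (coendRel (resolution S) T i).mkQ
      (preTensorIncl (resolution S) T τ (p + homDeg u) q h
        (gen S (sourceFactorization u) p (add_homDeg_source rfl) x ⊗ₜ y)) := by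
  rw [comparisonInv, koszulIncl, DirectSum.toModule_lof]
  rfl

lemma comparisonX_comparisonInv (i : ℤ) :
    comparisonX S T i ∘ₗ comparisonInv S T i = LinearMap.id := by
  refine DirectSum.linearMap_ext _ fun a => TensorProduct.ext' fun x y => ?_
  obtain ⟨τ, σ, u, p, q, h⟩ := a
  change comparisonX S T i (comparisonInv S T i (koszulIncl S T u p q h (x ⊗ₜ y))) =
    koszulIncl S T u p q h (x ⊗ₜ y)
  rw [comparisonInv_incl]
  refine (preComparison_incl τ _ q h _ y).trans ?_
  rw [pairing_gen]
  have : T.map (𝟙 τ) = 𝟙 _ := T.map_id τ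
  change koszulIncl S T u p q h (x ⊗ₜ (T.map (𝟙 τ)).f q y) = _
  rw [this]
  rfl

lemma comparisonInv_comparisonX (i : ℤ) :
    comparisonInv S T i ∘ₗ comparisonX S T i = LinearMap.id := by
  refine Submodule.linearMap_qext _ (preTensor_ext fun τ p q e z y => ?_)
  change comparisonInv S T i (preComparison i
    (preTensorIncl (resolution S) T τ p q e (z ⊗ₜ y))) =
      (coendRel (resolution S) T i).mkQ (preTensorIncl (resolution S) T τ p q e (z ⊗ₜ y))
  refine (congrArg _ (preComparison_incl τ p q e z y)).trans ?_
  change KoszulX S (freeAt k τ) p at z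
  let B : KoszulX S (freeAt k τ) p →ₗ[k]
      (PreTensor (resolution S) T i ⧸ coendRel (resolution S) T i) :=
    ((coendRel (resolution S) T i).mkQ ∘ₗ preTensorIncl (resolution S) T τ p q e) ∘ₗ
      (TensorProduct.mk k (((resolution S).obj (op τ)).X p) ((T.obj τ).X q)).flip y
  refine LinearMap.congr_fun (f := comparisonInv S T i ∘ₗ (pairing S T τ e).flip y) (g := B)
    (koszulX_ext fun {σ f} F r hr x => ?_) z
  change comparisonInv S T i (pairing S T τ e (gen S F r hr x) y) =
    (coendRel (resolution S) T i).mkQ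
      (preTensorIncl (resolution S) T τ p q e (gen S F r hr x ⊗ₜ y))
  subst hr
  rw [pairing_gen, comparisonInv_incl, eq_comm, ← sub_eq_zero, ← map_sub, Submodule.mkQ_apply,
    Submodule.Quotient.mk_eq_zero]
  -- The coend relation for the right factor moves it from `[w]` to `y`, which leaves the generator
  -- with `[id]`.
  refine Submodule.subset_span ⟨τ, F.mid, F.right, _, q, e,
    gen S (sourceFactorization F.left) r (add_homDeg_source rfl) x, y, ?_⟩
  rw [← koszulXMap_source S F r rfl x]
  rfl

end Comparison

/-! ### The homology of the Koszul complex -/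

section KoszulHomology

open PrunedTree HomologicalComplex

variable {k : Type u} [CommRing k] {n : ℕ}

lemma isIso_comparison (S : ContraDiagram k n) (T : CovDiagram k n) (hK : KoszulSquareZero S T) :
    IsIso (comparison S T hK) := by
  have (i : ℤ) : IsIso ((comparison S T hK).f i) :=
    ⟨ModuleCat.ofHom (comparisonInv S T i),
      ModuleCat.hom_ext (comparisonInv_comparisonX S T i),
      ModuleCat.hom_ext (comparisonX_comparisonInv S T i)⟩
  exact Hom.isIso_of_components _

lemma comparison_naturality {S S' : ContraDiagram k n} {T T' : CovDiagram k n} (f : S ⟶ S')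
    (g : T ⟶ T') (hK : KoszulSquareZero S T) (hK' : KoszulSquareZero S' T') :
    tensorOverMap (resolutionMap f) g ≫ comparison S' T' hK' =
      comparison S T hK ≫ koszulMap f g hK hK' := by
  ext i : 1
  refine ModuleCat.hom_ext (Submodule.linearMap_qext _ (preTensor_ext fun τ p q e z y => ?_))
  change preComparison i (preTensorMap (resolutionMap f) g i
      (preTensorIncl (resolution S) T τ p q e (z ⊗ₜ y))) =
    koszulXMap f g i (preComparison i (preTensorIncl (resolution S) T τ p q e (z ⊗ₜ y)))
  rw [preTensorMap_incl]
  refine (preComparison_incl τ p q e _ _).trans (Eq.trans ?_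
    (congrArg (koszulXMap f g i) (preComparison_incl τ p q e z y).symm))
  change KoszulX S (freeAt k τ) p at z
  refine LinearMap.congr_fun
    (f := (pairing S' T' τ e).flip ((g.app τ).f q y) ∘ₗ koszulXMap f (𝟙 (freeAt k τ)) p)
    (g := koszulXMap f g i ∘ₗ (pairing S T τ e).flip y)
    (koszulX_ext fun {σ a} F r hr x => ?_) z
  change pairing S' T' τ e (koszulXMap f (𝟙 (freeAt k τ)) p (gen S F r hr x))
      ((g.app τ).f q y) = koszulXMap f g i (pairing S T τ e (gen S F r hr x) y)
  rw [koszulXMap_id_gen, pairing_gen, pairing_gen, koszulXMap_incl, nat_apply]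

/-- The resolution of an objectwise cofibrant diagram as a cofibrant replacement. -/
noncomputable def standardReplacement (S : ContraDiagram k n) (hS : IsDGCofibrant S) :
    CofibrantReplacement S where
  Q := resolution S
  cofibrant := isCofibrantDiagram_resolution hS
  q := augmentation S
  quasiIso j := (isAcyclicFibration_augmentation S j).2

namespace CofibrantReplacement

variable {S S' : ContraDiagram k n} {T T' : CovDiagram k n} (R : CofibrantReplacement S)
  (R' : CofibrantReplacement S')

/-- A lift of the augmentation of a cofibrant replacement to the resolution. -/
noncomputable def toResolution : R.Q ⟶ resolution S :=
  (R.cofibrant (augmentation S) (isAcyclicFibration_augmentation S) R.q).choose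

lemma toResolution_augmentation : R.toResolution ≫ augmentation S = R.q :=
  (R.cofibrant (augmentation S) (isAcyclicFibration_augmentation S) R.q).choose_spec

lemma quasiIso_toResolution (j : (PrunedTree n)ᵒᵖ) : QuasiIso (R.toResolution.app j) := by
  have h1 := (isAcyclicFibration_augmentation S j).2
  have h2 : QuasiIso (R.toResolution.app j ≫ (augmentation S).app j) := by
    rw [← NatTrans.comp_app, toResolution_augmentation]
    exact R.quasiIso j
  exact quasiIso_of_comp_right _ ((augmentation S).app j)

variable (T) in
/-- The comparison of the tensor product with a cofibrant replacement and of the Koszul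
complex. -/
noncomputable def toKoszul (hK : KoszulSquareZero S T) : tensorOver R.Q T ⟶ koszulComplex S T hK :=
  tensorOverMap R.toResolution (𝟙 T) ≫ comparison S T hK

lemma isIso_homologyMap_toKoszul (hS : IsDGCofibrant S) (hK : KoszulSquareZero S T) (i : ℤ) :
    IsIso (homologyMap (R.toKoszul T hK) i) := by
  have h1 := (isCofibrantDiagram_resolution hS).isIso_homologyMap R.cofibrant R.toResolution
    R.quasiIso_toResolution T i
  have h2 := isIso_comparison S T hK
  rw [toKoszul, homologyMap_comp]
  infer_instance

/-- The two ways around the square from `R.Q` to the resolution of `S'` agree after the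
augmentation, which is an acyclic fibration. As `R.Q` is cofibrant, they induce the same map on
homology. -/
lemma homologyMap_toKoszul_naturality (f : S ⟶ S') (g : T ⟶ T') (f' : R.Q ⟶ R'.Q)
    (h : f' ≫ R'.q = R.q ≫ f) (hK : KoszulSquareZero S T) (hK' : KoszulSquareZero S' T') (i : ℤ) :
    homologyMap (tensorOverMap f' g) i ≫ homologyMap (R'.toKoszul T' hK') i =
      homologyMap (R.toKoszul T hK) i ≫ homologyMap (koszulMap f g hK hK') i := by
  have h1 : homologyMap (tensorOverMap (f' ≫ R'.toResolution) (𝟙 T)) i =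
      homologyMap (tensorOverMap (R.toResolution ≫ resolutionMap f) (𝟙 T)) i :=
    R.cofibrant.homologyMap_eq (augmentation S') (isAcyclicFibration_augmentation S')
      (by rw [Category.assoc, Category.assoc, augmentation_naturality,
        toResolution_augmentation, h, ← Category.assoc, toResolution_augmentation]) T i
  have h2 : ∀ {P P' : ContraDiagram k n} (a : P ⟶ P'),
      tensorOverMap a g = tensorOverMap a (𝟙 T) ≫ tensorOverMap (𝟙 P') g := fun a => by
    rw [← tensorOverMap_comp, Category.comp_id, Category.id_comp]
  rw [toKoszul, toKoszul, ← homologyMap_comp, ← homologyMap_comp, Category.assoc,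
    ← comparison_naturality, ← Category.assoc, ← Category.assoc, ← tensorOverMap_comp,
    ← tensorOverMap_comp, Category.comp_id, Category.id_comp, homologyMap_comp, homologyMap_comp,
    h2 (f' ≫ _), h2 (R.toResolution ≫ _), homologyMap_comp, homologyMap_comp, h1]

end CofibrantReplacement

end KoszulHomology

theorem mainTheorem3 (k : Type u) [CommRing k] (n : ℕ) :
    ∃ hK : ∀ (S : ContraDiagram k n) (T : CovDiagram k n), KoszulSquareZero S T,
      (∀ S : ContraDiagram k n, IsDGCofibrant S → Nonempty (CofibrantReplacement S)) ∧
      ∃ φ : ∀ (S : ContraDiagram k n) (T : CovDiagram k n),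
          IsDGCofibrant S → IsDGCofibrant T → ∀ (R : CofibrantReplacement S) (i : ℤ),
            R.Tor T i ≅ (koszulComplex S T (hK S T)).homology i,
        ∀ (S S' : ContraDiagram k n) (T T' : CovDiagram k n)
          (hS : IsDGCofibrant S) (hS' : IsDGCofibrant S')
          (hT : IsDGCofibrant T) (hT' : IsDGCofibrant T')
          (R : CofibrantReplacement S) (R' : CofibrantReplacement S')
          (f : S ⟶ S') (g : T ⟶ T') (f' : R.Q ⟶ R'.Q), f' ≫ R'.q = R.q ≫ f →
          ∀ i : ℤ,
            HomologicalComplex.homologyMap (tensorOverMap f' g) i ≫ (φ S' T' hS' hT' R' i).hom =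
              (φ S T hS hT R i).hom ≫
                HomologicalComplex.homologyMap (koszulMap f g (hK S T) (hK S' T')) i := by
  refine ⟨koszulSquareZero, fun S hS => ⟨standardReplacement S hS⟩, fun S T hS _ R i =>
    have := R.isIso_homologyMap_toKoszul hS (koszulSquareZero S T) i
    asIso (HomologicalComplex.homologyMap (R.toKoszul T (koszulSquareZero S T)) i), ?_⟩
  intro S S' T T' hS hS' hT hT' R R' f g f' h i
  exact R.homologyMap_toKoszul_naturality R' f g f' h _ _ i
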